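/- **Model.** Let $N\ge 2$ and $x\in\{0,1\}^N$, accessed through the phase oracle $O_x|i,b\rangle=(-1)^{x(i)\,b}|i,b\rangle$ on a query register that holds an index $i$ ($\lceil\log_2 N\rceil$ qubits; index strings outside $\{0,\dots,N-1\}$ get no phase) and a bit $b$. A *PDQP query algorithm* acts on finitely many qubits that start in $|0\cdots 0\rangle$ and is a fixed finite sequence of steps; each step applies an arbitrary unitary, then a collapsing computational-basis measurement of some (possibly empty) set of the qubits, and then either one application of $O_x$ to the query register or one *non-collapsing measurement*, which samples a string from the current state by the Born rule without changing the state. Neither the steps nor the unitaries depend on $x$ or on measurement results. At the end a fixed function of the list of all the non-collapsing samples gives the output. A *non-adaptive* PDQP query algorithm with $Q$ queries applies a unitary to $|0\cdots0\rangle$, then $O_x^{\otimes Q}$ in parallel to $Q$ query registers, and after that only steps that end with a non-collapsing measurement. An algorithm computes $f:\{0,1\}^N\to\{0,1\}$ if for every $x$ its output is $f(x)$ with probability at least $2/3$. The (adaptive or non-adaptive) PDQP query complexity of $f$ is the minimum of $Q+P$ over all (adaptive or non-adaptive) algorithms that compute $f$, where $Q$ is the number of queries and $P$ the number of non-collapsing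 measurements. Let $\mathrm{MAJ}_N(x)=1$ iff $|\{i:x(i)=1\}|\ge N/2$, and $\mathrm{PARITY}_N(x)=\bigoplus_i x(i)$. **Theorem.** (1) Both the adaptive and the non-adaptive PDQP query complexities of $\mathrm{MAJ}_N$ and of $\mathrm{PARITY}_N$ are $\tilde\Theta(\sqrt N)$: for each of these four quantities $q(N)$ there are constants $c,C>0$ and $k\in\mathbb N$ such that $q(N)$ is finite and $$c\sqrt N\;\le\; q(N)\;\le\; C\sqrt N\,(\log N)^k\qquad\text{for all } N\ge 2 .$$ (2) For $O:\{0,1\}^*\to\{0,1\}$ let $\mathsf{PP}^O$ and $\oplus\mathsf P^O$ be the usual relativized classes, and let $\mathsf{PDQP}^O$ be the class of languages decided with error probability at most $1/3$ by a deterministic polynomial-time Turing machine with oracle $O$ that makes one query to a sampler; the sampler takes a description of a quantum circuit $(U_1,M_1,\dots,U_P,M_P)$, where each $U_i$ is a product of gates from a finite universal set and of phase-oracle gates for $O$ and each $M_i$ is a collapsing computational-basis measurement of some qubits, and returns the results $v_1,\dots,v_P$ of non-collapsing measurements of all the qubits after $M_1,\dots,M_P$ in one run. Then there is an oracle $O$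 with $\mathsf{PP}^O\not\subseteq\mathsf{PDQP}^O$, and there is an oracle $O$ with $\oplus\mathsf P^O\not\subseteq\mathsf{PDQP}^O$. -/

import Mathlib

namespace Noncollapsing

noncomputable section

/-! ### Quantum states on qubits and non-collapsing measurements -/

/-- Computational basis of a system whose qubits are labelled by `ι`. -/
abbrev Basis (ι : Type) := ι → Bool

/-- Amplitude vectors. -/
abbrev State (ι : Type) := Basis ι → ℂ

/-- The state `|0…0⟩`. -/
def zeroState (ι : Type) [Fintype ι] : State ι :=
  Pi.single (fun _ => false) 1

/-- Squared Euclidean norm of an amplitude vector. -/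
def normSq {ι : Type} [Fintype ι] [DecidableEq ι] (ψ : State ι) : ℝ :=
  ∑ b, ‖ψ b‖ ^ 2

/-- Rescaling to a unit vector (the zero vector stays zero). -/
def normalize {ι : Type} [Fintype ι] [DecidableEq ι] (ψ : State ι) : State ι :=
  fun b => ((Real.sqrt (normSq ψ))⁻¹ : ℝ) * ψ b

/-- Projection onto the outcome `m` of a computational basis measurement of the qubits in `S`. -/
def project {ι : Type} [DecidableEq ι] (S : Finset ι) (m : S → Bool) (ψ : State ι) : State ι :=
  fun b => if ∀ q : S, b q = m q then ψ b else 0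

/-- One step of a circuit: a unitary `evolve`, then a (possibly empty) collapsing measurement of
the qubits in `measured`; after that the step ends either with a query operator (`some O`) or with
a non-collapsing measurement of all the qubits (`none`). -/
structure Stage (ι : Type) where
  evolve : State ι → State ι
  measured : Finset ι
  query : Option (State ι → State ι)

/-- The probability that the list of results of the non-collapsing measurements satisfies `A`,
when the given stages are run from the unit vector `ψ`. A collapsing measurement replaces the state
by the renormalized projection on its (random) outcome; a non-collapsing measurement samples a
basis state by the Born rule and leaves the state as it is. -/
def eventProb {ι : Type} [Fintype ι] [DecidableEq ι] :
    List (Stage ι) → State ι → (List (Basis ι) → Bool) → ℝ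
  | [], _, A => if A [] then 1 else 0
  | s :: rest, ψ, A =>
    ∑ m : s.measured → Bool,
      normSq (project s.measured m (s.evolve ψ)) *
        (match s.query with
          | some O => eventProb rest (O (normalize (project s.measured m (s.evolve ψ)))) A
          | none => ∑ v : Basis ι,
              ‖normalize (project s.measured m (s.evolve ψ)) v‖ ^ 2 *
                eventProb rest (normalize (project s.measured m (s.evolve ψ)))
                  (fun vs => A (v :: vs)))

/-! ### The query model -/

/-- A query register for inputs of length `N`: index qubits and one control qubit. -/
abbrev QueryReg (N : ℕ) := Fin (Nat.clog 2 N) ⊕ Unit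

/-- The exponent `x(i) · b` of the phase oracle on the basis state `|i, b⟩` of a query register.
Index strings that do not denote an element of `{0, …, N - 1}` get no phase; there are none of
them if `N` is a power of two. -/
def phaseBit {N : ℕ} (x : Fin N → Bool) (r : Basis (QueryReg N)) : Bool :=
  (if h : Nat.ofBits (fun j => r (Sum.inl j)) < N then x ⟨_, h⟩ else false) && r (Sum.inr ())

/-- The sign `(-1)^(x(i) · b)`. -/
def phaseSign {N : ℕ} (x : Fin N → Bool) (r : Basis (QueryReg N)) : ℂ :=
  if phaseBit x r then -1 else 1

/-- A step of a query algorithm: a unitary, the qubits that are measured (with collapse) after it,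
and whether the step ends with a query or with a non-collapsing measurement. -/
structure Step (ι : Type) [Fintype ι] [DecidableEq ι] where
  U : Matrix.unitaryGroup (Basis ι) ℂ
  measured : Finset ι
  isQuery : Bool

/-- A query algorithm with non-collapsing measurements and adaptive queries. It acts on one query
register and `work` further qubits; `decision` is the classical processing of the samples. -/
structure Algorithm (N : ℕ) where
  work : ℕ
  steps : List (Step (QueryReg N ⊕ Fin work))
  decision : List (Basis (QueryReg N ⊕ Fin work)) → Bool

/-- The phase oracle `O_x` on the query register. -/
def phaseOracle {N w : ℕ} (x : Fin N → Bool) (ψ : State (QueryReg N ⊕ Fin w)) :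
    State (QueryReg N ⊕ Fin w) :=
  fun b => phaseSign x (fun j => b (Sum.inl j)) * ψ b

/-- The stages of an adaptive algorithm when it is run on the input `x`. -/
def Algorithm.stages {N : ℕ} (A : Algorithm N) (x : Fin N → Bool) :
    List (Stage (QueryReg N ⊕ Fin A.work)) :=
  A.steps.map fun s =>
    { evolve := fun ψ => s.U.1.mulVec ψ
      measured := s.measured
      query := if s.isQuery then some (phaseOracle x) else none }

/-- Number of queries. -/
def Algorithm.queries {N : ℕ} (A : Algorithm N) : ℕ :=
  (A.steps.filter fun s => s.isQuery).length

/-- Number of non-collapsing measurements. -/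
def Algorithm.samples {N : ℕ} (A : Algorithm N) : ℕ :=
  (A.steps.filter fun s => !s.isQuery).length

/-- The algorithm computes `f` with error probability at most `1/3` on every input. -/
def Algorithm.Computes {N : ℕ} (A : Algorithm N) (f : (Fin N → Bool) → Bool) : Prop :=
  ∀ x, 2 / 3 ≤ eventProb (A.stages x) (zeroState _) (fun vs => A.decision vs == f x)

/-- A query algorithm with non-collapsing measurements and non-adaptive queries: a unitary `U₀`,
one parallel application of the oracle to `queries` query registers, and then steps that consist
of a unitary, a collapsing measurement and a non-collapsing measurement. -/
structure NonadaptiveAlgorithm (N : ℕ) where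
  queries : ℕ
  work : ℕ
  U₀ : Matrix.unitaryGroup (Basis (Fin queries × QueryReg N ⊕ Fin work)) ℂ
  steps : List (Matrix.unitaryGroup (Basis (Fin queries × QueryReg N ⊕ Fin work)) ℂ ×
    Finset (Fin queries × QueryReg N ⊕ Fin work))
  decision : List (Basis (Fin queries × QueryReg N ⊕ Fin work)) → Bool

/-- The parallel phase oracle on `Q` query registers. -/
def parallelOracle {N Q w : ℕ} (x : Fin N → Bool)
    (ψ : State (Fin Q × QueryReg N ⊕ Fin w)) : State (Fin Q × QueryReg N ⊕ Fin w) :=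
  fun b => (∏ t : Fin Q, phaseSign x (fun j => b (Sum.inl (t, j)))) * ψ b

/-- The stages that follow the parallel query. -/
def NonadaptiveAlgorithm.stages {N : ℕ} (A : NonadaptiveAlgorithm N) :
    List (Stage (Fin A.queries × QueryReg N ⊕ Fin A.work)) :=
  A.steps.map fun s =>
    { evolve := fun ψ => s.1.1.mulVec ψ
      measured := s.2
      query := none }

/-- Number of non-collapsing measurements. -/
def NonadaptiveAlgorithm.samples {N : ℕ} (A : NonadaptiveAlgorithm N) : ℕ :=
  A.steps.length

/-- The algorithm computes `f` with error probability at most `1/3` on every input. -/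
def NonadaptiveAlgorithm.Computes {N : ℕ} (A : NonadaptiveAlgorithm N)
    (f : (Fin N → Bool) → Bool) : Prop :=
  ∀ x, 2 / 3 ≤ eventProb A.stages (parallelOracle x (A.U₀.1.mulVec (zeroState _)))
    (fun vs => A.decision vs == f x)

/-- Least number of queries plus non-collapsing measurements of an adaptive algorithm for `f`
(`⊤` if there is no algorithm). -/
def complexity {N : ℕ} (f : (Fin N → Bool) → Bool) : ℕ∞ :=
  ⨅ (A : Algorithm N) (_ : A.Computes f), ((A.queries + A.samples : ℕ) : ℕ∞)

/-- Least number of queries plus non-collapsing measurements of a non-adaptive algorithm for `f`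
(`⊤` if there is no algorithm). -/
def nonadaptiveComplexity {N : ℕ} (f : (Fin N → Bool) → Bool) : ℕ∞ :=
  ⨅ (A : NonadaptiveAlgorithm N) (_ : A.Computes f), ((A.queries + A.samples : ℕ) : ℕ∞)

/-- Number of ones. -/
def hammingWeight {N : ℕ} (x : Fin N → Bool) : ℕ :=
  (Finset.univ.filter fun i => x i = true).card

/-- Are at least half of the bits equal to one? -/
def majority (N : ℕ) (x : Fin N → Bool) : Bool :=
  decide (N ≤ 2 * hammingWeight x)

/-- The exclusive or of all the bits. -/
def parity (N : ℕ) (x : Fin N → Bool) : Bool :=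
  decide (Odd (hammingWeight x))

/-- `T N` is finite, at least of order `√N`, and at most of order `√N` up to a power of `log N`,
for all `N ≥ 2`. -/
def IsThetaTildeSqrt (T : ℕ → ℕ∞) : Prop :=
  ∃ c C : ℝ, 0 < c ∧ 0 < C ∧ ∃ k : ℕ, ∀ N : ℕ, 2 ≤ N → ∃ q : ℕ, T N = q ∧
    c * Real.sqrt N ≤ q ∧ (q : ℝ) ≤ C * Real.sqrt N * Real.log N ^ k

/-! ### Oracle Turing machines -/

/-- A two-way infinite tape over `{0, 1, blank}`; the scanned cell is the head of `right`, cells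
beyond the ends of the lists are blank. -/
structure Tape where
  left : List (Option Bool)
  right : List (Option Bool)

/-- The scanned symbol. -/
def Tape.read (t : Tape) : Option Bool := t.right.headD none

/-- Overwrite the scanned cell. -/
def Tape.write (t : Tape) (a : Option Bool) : Tape := ⟨t.left, a :: t.right.tail⟩

/-- Head movements. -/
inductive Move
  | left
  | stay
  | right

/-- Move the head. -/
def Tape.move (t : Tape) : Move → Tape
  | Move.left => ⟨t.left.tail, t.left.headD none :: t.right⟩
  | Move.stay => t
  | Move.right => ⟨t.read :: t.left, t.right.tail⟩

/-- The word from the scanned cell rightwards up to the first blank. -/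
def Tape.word (t : Tape) : List Bool := (t.right.takeWhile Option.isSome).reduceOption

/-- A tape with a word written on it and the head on its first letter. -/
def Tape.ofWord (w : List Bool) : Tape := ⟨[], w.map some⟩

/-- What a machine with states `σ` and tapes `κ` does in one step: halt; write a symbol and move
on each tape and change state; or ask the oracle about the word on the query tape and go to
one of two states according to the answer. -/
inductive Command (σ κ : Type)
  | halt
  | act (next : σ) (write : κ → Option Bool) (move : κ → Move)
  | ask (yes no : σ)

/-- Deterministic multi-tape oracle Turing machines. Tapes `0` and `1` hold the two input words,
tape `2` is the query tape, tape `3` the output tape, and there are `work` further tapes. The start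
state is `0`. -/
structure Machine where
  states : ℕ
  work : ℕ
  command : Fin (states + 1) → (Fin (work + 4) → Option Bool) →
    Command (Fin (states + 1)) (Fin (work + 4))

/-- Configurations. -/
structure Machine.Config (M : Machine) where
  state : Fin (M.states + 1)
  tapes : Fin (M.work + 4) → Tape

/-- The start configuration on the inputs `x` and `y`. -/
def Machine.start (M : Machine) (x y : List Bool) : M.Config where
  state := 0
  tapes := fun i => if i.val = 0 then Tape.ofWord x else if i.val = 1 then Tape.ofWord y
    else Tape.ofWord []

/-- The command that is executed in a configuration. -/
def Machine.current (M : Machine) (c : M.Config) :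
    Command (Fin (M.states + 1)) (Fin (M.work + 4)) :=
  M.command c.state fun i => (c.tapes i).read

/-- One step with the oracle `O` (halted configurations do not change). -/
def Machine.next (M : Machine) (O : List Bool → Bool) (c : M.Config) : M.Config :=
  match M.current c with
  | Command.halt => c
  | Command.act q w m => ⟨q, fun i => ((c.tapes i).write (w i)).move (m i)⟩
  | Command.ask yes no => ⟨if O (c.tapes 2).word then yes else no, c.tapes⟩

/-- On the inputs `x`, `y` and with the oracle `O`, the machine halts within `T` steps with the
word `z` on its output tape. -/
def Machine.Outputs (M : Machine) (O : List Bool → Bool) (x y : List Bool) (T : ℕ)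
    (z : List Bool) : Prop :=
  M.current ((M.next O)^[T] (M.start x y)) = Command.halt ∧
    (((M.next O)^[T] (M.start x y)).tapes 3).word = z

/-! ### Relativized complexity classes -/

/-- A language. -/
abbrev Lang := Set (List Bool)

/-- The number of strings `y` of length `n` such that `M` accepts `(x, y)`, that is, it outputs `1`
within `T` steps. -/
def acceptCount (M : Machine) (O : List Bool → Bool) (x : List Bool) (n T : ℕ) : ℕ :=
  Nat.card {y : Fin n → Bool // M.Outputs O x (List.ofFn y) T [true]}

/-- `M` halts within `T` steps on `(x, y)` for all `y` of length `n`. -/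
def HaltsOnAll (M : Machine) (O : List Bool → Bool) (x : List Bool) (n T : ℕ) : Prop :=
  ∀ y : Fin n → Bool, ∃ z, M.Outputs O x (List.ofFn y) T z

/-- The class `PP` relative to `O`: for some polynomial-time machine, `x ∈ L` if and only if more
than half of the witness strings of polynomial length are accepted. -/
def PP (O : List Bool → Bool) : Set Lang :=
  {L | ∃ (M : Machine) (p r : Polynomial ℕ), ∀ x : List Bool,
    HaltsOnAll M O x (r.eval x.length) (p.eval x.length) ∧
    (x ∈ L ↔ 2 ^ (r.eval x.length) <
      2 * acceptCount M O x (r.eval x.length) (p.eval x.length))}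

/-- The class `⊕P` relative to `O`: for some polynomial-time machine, `x ∈ L` if and only if the
number of accepted witness strings of polynomial length is odd. -/
def ParityP (O : List Bool → Bool) : Set Lang :=
  {L | ∃ (M : Machine) (p r : Polynomial ℕ), ∀ x : List Bool,
    HaltsOnAll M O x (r.eval x.length) (p.eval x.length) ∧
    (x ∈ L ↔ Odd (acceptCount M O x (r.eval x.length) (p.eval x.length)))}

/-- Gates on `l` qubits: a universal gate set and oracle gates, which query the string on the qubits
`qs` with the control qubit `b`. -/
inductive Gate (l : ℕ)
  | hadamard (q : Fin l)
  | phase (q : Fin l)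
  | cnot (c t : Fin l)
  | oracle (qs : List (Fin l)) (b : Fin l)

/-- The action of a gate: Hadamard, `diag(1, exp(iπ/4))`, controlled not (the identity if control
and target coincide), and the phase oracle `|i, b⟩ ↦ (-1)^(O(i) · b) |i, b⟩`. -/
def Gate.apply {l : ℕ} (O : List Bool → Bool) : Gate l → State (Fin l) → State (Fin l)
  | Gate.hadamard q, ψ => fun b =>
      (ψ (Function.update b q false) +
        (if b q then -1 else 1) * ψ (Function.update b q true)) / (Real.sqrt 2 : ℝ)
  | Gate.phase q, ψ => fun b =>
      (if b q then Complex.exp (Complex.I * Real.pi / 4) else 1) * ψ b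
  | Gate.cnot c t, ψ => fun b =>
      if c = t then ψ b else ψ (Function.update b t (xor (b t) (b c)))
  | Gate.oracle qs a, ψ => fun b => (if O (qs.map b) && b a then -1 else 1) * ψ b

/-- A circuit `(U₁, M₁, …, U_P, M_P)` on `width` qubits: each step consists of a list of gates and
the list of qubits that are then measured with collapse. -/
structure Circuit where
  width : ℕ
  steps : List (List (Gate width) × List (Fin width))

/-- The stages of a circuit with the oracle `O`: a non-collapsing measurement ends each step. -/
def Circuit.stages (C : Circuit) (O : List Bool → Bool) : List (Stage (Fin C.width)) :=
  C.steps.map fun s =>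
    { evolve := fun ψ => s.1.foldl (fun φ g => g.apply O φ) ψ
      measured := s.2.toFinset
      query := none }

/-- Self-delimiting unary code of a number. -/
def encodeNat (n : ℕ) : List Bool := List.replicate n true ++ [false]

/-- Self-delimiting code of a list. -/
def encodeList {α : Type} (e : α → List Bool) (as : List α) : List Bool :=
  encodeNat as.length ++ as.flatMap e

/-- Code of a qubit label. -/
def encodeQubit {l : ℕ} (q : Fin l) : List Bool := encodeNat q.val

/-- Code of a gate. -/
def Gate.encode {l : ℕ} : Gate l → List Bool
  | Gate.hadamard q => encodeNat 0 ++ encodeQubit q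
  | Gate.phase q => encodeNat 1 ++ encodeQubit q
  | Gate.cnot c t => encodeNat 2 ++ encodeQubit c ++ encodeQubit t
  | Gate.oracle qs b => encodeNat 3 ++ encodeList encodeQubit qs ++ encodeQubit b

/-- Code of a circuit. -/
def Circuit.encode (C : Circuit) : List Bool :=
  encodeNat C.width ++
    encodeList (fun s => encodeList Gate.encode s.1 ++ encodeList encodeQubit s.2) C.steps

/-- The results of the non-collapsing measurements as one bit string. -/
def encodeSamples {l : ℕ} (vs : List (Basis (Fin l))) : List Bool :=
  vs.flatMap fun v => List.ofFn v

open Classical in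
/-- The class `PDQP` relative to `O`: a deterministic polynomial-time machine with oracle `O` makes
one query to the sampler, which runs a circuit with oracle gates and returns the results of all
its non-collapsing measurements. The part of the computation before that query is
the machine `G`, which outputs the circuit; the part after it is the machine `D`, which
reads the input and the samples. The error probability is at most `1/3`. -/
def PDQP (O : List Bool → Bool) : Set Lang :=
  {L | ∃ (G D : Machine) (p : Polynomial ℕ), ∀ x : List Bool, ∃ C : Circuit,
    G.Outputs O x [] (p.eval x.length) C.encode ∧
    (∀ vs : List (Basis (Fin C.width)), vs.length = C.steps.length →
      ∃ z, D.Outputs O x (encodeSamples vs) (p.eval x.length) z) ∧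
    (x ∈ L → 2 / 3 ≤ eventProb (C.stages O) (zeroState _)
      (fun vs => decide (D.Outputs O x (encodeSamples vs) (p.eval x.length) [true]))) ∧
    (x ∉ L → eventProb (C.stages O) (zeroState _)
      (fun vs => decide (D.Outputs O x (encodeSamples vs) (p.eval x.length) [true])) ≤ 1 / 3)}

end

end Noncollapsing

/-! Lower bounds. The runs on `x` and on `flip x i` are compared for all sensitive pairs at once,
through the sum of the squared distances of their unnormalized states. Input-independent unitaries
preserve this sum, and so do collapsing measurements once all outcomes are summed. A query adds at
most 4 for each input, because a basis state asks for one bit only and so meets at most one pair of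
each input (`perturbs_keyOracle`). Samples leave the states alone, and the Bhattacharyya coefficient
of any test on all the samples is at least 1 minus half of the squared distances summed over the
sampling times and the end (`normSq_add_sub_loss_le_fidelity`). With `Q` queries and `P` samples
these losses are at most `4 * Q * (P + 1)` per input (`sum_loss_le`), while every sensitive pair
costs a constant. So the sensitivity is `O(Q * (P + 1))` (`adversary_bound`). It is `N` for parity
and at least `N / 2` at every sensitive point of majority, hence `Q + P` is of order at least `√N`.

Upper bounds. The whole input can be read, so the function is irrelevant. Cut it into about `√N`
blocks of about `√N` bits and prepare a uniform superposition over blocks and control strings. One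
query per position of a block writes the phases `(-1)^(y_j · c)`, and a Hadamard transform on the
control strings turns them into the uniform superposition of the `|j, y_j⟩`
(`exists_unitary_decode`). By coupon collecting, `O(√N log N)` samples of this one state show all
blocks (`le_eventProb_sample`).

Oracles. The languages ask whether the words of length `|x|` in the oracle are a strict majority, or
odd in number; `askMachine` puts them in PP and ⊕P. Against a PDQP procedure of time `T`, discard
the at most `T` words asked while the circuit is generated. The circuit is then fixed, and the
adversary bound applies with an extra term for the at most `T` words that the final classical
computation asks (`le_of_decidesAt`). The required sensitivity, about `2^(n-1)`, exceeds this
polynomial bound for large `n` (`exists_not_decidesAt`). Since procedures see finitely much of the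
oracle on each input, the oracles that defeat a given procedure form a dense open set, and the Baire
category theorem yields one that defeats all of them (`exists_oracle_notMem_PDQP`). -/

namespace Noncollapsing

noncomputable section

set_option linter.unusedSectionVars false

/-! ### Probabilities of runs, expressed through unnormalized states -/

section

variable {ι : Type} [Fintype ι] [DecidableEq ι]

/-! ### Norms and projections -/

lemma normSq_nonneg (ψ : State ι) : 0 ≤ normSq ψ :=
  Finset.sum_nonneg fun _ _ => by positivity

lemma normSq_smul (c : ℂ) (ψ : State ι) : normSq (c • ψ) = ‖c‖ ^ 2 * normSq ψ := by
  simp [normSq, Finset.mul_sum, mul_pow]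

@[simp] lemma normSq_zero : normSq (0 : State ι) = 0 := by simp [normSq]

lemma eq_zero_of_normSq_eq_zero {ψ : State ι} (h : normSq ψ = 0) : ψ = 0 := by
  funext b
  have := (Finset.sum_eq_zero_iff_of_nonneg (fun _ _ => by positivity)).1 h b (Finset.mem_univ b)
  simpa using this

lemma normSq_zeroState : normSq (zeroState ι) = 1 := by
  rw [normSq, Finset.sum_eq_single (fun _ => false)]
  · simp [zeroState]
  · intro b _ hb
    simp [zeroState, hb]
  · simp

lemma normalize_eq_smul (ψ : State ι) :
    normalize ψ = (((Real.sqrt (normSq ψ))⁻¹ : ℝ) : ℂ) • ψ := rfl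

lemma normalize_smul {c : ℝ} (hc : 0 < c) (ψ : State ι) :
    normalize ((c : ℂ) • ψ) = normalize ψ := by
  have h : normSq ((c : ℂ) • ψ) = c ^ 2 * normSq ψ := by
    rw [normSq_smul, Complex.norm_real, Real.norm_eq_abs, sq_abs]
  rw [normalize_eq_smul, normalize_eq_smul, h, Real.sqrt_mul (by positivity),
    Real.sqrt_sq hc.le, smul_smul]
  congr 1
  have : (c : ℂ) ≠ 0 := by exact_mod_cast hc.ne'
  push_cast
  rw [mul_inv]
  field_simp

lemma norm_normalize_sq (ψ : State ι) (v : Basis ι) :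
    ‖normalize ψ v‖ ^ 2 = ‖ψ v‖ ^ 2 / normSq ψ := by
  rw [normalize, norm_mul, mul_pow, Complex.norm_real, Real.norm_eq_abs, sq_abs, inv_pow,
    Real.sq_sqrt (normSq_nonneg ψ)]
  ring

lemma sum_norm_normalize_sq {ψ : State ι} (h : normSq ψ ≠ 0) :
    ∑ v, ‖normalize ψ v‖ ^ 2 = 1 := by
  simp only [norm_normalize_sq, ← Finset.sum_div]
  exact div_self h

lemma sum_norm_normalize_sq_le (ψ : State ι) : ∑ v, ‖normalize ψ v‖ ^ 2 ≤ 1 := by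
  by_cases h : normSq ψ = 0
  · simp [norm_normalize_sq, h]
  · exact (sum_norm_normalize_sq h).le

lemma project_smul (S : Finset ι) (m : S → Bool) (c : ℂ) (ψ : State ι) :
    project S m (c • ψ) = c • project S m ψ := by
  funext b
  simp only [project, Pi.smul_apply]
  split_ifs <;> simp

lemma project_sub (S : Finset ι) (m : S → Bool) (ψ φ : State ι) :
    project S m (ψ - φ) = project S m ψ - project S m φ := by
  funext b
  simp only [project, Pi.sub_apply]
  split_ifs <;> simp

/-- Each basis state is compatible with exactly one outcome. Applied to differences of states, this
makes collapsing measurements harmless for the adversary argument. -/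
lemma sum_normSq_project (S : Finset ι) (ψ : State ι) :
    ∑ m : S → Bool, normSq (project S m ψ) = normSq ψ := by
  unfold normSq
  rw [Finset.sum_comm]
  refine Finset.sum_congr rfl fun b _ => ?_
  rw [Finset.sum_eq_single (fun q : S => b q)]
  · simp [project]
  · intro m _ hm
    have : ¬ ∀ q : S, b q = m q := fun h => hm (funext fun q => (h q).symm)
    rw [project, if_neg this]
    simp
  · simp

/-- Norm-preserving linear operators. -/
structure IsIsometry (f : State ι → State ι) : Prop where
  map_sub : ∀ ψ φ, f (ψ - φ) = f ψ - f φ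
  map_smul : ∀ (c : ℂ) ψ, f (c • ψ) = c • f ψ
  normSq_map : ∀ ψ, normSq (f ψ) = normSq ψ

lemma IsIsometry.id : IsIsometry (fun ψ : State ι => ψ) := ⟨by simp, by simp, by simp⟩

lemma IsIsometry.comp {f g : State ι → State ι} (hf : IsIsometry f) (hg : IsIsometry g) :
    IsIsometry (fun ψ => f (g ψ)) :=
  ⟨fun _ _ => by simp only [hg.map_sub, hf.map_sub],
    fun _ _ => by simp only [hg.map_smul, hf.map_smul],
    fun _ => by simp only [hf.normSq_map, hg.normSq_map]⟩

/-! ### Unnormalized expectations -/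

/-- The stage consists of norm-preserving linear operators. -/
def Stage.IsIsometric (s : Stage ι) : Prop :=
  IsIsometry s.evolve ∧ ∀ O ∈ s.query, IsIsometry O

/-- The expectation of `f` on the list of samples times the squared norm of the initial vector. -/
def weight : List (Stage ι) → State ι → (List (Basis ι) → ℝ) → ℝ
  | [], ψ, f => normSq ψ * f []
  | s :: rest, ψ, f =>
    ∑ m : s.measured → Bool,
      (match s.query with
        | some O => weight rest (O (project s.measured m (s.evolve ψ))) f
        | none => ∑ v : Basis ι,
            ‖normalize (project s.measured m (s.evolve ψ)) v‖ ^ 2 *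
              weight rest (project s.measured m (s.evolve ψ)) (fun vs => f (v :: vs)))

lemma weight_nonneg {l : List (Stage ι)} {f : List (Basis ι) → ℝ} (hf : ∀ vs, 0 ≤ f vs)
    (ψ : State ι) : 0 ≤ weight l ψ f := by
  induction l generalizing ψ f with
  | nil => exact mul_nonneg (normSq_nonneg ψ) (hf _)
  | cons s rest ih =>
    rw [weight]
    refine Finset.sum_nonneg fun m _ => ?_
    cases s.query with
    | some O => exact ih hf _
    | none => exact Finset.sum_nonneg fun v _ =>
        mul_nonneg (by positivity) (ih (fun vs => hf (v :: vs)) _)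

lemma weight_add (l : List (Stage ι)) (ψ : State ι) (f g : List (Basis ι) → ℝ) :
    weight l ψ (fun vs => f vs + g vs) = weight l ψ f + weight l ψ g := by
  induction l generalizing ψ f g with
  | nil => simp [weight, mul_add]
  | cons s rest ih =>
    rw [weight, weight, weight, ← Finset.sum_add_distrib]
    refine Finset.sum_congr rfl fun m _ => ?_
    cases s.query with
    | some O => exact ih _ _ _
    | none =>
      simp only [← Finset.sum_add_distrib, ← mul_add]
      exact Finset.sum_congr rfl fun v _ => by rw [ih]

lemma weight_const_mul (l : List (Stage ι)) (ψ : State ι) (c : ℝ) (f : List (Basis ι) → ℝ) :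
    weight l ψ (fun vs => c * f vs) = c * weight l ψ f := by
  induction l generalizing ψ f with
  | nil => simp [weight]; ring
  | cons s rest ih =>
    rw [weight, weight, Finset.mul_sum]
    refine Finset.sum_congr rfl fun m _ => ?_
    cases s.query with
    | some O => exact ih _ _
    | none =>
      simp only [Finset.mul_sum]
      exact Finset.sum_congr rfl fun v _ => by rw [ih]; ring

lemma weight_mono {l : List (Stage ι)} {ψ : State ι} {f g : List (Basis ι) → ℝ}
    (h : ∀ vs, f vs ≤ g vs) : weight l ψ f ≤ weight l ψ g := by
  have h1 : weight l ψ g = weight l ψ f + weight l ψ (fun vs => g vs - f vs) := by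
    rw [← weight_add]; simp
  have h2 := weight_nonneg (l := l) (f := fun vs => g vs - f vs) (fun vs => sub_nonneg.2 (h vs)) ψ
  linarith

lemma weight_sum {α : Type*} (s : Finset α) (l : List (Stage ι)) (ψ : State ι)
    (f : α → List (Basis ι) → ℝ) :
    weight l ψ (fun vs => ∑ a ∈ s, f a vs) = ∑ a ∈ s, weight l ψ (f a) := by
  classical
  induction s using Finset.induction_on with
  | empty =>
    have := weight_const_mul l ψ 0 (fun _ => 0)
    simpa using this
  | insert a s ha ih =>
    simp only [Finset.sum_insert ha]
    rw [weight_add, ih]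

/-- Total probability. A branch with zero vector has no normalization, so its sample probabilities
do not sum to 1; it contributes 0 anyway. -/
lemma weight_one {l : List (Stage ι)} (hl : ∀ s ∈ l, s.IsIsometric) (ψ : State ι) :
    weight l ψ (fun _ => 1) = normSq ψ := by
  induction l generalizing ψ with
  | nil => simp [weight]
  | cons s rest ih =>
    have ih' := ih fun s hs => hl s (List.mem_cons_of_mem _ hs)
    have hs := hl s List.mem_cons_self
    rw [weight, ← hs.1.normSq_map ψ, ← sum_normSq_project s.measured]
    refine Finset.sum_congr rfl fun m _ => ?_
    have hq := hs.2
    cases hO : s.query with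
    | some O => simp only [ih', (hq O hO).normSq_map]
    | none =>
      simp only [ih', ← Finset.sum_mul]
      by_cases h : normSq (project s.measured m (s.evolve ψ)) = 0
      · rw [h, mul_zero]
      · rw [sum_norm_normalize_sq h, one_mul]

/-- Sample probabilities are unaffected by positive scaling, so only the final squared norm scales.
This allows renormalization after a collapse to be postponed to the end. -/
lemma weight_smul {l : List (Stage ι)} (hl : ∀ s ∈ l, s.IsIsometric) {c : ℝ} (hc : 0 ≤ c)
    (ψ : State ι) (f : List (Basis ι) → ℝ) :
    weight l ((c : ℂ) • ψ) f = c ^ 2 * weight l ψ f := by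
  induction l generalizing ψ f with
  | nil => rw [weight, weight, normSq_smul, Complex.norm_real, Real.norm_eq_abs, sq_abs, mul_assoc]
  | cons s rest ih =>
    have ih' := ih fun s hs => hl s (List.mem_cons_of_mem _ hs)
    have hs := hl s List.mem_cons_self
    rw [weight, weight, Finset.mul_sum]
    refine Finset.sum_congr rfl fun m _ => ?_
    rw [hs.1.map_smul, project_smul]
    have hq := hs.2
    cases hO : s.query with
    | some O => simp only [(hq O hO).map_smul, ih']
    | none =>
      simp only [Finset.mul_sum, ih']
      refine Finset.sum_congr rfl fun v _ => ?_
      rcases hc.eq_or_lt with rfl | hc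
      · simp
      · rw [normalize_smul hc]; ring

lemma normSq_mul_weight_normalize {l : List (Stage ι)} (hl : ∀ s ∈ l, s.IsIsometric)
    (ψ : State ι) (f : List (Basis ι) → ℝ) :
    normSq ψ * weight l (normalize ψ) f = weight l ψ f := by
  rw [normalize_eq_smul, weight_smul hl (by positivity), inv_pow, Real.sq_sqrt (normSq_nonneg ψ)]
  by_cases h : normSq ψ = 0
  · have := weight_smul hl le_rfl ψ f
    rw [eq_zero_of_normSq_eq_zero h] at this ⊢
    simpa using this.symm
  · field_simp

lemma normalize_normSq {ψ : State ι} (h : normSq ψ ≠ 0) : normSq (normalize ψ) = 1 :=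
  sum_norm_normalize_sq h

lemma normalize_of_normSq_eq_one {ψ : State ι} (h : normSq ψ = 1) : normalize ψ = ψ := by
  simp [normalize_eq_smul, h]

/-- The indicator function of an event. -/
def indic (A : List (Basis ι) → Bool) (vs : List (Basis ι)) : ℝ := if A vs then 1 else 0

/-- The factor `normSq` of a collapse is absorbed into the vector by homogeneity. Branches of
probability 0 vanish on both sides. -/
lemma eventProb_eq_weight {l : List (Stage ι)} (hl : ∀ s ∈ l, s.IsIsometric) {ψ : State ι}
    (hψ : normSq ψ = 1) (A : List (Basis ι) → Bool) :
    eventProb l ψ A = weight l ψ (indic A) := by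
  induction l generalizing ψ A with
  | nil => simp [eventProb, weight, hψ, indic]
  | cons s rest ih =>
    have hrest : ∀ s ∈ rest, s.IsIsometric := fun s hs => hl s (List.mem_cons_of_mem _ hs)
    have ih' := fun {ψ} => @ih hrest ψ
    have hs := hl s List.mem_cons_self
    rw [eventProb, weight]
    refine Finset.sum_congr rfl fun m _ => ?_
    set φ := project s.measured m (s.evolve ψ)
    by_cases h0 : normSq φ = 0
    · have hφ : φ = 0 := eq_zero_of_normSq_eq_zero h0
      have hw : ∀ f, weight rest (0 : State ι) f = 0 := fun f => by
        simpa using weight_smul hrest le_rfl (0 : State ι) f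
      have hq := hs.2
      cases hO : s.query with
      | some O =>
        have : O 0 = 0 := by simpa using (hq O hO).map_smul 0 0
        simp [hφ, this, hw]
      | none => simp [hφ, hw]
    · have h1 := normalize_normSq h0
      have hq := hs.2
      cases hO : s.query with
      | some O =>
        have hO' := hq O hO
        simp only
        rw [ih' ((hO'.normSq_map _).trans h1), normalize_eq_smul, hO'.map_smul,
          weight_smul hrest (by positivity), inv_pow, Real.sq_sqrt (normSq_nonneg φ)]
        field_simp
      | none =>
        simp only [Finset.mul_sum]
        refine Finset.sum_congr rfl fun v _ => ?_
        rw [ih' h1, ← normSq_mul_weight_normalize hrest φ]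
        have hA : (fun vs => indic A (v :: vs)) = indic (fun vs => A (v :: vs)) := rfl
        rw [hA]
        ring

end

/-! ### Distinguishing two runs by their samples -/

section

variable {ι : Type} [Fintype ι] [DecidableEq ι]

/-! ### Families of stages and the Bhattacharyya coefficient of their samples -/

/-- A stage whose operators depend on an input `x : X`. -/
structure StageFamily (X : Type) (ι : Type) where
  evolve : X → State ι → State ι
  measured : Finset ι
  query : Option (X → State ι → State ι)

variable {X : Type}

/-- The stage on the input `x`. -/
def StageFamily.on (s : StageFamily X ι) (x : X) : Stage ι :=
  ⟨s.evolve x, s.measured, s.query.map fun O => O x⟩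

/-- All the operators preserve norms. -/
def StageFamily.IsIsometric (s : StageFamily X ι) : Prop := ∀ x, (s.on x).IsIsometric

/-- The sum of the squared distances of the two (unnormalized) runs at all the samples and at the
end. -/
def loss (x y : X) : List (StageFamily X ι) → State ι → State ι → ℝ
  | [], ψ, φ => normSq (ψ - φ)
  | s :: rest, ψ, φ =>
    ∑ m : s.measured → Bool,
      (match s.query with
        | some O => loss x y rest (O x (project s.measured m (s.evolve x ψ)))
            (O y (project s.measured m (s.evolve y φ)))
        | none => normSq (project s.measured m (s.evolve x ψ) -
              project s.measured m (s.evolve y φ)) +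
            loss x y rest (project s.measured m (s.evolve x ψ))
              (project s.measured m (s.evolve y φ)))

lemma loss_nonneg (x y : X) (l : List (StageFamily X ι)) (ψ φ : State ι) :
    0 ≤ loss x y l ψ φ := by
  induction l generalizing ψ φ with
  | nil => exact normSq_nonneg _
  | cons s rest ih =>
    rw [loss]
    refine Finset.sum_nonneg fun m _ => ?_
    cases s.query with
    | some O => exact ih _ _
    | none => exact add_nonneg (normSq_nonneg _) (ih _ _)

/-- Coordinatewise this is the reverse triangle inequality, squared. -/
lemma normSq_add_normSq_sub_le (ψ φ : State ι) :
    normSq ψ + normSq φ - normSq (ψ - φ) ≤ 2 * ∑ v, ‖ψ v‖ * ‖φ v‖ := by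
  simp only [normSq, ← Finset.sum_add_distrib, ← Finset.sum_sub_distrib, Finset.mul_sum]
  refine Finset.sum_le_sum fun v _ => ?_
  have h := abs_norm_sub_norm_le (ψ v) (φ v)
  have h2 := sq_le_sq' (by linarith [neg_abs_le (‖ψ v‖ - ‖φ v‖), norm_nonneg (ψ v - φ v)])
    ((le_abs_self _).trans h)
  simp only [Pi.sub_apply]
  nlinarith

/-- Cauchy–Schwarz, in the form that merging outcomes does not decrease the Bhattacharyya
coefficient. -/
lemma sum_sqrt_mul_le {α : Type*} (s : Finset α) (a b : α → ℝ) (ha : ∀ i, 0 ≤ a i)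
    (hb : ∀ i, 0 ≤ b i) :
    ∑ i ∈ s, √(a i * b i) ≤ √((∑ i ∈ s, a i) * ∑ i ∈ s, b i) := by
  have := Real.sum_sqrt_mul_sqrt_le s ha hb
  rw [Real.sqrt_mul (Finset.sum_nonneg fun i _ => ha i)]
  exact (Finset.sum_le_sum fun i _ => (Real.sqrt_mul (ha i) _).le).trans this

/-- The Bhattacharyya coefficient of the two-outcome tests `f`, `1 - f` on two runs. -/
def fidelity (l₁ l₂ : List (Stage ι)) (ψ φ : State ι) (f : List (Basis ι) → ℝ) : ℝ :=
  √(weight l₁ ψ f * weight l₂ φ f) +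
    √(weight l₁ ψ (fun vs => 1 - f vs) * weight l₂ φ (fun vs => 1 - f vs))

/-- The Bhattacharyya coefficient is multiplicative along the list of samples, so its deficit is at
most the sum of the deficits of the single samples, each controlled by a squared state distance. The
induction works with unnormalized vectors, so the two runs may reach an outcome with different
probabilities. -/
lemma normSq_add_sub_loss_le_fidelity (x y : X) {l : List (StageFamily X ι)}
    (hl : ∀ s ∈ l, s.IsIsometric) (ψ φ : State ι) {f : List (Basis ι) → ℝ}
    (hf0 : ∀ vs, 0 ≤ f vs) (hf1 : ∀ vs, f vs ≤ 1) :
    normSq ψ + normSq φ - loss x y l ψ φ ≤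
      2 * fidelity (l.map fun s => s.on x) (l.map fun s => s.on y) ψ φ f := by
  induction l generalizing ψ φ f with
  | nil =>
    have h0 := normSq_nonneg ψ
    have h1 := normSq_nonneg φ
    have h2 := hf0 []
    have h3 : 0 ≤ 1 - f [] := by linarith [hf1 []]
    simp only [loss, List.map_nil, fidelity, weight]
    have e1 : normSq ψ * f [] * (normSq φ * f []) = normSq ψ * normSq φ * f [] ^ 2 := by ring
    have e2 : normSq ψ * (1 - f []) * (normSq φ * (1 - f [])) =
        normSq ψ * normSq φ * (1 - f []) ^ 2 := by ring
    rw [e1, e2, Real.sqrt_mul (mul_nonneg h0 h1) (f [] ^ 2),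
      Real.sqrt_mul (mul_nonneg h0 h1) ((1 - f []) ^ 2), Real.sqrt_sq h2, Real.sqrt_sq h3, ← mul_add]
    simp only [add_sub_cancel, mul_one]
    refine (normSq_add_normSq_sub_le ψ φ).trans ?_
    have := sum_sqrt_mul_le Finset.univ (fun v => ‖ψ v‖ ^ 2) (fun v => ‖φ v‖ ^ 2)
      (fun _ => by positivity) (fun _ => by positivity)
    simp only [← mul_pow] at this
    simp only [Real.sqrt_sq (mul_nonneg (norm_nonneg _) (norm_nonneg _))] at this
    simp only [normSq]
    linarith
  | cons s rest ih =>
    have ih' := fun {ψ φ f} => @ih (fun s hs => hl s (List.mem_cons_of_mem _ hs)) ψ φ f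
    have hs := hl s List.mem_cons_self
    have hsx : IsIsometry (s.evolve x) := (hs x).1
    have hsy : IsIsometry (s.evolve y) := (hs y).1
    set ψ' := fun m => project s.measured m (s.evolve x ψ) with hψ'
    set φ' := fun m => project s.measured m (s.evolve y φ) with hφ'
    have hg0 : ∀ vs, 0 ≤ 1 - f vs := fun vs => by linarith [hf1 vs]
    rw [← hsx.normSq_map ψ, ← hsy.normSq_map φ, ← sum_normSq_project s.measured,
      ← sum_normSq_project s.measured, loss, ← Finset.sum_add_distrib, ← Finset.sum_sub_distrib]
    cases hO : s.query with
    | some O =>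
      have hsplit : ∑ m, fidelity (rest.map fun s => s.on x) (rest.map fun s => s.on y)
          (O x (ψ' m)) (O y (φ' m)) f ≤
          fidelity ((s :: rest).map fun s => s.on x) ((s :: rest).map fun s => s.on y) ψ φ f := by
        simp only [fidelity, Finset.sum_add_distrib]
        refine add_le_add ?_ ?_
        · refine (sum_sqrt_mul_le _ _ _ (fun m => weight_nonneg hf0 _)
            (fun m => weight_nonneg hf0 _)).trans (le_of_eq ?_)
          simp [weight, StageFamily.on, hO, hψ', hφ']
        · refine (sum_sqrt_mul_le _ _ _ (fun m => weight_nonneg hg0 _)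
            (fun m => weight_nonneg hg0 _)).trans (le_of_eq ?_)
          simp [weight, StageFamily.on, hO, hψ', hφ']
      refine le_trans ?_ (mul_le_mul_of_nonneg_left hsplit (by norm_num))
      rw [Finset.mul_sum]
      refine Finset.sum_le_sum fun m _ => ?_
      refine le_trans (le_of_eq ?_) (ih' (ψ := O x (ψ' m)) (φ := O y (φ' m)) hf0 hf1)
      have hx := (hs x).2 (O x) (by simp [StageFamily.on, hO])
      have hy := (hs y).2 (O y) (by simp [StageFamily.on, hO])
      rw [hx.normSq_map, hy.normSq_map]
    | none =>
      have hsplit : ∑ m, ∑ v, √(‖normalize (ψ' m) v‖ ^ 2 * ‖normalize (φ' m) v‖ ^ 2) *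
          fidelity (rest.map fun s => s.on x) (rest.map fun s => s.on y)
            (ψ' m) (φ' m) (fun vs => f (v :: vs)) ≤
          fidelity ((s :: rest).map fun s => s.on x) ((s :: rest).map fun s => s.on y) ψ φ f := by
        have key : ∀ g : List (Basis ι) → ℝ, (∀ vs, 0 ≤ g vs) →
            ∑ m, ∑ v, √(‖normalize (ψ' m) v‖ ^ 2 * ‖normalize (φ' m) v‖ ^ 2) *
              √(weight (rest.map fun s => s.on x) (ψ' m) (fun vs => g (v :: vs)) *
                weight (rest.map fun s => s.on y) (φ' m) (fun vs => g (v :: vs))) ≤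
            √(weight ((s :: rest).map fun s => s.on x) ψ g *
              weight ((s :: rest).map fun s => s.on y) φ g) := by
          intro g hg
          have hw : ∀ v z χ, 0 ≤ weight (rest.map fun s => s.on z) χ (fun vs => g (v :: vs)) :=
            fun v z χ => weight_nonneg (fun vs => hg _) _
          rw [← Finset.sum_product']
          refine le_trans (le_of_eq ?_) ((sum_sqrt_mul_le (Finset.univ ×ˢ Finset.univ)
            (fun p : (s.measured → Bool) × Basis ι => ‖normalize (ψ' p.1) p.2‖ ^ 2 *
              weight (rest.map fun s => s.on x) (ψ' p.1) (fun vs => g (p.2 :: vs)))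
            (fun p : (s.measured → Bool) × Basis ι => ‖normalize (φ' p.1) p.2‖ ^ 2 *
              weight (rest.map fun s => s.on y) (φ' p.1) (fun vs => g (p.2 :: vs)))
            (fun p => mul_nonneg (by positivity) (hw _ _ _))
            (fun p => mul_nonneg (by positivity) (hw _ _ _))).trans (le_of_eq ?_))
          · refine Finset.sum_congr rfl fun p _ => ?_
            rw [← Real.sqrt_mul (by positivity)]
            congr 1
            ring
          · rw [Finset.sum_product, Finset.sum_product]
            simp [weight, StageFamily.on, hO, hψ', hφ']
        simp only [fidelity, mul_add, Finset.sum_add_distrib]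
        exact add_le_add (key f hf0) (key _ hg0)
      refine le_trans ?_ (mul_le_mul_of_nonneg_left hsplit (by norm_num))
      rw [Finset.mul_sum]
      refine Finset.sum_le_sum fun m _ => ?_
      change normSq (ψ' m) + normSq (φ' m) - (normSq (ψ' m - φ' m) + loss x y rest (ψ' m) (φ' m)) ≤ _
      have hL := loss_nonneg x y rest (ψ' m) (φ' m)
      -- `∑ v, p v` is the Bhattacharyya coefficient of this one sample; `hlow` multiplies it into
      -- the induction hypothesis.
      set p := fun v => √(‖normalize (ψ' m) v‖ ^ 2 * ‖normalize (φ' m) v‖ ^ 2) with hp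
      have hp0 : ∀ v, 0 ≤ p v := fun v => Real.sqrt_nonneg _
      have hp1 : ∑ v, p v ≤ 1 := by
        refine (sum_sqrt_mul_le _ _ _ (fun _ => by positivity) (fun _ => by positivity)).trans ?_
        refine Real.sqrt_le_iff.2 ⟨zero_le_one, ?_⟩
        rw [one_pow]
        exact mul_le_one₀ (sum_norm_normalize_sq_le _)
          (Finset.sum_nonneg fun _ _ => by positivity) (sum_norm_normalize_sq_le _)
      have hlow : (∑ v, p v) * (normSq (ψ' m) + normSq (φ' m) - loss x y rest (ψ' m) (φ' m)) ≤
          2 * ∑ v, p v * fidelity (rest.map fun s => s.on x) (rest.map fun s => s.on y)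
            (ψ' m) (φ' m) (fun vs => f (v :: vs)) := by
        rw [Finset.mul_sum, Finset.sum_mul]
        refine Finset.sum_le_sum fun v _ => ?_
        have := mul_le_mul_of_nonneg_left (ih' (ψ := ψ' m) (φ := φ' m)
          (f := fun vs => f (v :: vs)) (fun _ => hf0 _) (fun _ => hf1 _)) (hp0 v)
        linarith
      refine le_trans ?_ hlow
      -- The distance at this sample pays for the factor `∑ v, p v`. The geometric mean of the two
      -- norms is replaced by the arithmetic one. Afterwards the remaining loss is nonnegative and
      -- `∑ v, p v ≤ 1`, so its factor can be dropped.
      have hmain : normSq (ψ' m) + normSq (φ' m) - normSq (ψ' m - φ' m) ≤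
          (∑ v, p v) * (normSq (ψ' m) + normSq (φ' m)) := by
        refine (normSq_add_normSq_sub_le _ _).trans ?_
        rw [Finset.mul_sum, Finset.sum_mul]
        refine Finset.sum_le_sum fun v _ => ?_
        have hle : ∀ χ : State ι, ‖χ v‖ ^ 2 ≤ normSq χ := fun χ =>
          Finset.single_le_sum (f := fun v => ‖χ v‖ ^ 2) (fun _ _ => by positivity)
            (Finset.mem_univ v)
        have hn : ∀ χ : State ι, ‖χ v‖ = ‖normalize χ v‖ * √(normSq χ) := by
          intro χ
          have h1 := norm_normalize_sq χ v
          by_cases h : normSq χ = 0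
          · have : χ = 0 := eq_zero_of_normSq_eq_zero h
            simp [this]
          · have h2 : (‖normalize χ v‖ * √(normSq χ)) ^ 2 = ‖χ v‖ ^ 2 := by
              rw [mul_pow, h1, Real.sq_sqrt (normSq_nonneg χ)]
              field_simp
            exact ((sq_eq_sq₀ (by positivity) (by positivity)).1 h2).symm
        have hpv : p v = ‖normalize (ψ' m) v‖ * ‖normalize (φ' m) v‖ := by
          rw [hp]
          simp only [← mul_pow]
          exact Real.sqrt_sq (by positivity)
        rw [hpv, hn (ψ' m), hn (φ' m)]
        have a1 := Real.sq_sqrt (normSq_nonneg (ψ' m))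
        have a2 := Real.sq_sqrt (normSq_nonneg (φ' m))
        have a3 : 0 ≤ ‖normalize (ψ' m) v‖ * ‖normalize (φ' m) v‖ := by positivity
        have a4 : 2 * (√(normSq (ψ' m)) * √(normSq (φ' m))) ≤ normSq (ψ' m) + normSq (φ' m) := by
          nlinarith [sq_nonneg (√(normSq (ψ' m)) - √(normSq (φ' m)))]
        nlinarith [mul_le_mul_of_nonneg_left a4 a3]
      nlinarith

lemma sq_sub_le_of_bhattacharyya {p q L : ℝ} (hp0 : 0 ≤ p) (hp1 : p ≤ 1) (hq0 : 0 ≤ q)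
    (hq1 : q ≤ 1) (h : 2 - L ≤ 2 * (√(p * q) + √((1 - p) * (1 - q)))) :
    (p - q) ^ 2 ≤ 4 * L := by
  rw [Real.sqrt_mul hp0, Real.sqrt_mul (sub_nonneg.2 hp1)] at h
  have a := Real.sq_sqrt hp0
  have b := Real.sq_sqrt hq0
  have c := Real.sq_sqrt (sub_nonneg.2 hp1)
  have d := Real.sq_sqrt (sub_nonneg.2 hq1)
  have a1 : √p ≤ 1 := Real.sqrt_le_iff.2 ⟨zero_le_one, by linarith⟩
  have b1 : √q ≤ 1 := Real.sqrt_le_iff.2 ⟨zero_le_one, by linarith⟩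
  set s := √p
  set t := √q
  have hs : 0 ≤ s := Real.sqrt_nonneg _
  have ht : 0 ≤ t := Real.sqrt_nonneg _
  -- Twice the deficit of the coefficient is `(√p - √q)² + (√(1-p) - √(1-q))²`; the second square is
  -- dropped.
  have h1 : (s - t) ^ 2 ≤ L := by nlinarith [sq_nonneg (√(1 - p) - √(1 - q))]
  have h2 : p - q = (s - t) * (s + t) := by rw [← a, ← b]; ring
  rw [h2, mul_pow]
  have h3 : (s + t) ^ 2 ≤ 4 := by nlinarith
  nlinarith [sq_nonneg (s - t)]

lemma sq_eventProb_sub_le_loss (x y : X) {l : List (StageFamily X ι)}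
    (hl : ∀ s ∈ l, s.IsIsometric) {ψ φ : State ι} (hψ : normSq ψ = 1) (hφ : normSq φ = 1)
    (A : List (Basis ι) → Bool) :
    (eventProb (l.map fun s => s.on x) ψ A - eventProb (l.map fun s => s.on y) φ A) ^ 2 ≤
      4 * loss x y l ψ φ := by
  have hx : ∀ z, ∀ s ∈ l.map fun s => s.on z, s.IsIsometric := by
    intro z s hs
    obtain ⟨t, ht, rfl⟩ := List.mem_map.1 hs
    exact hl t ht z
  rw [eventProb_eq_weight (hx x) hψ, eventProb_eq_weight (hx y) hφ]
  have hf0 : ∀ vs, 0 ≤ indic A vs := fun vs => by unfold indic; split_ifs <;> norm_num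
  have hf1 : ∀ vs, indic A vs ≤ 1 := fun vs => by unfold indic; split_ifs <;> norm_num
  have hsub : ∀ z χ, normSq χ = 1 → weight (l.map fun s => s.on z) χ (fun vs => 1 - indic A vs) =
      1 - weight (l.map fun s => s.on z) χ (indic A) := by
    intro z χ hχ
    have h1 := weight_add (l.map fun s => s.on z) χ (fun vs => 1 - indic A vs) (indic A)
    simp only [sub_add_cancel] at h1
    rw [weight_one (hx z), hχ] at h1
    linarith
  have hg0 : ∀ vs, 0 ≤ 1 - indic A vs := fun vs => by linarith [hf1 vs]
  have main := normSq_add_sub_loss_le_fidelity x y hl ψ φ hf0 hf1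
  rw [fidelity, hsub x ψ hψ, hsub y φ hφ, hψ, hφ] at main
  have w1 := (weight_nonneg hg0 ψ).trans_eq (hsub x ψ hψ)
  have w2 := (weight_nonneg hg0 φ).trans_eq (hsub y φ hφ)
  exact sq_sub_le_of_bhattacharyya (weight_nonneg hf0 _) (by linarith) (weight_nonneg hf0 _)
    (by linarith) (by linarith)

end

/-! ### The adversary bound for queries and samples -/

section

variable {ι : Type} [Fintype ι] [DecidableEq ι] {I : Type} [DecidableEq I]

/-! ### The adversary method for flips of single bits -/

/-- Flip the bit `i`. -/
def flip (x : I → Bool) (i : I) : I → Bool := Function.update x i (!x i)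

@[simp] lemma flip_self (x : I → Bool) (i : I) : flip x i i = !x i := by simp [flip]

lemma flip_of_ne (x : I → Bool) {i j : I} (h : j ≠ i) : flip x i j = x j := by simp [flip, h]

@[simp] lemma flip_flip (x : I → Bool) (i : I) : flip (flip x i) i = x := by
  funext j
  by_cases h : j = i
  · subst h; simp
  · simp [flip_of_ne, h]

/-- The sum of the squared distances of the states `ψ x` along the edges `(x, flip x i)` in `E`. -/
def spread (E : Finset ((I → Bool) × I)) (ψ : (I → Bool) → State ι) : ℝ :=
  ∑ e ∈ E, normSq (ψ e.1 - ψ (flip e.1 e.2))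

/-- The input-dependent operator `f` increases the spread by at most `κ` times the total norm. -/
def Perturbs (E : Finset ((I → Bool) × I)) (M : Finset (I → Bool)) (κ : ℝ)
    (f : (I → Bool) → State ι → State ι) : Prop :=
  ∀ ψ : (I → Bool) → State ι,
    spread E (fun x => f x (ψ x)) ≤ spread E ψ + κ * ∑ x ∈ M, normSq (ψ x)

variable {E : Finset ((I → Bool) × I)} {M : Finset (I → Bool)}

lemma Perturbs.of_isIsometry {f : State ι → State ι} (hf : IsIsometry f) :
    Perturbs E M 0 (fun _ => f) := by
  intro ψ
  simp only [spread, ← hf.map_sub, hf.normSq_map, zero_mul, add_zero, le_refl]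

lemma Perturbs.comp {κ₁ κ₂ : ℝ} {f g : (I → Bool) → State ι → State ι}
    (hf : Perturbs E M κ₁ f) (hg : Perturbs E M κ₂ g) (hg' : ∀ x, IsIsometry (g x)) :
    Perturbs E M (κ₁ + κ₂) (fun x ψ => f x (g x ψ)) := by
  intro ψ
  have h1 := hf (fun x => g x (ψ x))
  have h2 := hg ψ
  simp only [(hg' _).normSq_map] at h1
  linarith

/-- The phase oracle that asks for the bit `key b` on the basis state `b`, if there is one. -/
def keyOracle (key : Basis ι → Option I) (x : I → Bool) (ψ : State ι) : State ι :=
  fun b => (if (key b).elim false x then -1 else 1) * ψ b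

lemma isIsometry_keyOracle (key : Basis ι → Option I) (x : I → Bool) :
    IsIsometry (keyOracle key x) where
  map_sub ψ φ := by funext b; simp only [keyOracle, Pi.sub_apply]; ring
  map_smul c ψ := by funext b; simp only [keyOracle, Pi.smul_apply, smul_eq_mul]; ring
  normSq_map ψ := by
    refine Finset.sum_congr rfl fun b _ => ?_
    simp only [keyOracle]
    split_ifs <;> simp

lemma norm_add_sq_le (z w : ℂ) : ‖z + w‖ ^ 2 ≤ 2 * ‖z‖ ^ 2 + 2 * ‖w‖ ^ 2 := by
  have := norm_add_le z w
  nlinarith [norm_nonneg (z + w), sq_nonneg (‖z‖ - ‖w‖)]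

/-- Both inputs get the same sign unless the basis state asks for `i`; there the difference becomes
a sum, up to sign. -/
lemma normSq_keyOracle_sub_le (key : Basis ι → Option I) (x : I → Bool) (i : I)
    (ψ φ : State ι) :
    normSq (keyOracle key x ψ - keyOracle key (flip x i) φ) ≤ normSq (ψ - φ) +
      (2 * (∑ b, if key b = some i then ‖ψ b‖ ^ 2 else 0) +
        2 * ∑ b, if key b = some i then ‖φ b‖ ^ 2 else 0) := by
  rw [normSq, normSq, Finset.mul_sum, Finset.mul_sum, ← Finset.sum_add_distrib,
    ← Finset.sum_add_distrib]
  refine Finset.sum_le_sum fun b _ => ?_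
  simp only [keyOracle, Pi.sub_apply]
  have h := norm_add_sq_le (ψ b) (φ b)
  have h' : ‖-ψ b - φ b‖ = ‖ψ b + φ b‖ := by rw [← norm_neg]; ring_nf
  cases hk : key b with
  | none => simp
  | some j =>
    by_cases hj : j = i
    · subst hj
      have h0 : 0 ≤ ‖ψ b - φ b‖ ^ 2 := by positivity
      cases hx : x j
      · simp [hx]; linarith
      · simp [hx, h']; linarith
    · have hn : ‖-ψ b + φ b‖ = ‖ψ b - φ b‖ := by rw [← norm_neg]; ring_nf
      cases hx : x j <;> simp [hj, hx, flip_of_ne, hn]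

/-- The disturbance of an edge is the mass with which its two ends ask for the flipped bit.
Reversing edges makes the two contributions equal, and for a fixed input the masses of different
bits live on disjoint sets of basis states. -/
lemma perturbs_keyOracle (hE : ∀ e ∈ E, (flip e.1 e.2, e.2) ∈ E) (hM : ∀ e ∈ E, e.1 ∈ M)
    (key : Basis ι → Option I) : Perturbs E M 4 (keyOracle key) := by
  classical
  intro ψ
  set g : (I → Bool) × I → ℝ := fun e => ∑ b, if key b = some e.2 then ‖ψ e.1 b‖ ^ 2 else 0
  have hsymm : ∑ e ∈ E, g (flip e.1 e.2, e.2) = ∑ e ∈ E, g e :=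
    Finset.sum_bij' (fun e _ => (flip e.1 e.2, e.2)) (fun e _ => (flip e.1 e.2, e.2)) hE hE
      (fun e _ => by simp) (fun e _ => by simp) (fun e _ => rfl)
  have hg : ∑ e ∈ E, g e ≤ ∑ x ∈ M, normSq (ψ x) := by
    rw [← Finset.sum_fiberwise_of_maps_to hM]
    refine Finset.sum_le_sum fun x _ => ?_
    simp only [g]
    rw [Finset.sum_comm]
    refine Finset.sum_le_sum fun b _ => ?_
    rw [← Finset.sum_filter]
    set S := {e ∈ {e ∈ E | e.1 = x} | key b = some e.2} with hS
    -- For a fixed input `x`, the basis state `b` determines the bit and hence the edge.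
    have hcard : S.card ≤ 1 := by
      refine Finset.card_le_one.2 fun e he e' he' => ?_
      simp only [hS, Finset.mem_filter] at he he'
      exact Prod.ext (he.1.2.trans he'.1.2.symm) (Option.some.inj (he.2.symm.trans he'.2))
    calc ∑ e ∈ S, ‖ψ e.1 b‖ ^ 2 = ∑ e ∈ S, ‖ψ x b‖ ^ 2 :=
          Finset.sum_congr rfl fun e he => by
            simp only [hS, Finset.mem_filter] at he
            rw [he.1.2]
      _ = S.card * ‖ψ x b‖ ^ 2 := by simp
      _ ≤ 1 * ‖ψ x b‖ ^ 2 := by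
          refine mul_le_mul_of_nonneg_right ?_ (by positivity)
          exact_mod_cast hcard
      _ = ‖ψ x b‖ ^ 2 := one_mul _
  calc spread E (fun x => keyOracle key x (ψ x))
      ≤ ∑ e ∈ E, (normSq (ψ e.1 - ψ (flip e.1 e.2)) +
          (2 * g e + 2 * g (flip e.1 e.2, e.2))) :=
        Finset.sum_le_sum fun e _ => normSq_keyOracle_sub_le key e.1 e.2 _ _
    _ = spread E ψ + (2 * ∑ e ∈ E, g e + 2 * ∑ e ∈ E, g (flip e.1 e.2, e.2)) := by
        simp only [Finset.sum_add_distrib, Finset.mul_sum, spread]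
    _ ≤ spread E ψ + 4 * ∑ x ∈ M, normSq (ψ x) := by rw [hsymm]; linarith

/-- The operators of the stage increase the spread by at most `κ` times the total norm. -/
def StageFamily.Perturbs (E : Finset ((I → Bool) × I)) (M : Finset (I → Bool)) (κ : ℝ)
    (s : StageFamily (I → Bool) ι) : Prop :=
  match s.query with
  | none => Noncollapsing.Perturbs E M κ s.evolve
  | some O => Noncollapsing.Perturbs E M 0 s.evolve ∧ Noncollapsing.Perturbs E M κ O

lemma sum_spread_project (S : Finset ι) (ψ : (I → Bool) → State ι) :
    ∑ m : S → Bool, spread E (fun x => project S m (ψ x)) = spread E ψ := by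
  simp only [spread]
  rw [Finset.sum_comm]
  simp only [← project_sub, sum_normSq_project]

/-- At each of the samples and at the end, the spread is at most its initial value plus the cost of
all stages. The total norm is conserved, so all branches of a collapse together are charged only
once. -/
lemma sum_loss_le {τ : Type*} (F : τ → StageFamily (I → Bool) ι) (cost : τ → ℝ)
    (hcost : ∀ s, 0 ≤ cost s) (steps : List τ)
    (hsteps : ∀ s ∈ steps, (F s).IsIsometric ∧ (F s).Perturbs E M (cost s))
    (ψ : (I → Bool) → State ι) :
    ∑ e ∈ E, loss e.1 (flip e.1 e.2) (steps.map F) (ψ e.1) (ψ (flip e.1 e.2)) ≤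
      (((steps.filter fun s => (F s).query.isNone).length : ℝ) + 1) *
        (spread E ψ + (steps.map cost).sum * ∑ x ∈ M, normSq (ψ x)) := by
  induction steps generalizing ψ with
  | nil => simp [loss, spread]
  | cons s rest ih =>
    have ih' := ih fun s hs => hsteps s (List.mem_cons_of_mem _ hs)
    obtain ⟨hiso, hper⟩ := hsteps s List.mem_cons_self
    have hev : ∀ x, IsIsometry ((F s).evolve x) := fun x => (hiso x).1
    set S := (F s).measured
    set P : ℝ := ((rest.filter fun s => (F s).query.isNone).length : ℝ)
    set c := (rest.map cost).sum with hc
    have hc0 : 0 ≤ c := List.sum_nonneg (by simpa using fun a _ => hcost a)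
    have hP : 0 ≤ P := Nat.cast_nonneg _
    set φ := fun x => (F s).evolve x (ψ x) with hφ
    set n := ∑ x ∈ M, normSq (ψ x)
    have hn : 0 ≤ n := Finset.sum_nonneg fun _ _ => normSq_nonneg _
    have hnφ : ∑ m : S → Bool, ∑ x ∈ M, normSq (project S m (φ x)) = n := by
      rw [Finset.sum_comm]
      simp only [sum_normSq_project, hφ, (hev _).normSq_map, n]
    have hs0 := hcost s
    simp only [List.map_cons, List.sum_cons, loss]
    rw [Finset.sum_comm]
    rw [StageFamily.Perturbs] at hper
    cases hO : (F s).query with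
    | some O =>
      rw [hO] at hper
      simp only at hper
      have hOi : ∀ x, IsIsometry (O x) := fun x =>
        (hiso x).2 (O x) (by simp [StageFamily.on, hO])
      simp only [hO, Option.isNone_some, Bool.false_eq_true, not_false_eq_true,
        List.filter_cons_of_neg]
      calc _ ≤ ∑ m : S → Bool, (P + 1) * (spread E (fun x => O x (project S m (φ x))) +
            c * ∑ x ∈ M, normSq (project S m (φ x))) := by
            refine Finset.sum_le_sum fun m _ => ?_
            have := ih' (fun x => O x (project S m (φ x)))
            simpa only [(hOi _).normSq_map] using this
        _ ≤ ∑ m : S → Bool, (P + 1) * (spread E (fun x => project S m (φ x)) +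
            (cost s + c) * ∑ x ∈ M, normSq (project S m (φ x))) := by
            refine Finset.sum_le_sum fun m _ => mul_le_mul_of_nonneg_left ?_ (by positivity)
            have := hper.2 (fun x => project S m (φ x))
            rw [add_mul]
            linarith
        _ = (P + 1) * (spread E φ + (cost s + c) * n) := by
            rw [← Finset.mul_sum, Finset.sum_add_distrib, sum_spread_project, ← Finset.mul_sum, hnφ]
        _ ≤ (P + 1) * (spread E ψ + (cost s + c) * n) := by
            have := hper.1 ψ
            refine mul_le_mul_of_nonneg_left ?_ (by positivity)
            linarith
    | none =>
      rw [hO] at hper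
      simp only at hper
      simp only [hO, Option.isNone_none, List.filter_cons_of_pos, List.length_cons,
        Nat.cast_add, Nat.cast_one]
      calc _ ≤ ∑ m : S → Bool, (spread E (fun x => project S m (φ x)) +
            (P + 1) * (spread E (fun x => project S m (φ x)) +
              c * ∑ x ∈ M, normSq (project S m (φ x)))) := by
            refine Finset.sum_le_sum fun m _ => ?_
            rw [Finset.sum_add_distrib]
            exact add_le_add le_rfl (ih' (fun x => project S m (φ x)))
        _ = spread E φ + (P + 1) * (spread E φ + c * n) := by
            rw [Finset.sum_add_distrib, ← Finset.mul_sum, Finset.sum_add_distrib,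
              sum_spread_project, ← Finset.mul_sum, hnφ]
        _ ≤ (P + 1 + 1) * (spread E ψ + (cost s + c) * n) := by
            have h1 : spread E φ ≤ spread E ψ + cost s * n := hper ψ
            have h2 : 0 ≤ c * n := mul_nonneg hc0 hn
            nlinarith [mul_le_mul_of_nonneg_left h1 hP]

/-- If the sensitive edges in `E` are dense and the outcome of a test with samples is different at
the ends of every edge, then the number of samples or of queries is large. The test may depend
on at most `T` bits of the input. -/
theorem adversary_bound {τ : Type*} (hM : ∀ e ∈ E, e.1 ∈ M) (hne : E.Nonempty) {h T K₀ : ℝ} (hdeg : M.card * h ≤ E.card)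
    (F : τ → StageFamily (I → Bool) ι) (cost : τ → ℝ) (hcost : ∀ s, 0 ≤ cost s) (steps : List τ)
    (hsteps : ∀ s ∈ steps, (F s).IsIsometric ∧ (F s).Perturbs E M (cost s))
    (ψ : (I → Bool) → State ι) (hψ : ∀ x, normSq (ψ x) = 1) (hψE : spread E ψ ≤ K₀ * M.card)
    (A : (I → Bool) → List (Basis ι) → Bool) (K : (I → Bool) → List (Basis ι) → Finset I)
    (hK : ∀ x vs, ((K x vs).card : ℝ) ≤ T)
    (hA : ∀ e ∈ E, ∀ vs, A e.1 vs ≠ A (flip e.1 e.2) vs → e.2 ∈ K e.1 vs)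
    (hdiff : ∀ e ∈ E, 1 / 3 ≤
      |eventProb (steps.map fun s => (F s).on e.1) (ψ e.1) (A e.1) -
        eventProb (steps.map fun s => (F s).on (flip e.1 e.2)) (ψ (flip e.1 e.2))
          (A (flip e.1 e.2))|) :
    h ≤ 48 * ((((steps.filter fun s => (F s).query.isNone).length : ℝ) + 1) *
      (K₀ + (steps.map cost).sum)) + 4 * T := by
  classical
  have hiso : ∀ s ∈ steps.map F, s.IsIsometric := by
    intro s hs
    obtain ⟨t, ht, rfl⟩ := List.mem_map.1 hs
    exact (hsteps t ht).1
  have hstage : ∀ x, ∀ s ∈ steps.map fun s => (F s).on x, s.IsIsometric := by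
    intro x s hs
    obtain ⟨t, ht, rfl⟩ := List.mem_map.1 hs
    exact (hsteps t ht).1 x
  set W := fun x => weight (steps.map fun s => (F s).on x) (ψ x)
  set r : (I → Bool) × I → ℝ := fun e => W e.1 (fun vs => if e.2 ∈ K e.1 vs then 1 else 0)
  set L : (I → Bool) × I → ℝ := fun e =>
    loss e.1 (flip e.1 e.2) (steps.map F) (ψ e.1) (ψ (flip e.1 e.2))
  -- For each input, the probabilities that the test looks at the various bits add up to at most the
  -- expected size of `K`.
  have hr : ∑ e ∈ E, r e ≤ T * M.card := by
    rw [← Finset.sum_fiberwise_of_maps_to hM, mul_comm, ← nsmul_eq_mul]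
    refine Finset.sum_le_card_nsmul _ _ _ fun x _ => ?_
    have h1 : ∑ e ∈ E with e.1 = x, r e =
        W x (fun vs => ∑ e ∈ E with e.1 = x, if e.2 ∈ K x vs then 1 else 0) := by
      simp only [W]
      rw [weight_sum]
      refine Finset.sum_congr rfl fun e he => ?_
      rw [Finset.mem_filter] at he
      obtain ⟨_, rfl⟩ := he
      rfl
    rw [h1]
    calc W x (fun vs => ∑ e ∈ E with e.1 = x, if e.2 ∈ K x vs then 1 else 0)
        ≤ W x (fun vs => T * 1) := by
          refine weight_mono fun vs => ?_
          rw [← Finset.sum_filter]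
          simp only [Finset.sum_const, nsmul_eq_mul, mul_one]
          refine le_trans ?_ (hK x vs)
          norm_cast
          refine Finset.card_le_card_of_injOn Prod.snd (fun e he => ?_) fun e he e' he' hee => ?_
          · simp only [Finset.coe_filter, Finset.mem_filter, Set.mem_ofPred_eq] at he
            exact he.2
          · simp only [Finset.coe_filter, Finset.mem_filter, Set.mem_ofPred_eq] at he he'
            exact Prod.ext (he.1.2.trans he'.1.2.symm) hee
      _ = T := by
          simp only [W]
          rw [weight_const_mul, weight_one (hstage x), hψ, mul_one]
  have hL : ∑ e ∈ E, L e ≤ _ := sum_loss_le F cost hcost steps hsteps ψ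
  simp only [hψ, Finset.sum_const, nsmul_eq_mul, mul_one] at hL
  -- The gap `1/3` splits into the effect of changing the test on a fixed run, at most `r e`, and
  -- the effect of changing the run under a fixed test, whose square is at most `4 * L e`. The
  -- inequality `t ≤ 3 * t² + 1/12` makes the latter linear in `L e`, so that it can be summed over
  -- edges.
  have hedge : ∀ e ∈ E, 1 / 4 ≤ 12 * L e + r e := by
    intro e he
    have h1 := hdiff e he
    have h2 := sq_eventProb_sub_le_loss e.1 (flip e.1 e.2) hiso (hψ e.1) (hψ (flip e.1 e.2))
      (A (flip e.1 e.2))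
    simp only [List.map_map, Function.comp_def] at h2
    rw [eventProb_eq_weight (hstage _) (hψ _), eventProb_eq_weight (hstage _) (hψ _)] at h1 h2
    change (W e.1 (indic (A (flip e.1 e.2))) - W _ (indic (A (flip e.1 e.2)))) ^ 2 ≤ 4 * L e at h2
    change 1 / 3 ≤ |W e.1 (indic (A e.1)) - W _ (indic (A (flip e.1 e.2)))| at h1
    have key : ∀ B C : List (Basis ι) → Bool, (∀ vs, B vs ≠ C vs → e.2 ∈ K e.1 vs) →
        W e.1 (indic B) ≤ W e.1 (indic C) + r e := by
      intro B C hBC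
      simp only [W, r]
      rw [← weight_add]
      refine weight_mono fun vs => ?_
      have := hBC vs
      unfold indic
      cases hB : B vs <;> cases hC : C vs <;> simp_all <;> split_ifs <;> norm_num
    have k1 := key (A e.1) (A (flip e.1 e.2)) (hA e he)
    have k2 := key (A (flip e.1 e.2)) (A e.1) fun vs hvs => hA e he vs hvs.symm
    set a := W e.1 (indic (A e.1))
    set b := W e.1 (indic (A (flip e.1 e.2)))
    set d := W (flip e.1 e.2) (indic (A (flip e.1 e.2)))
    rcases le_abs.1 h1 with h | h
    · nlinarith [sq_nonneg (6 * (b - d) - 1)]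
    · nlinarith [sq_nonneg (6 * (b - d) + 1)]
  have hsum : (E.card : ℝ) * (1 / 4) ≤ 12 * ∑ e ∈ E, L e + ∑ e ∈ E, r e := by
    rw [Finset.mul_sum, ← Finset.sum_add_distrib, ← nsmul_eq_mul]
    exact Finset.card_nsmul_le_sum _ _ _ hedge
  have hMpos : (0 : ℝ) < M.card := by
    obtain ⟨e, he⟩ := hne
    exact_mod_cast Finset.card_pos.2 ⟨_, hM e he⟩
  set P : ℝ := ((steps.filter fun s => (F s).query.isNone).length : ℝ)
  have hP : 0 ≤ P := Nat.cast_nonneg _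
  have h3 := mul_le_mul_of_nonneg_left hψE (by positivity : 0 ≤ P + 1)
  refine le_of_mul_le_mul_left ?_ hMpos
  nlinarith

end

/-! ### Lower bounds for majority and parity -/

section

variable {ι : Type} [Fintype ι] [DecidableEq ι]

/-! ### Lower bounds in the query model -/

lemma ofReal_normSq (ψ : State ι) : ((normSq ψ : ℝ) : ℂ) = star ψ ⬝ᵥ ψ := by
  simp only [normSq, dotProduct, Pi.star_apply]
  push_cast
  refine Finset.sum_congr rfl fun b _ => ?_
  rw [← Complex.ofReal_pow, Complex.sq_norm, Complex.normSq_eq_conj_mul_self]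
  rfl

lemma isIsometry_mulVec (U : Matrix.unitaryGroup (Basis ι) ℂ) :
    IsIsometry (fun ψ : State ι => U.1.mulVec ψ) where
  map_sub ψ φ := Matrix.mulVec_sub _ _ _
  map_smul c ψ := Matrix.mulVec_smul _ _ _
  normSq_map ψ := by
    have h : star U.1 * U.1 = 1 := Matrix.UnitaryGroup.star_mul_self U
    have : ((normSq (U.1.mulVec ψ) : ℝ) : ℂ) = (normSq ψ : ℝ) := by
      rw [ofReal_normSq, ofReal_normSq, Matrix.star_mulVec, Matrix.dotProduct_mulVec,
        Matrix.vecMul_vecMul, ← Matrix.star_eq_conjTranspose, h, Matrix.vecMul_one]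
    exact_mod_cast this

/-- The index that a basis state of a query register asks for. -/
def queryKey {N : ℕ} (r : Basis (QueryReg N)) : Option (Fin N) :=
  if h : Nat.ofBits (fun j => r (Sum.inl j)) < N then
    if r (Sum.inr ()) then some ⟨_, h⟩ else none
  else none

lemma phaseBit_eq {N : ℕ} (x : Fin N → Bool) (r : Basis (QueryReg N)) :
    phaseBit x r = (queryKey r).elim false x := by
  unfold phaseBit queryKey
  split_ifs with h1 h2
  · simp [h2]
  · simp [h2]
  · simp

lemma phaseOracle_eq {N w : ℕ} (x : Fin N → Bool) :
    phaseOracle (w := w) x = keyOracle (fun b => queryKey fun j => b (Sum.inl j)) x := by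
  funext ψ b
  simp only [phaseOracle, phaseSign, keyOracle, phaseBit_eq]

/-- The number of bits to which `f` is sensitive at `x`. -/
def sensitivity {N : ℕ} (f : (Fin N → Bool) → Bool) (x : Fin N → Bool) : ℕ :=
  (Finset.univ.filter fun i => f x ≠ f (flip x i)).card

/-- The sensitive edges. -/
def sensEdges {N : ℕ} (f : (Fin N → Bool) → Bool) : Finset ((Fin N → Bool) × Fin N) :=
  Finset.univ.filter fun e => f e.1 ≠ f (flip e.1 e.2)

/-- The ends of the sensitive edges. -/
def sensPoints {N : ℕ} (f : (Fin N → Bool) → Bool) : Finset (Fin N → Bool) :=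
  Finset.univ.filter fun x => sensitivity f x ≠ 0

lemma card_sensEdges_ge {N : ℕ} {f : (Fin N → Bool) → Bool} {h : ℝ}
    (hf : ∀ x, sensitivity f x ≠ 0 → h ≤ sensitivity f x) :
    (sensPoints f).card * h ≤ (sensEdges f).card := by
  have h1 : (sensEdges f).card = ∑ x, sensitivity f x := by
    rw [sensEdges, Finset.card_filter, Fintype.sum_prod_type]
    exact Finset.sum_congr rfl fun x _ => by rw [sensitivity, Finset.card_filter]
  have h2 : ∑ x ∈ sensPoints f, sensitivity f x ≤ ∑ x, sensitivity f x :=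
    Finset.sum_le_sum_of_subset (Finset.subset_univ _)
  rw [h1]
  calc ((sensPoints f).card : ℝ) * h ≤ ∑ x ∈ sensPoints f, (sensitivity f x : ℝ) := by
        rw [← nsmul_eq_mul]
        exact Finset.card_nsmul_le_sum _ _ _ fun x hx => hf x (Finset.mem_filter.1 hx).2
    _ ≤ _ := by exact_mod_cast h2

lemma flip_mem_sensEdges {N : ℕ} {f : (Fin N → Bool) → Bool} :
    ∀ e ∈ sensEdges f, (flip e.1 e.2, e.2) ∈ sensEdges f := by
  intro e he
  simp only [sensEdges, Finset.mem_filter, Finset.mem_univ, true_and, flip_flip] at he ⊢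
  exact he.symm

lemma fst_mem_sensPoints {N : ℕ} {f : (Fin N → Bool) → Bool} :
    ∀ e ∈ sensEdges f, e.1 ∈ sensPoints f := by
  intro e he
  simp only [sensEdges, Finset.mem_filter, Finset.mem_univ, true_and] at he
  exact Finset.mem_filter.2 ⟨Finset.mem_univ _, Finset.card_ne_zero_of_mem (a := e.2)
    (Finset.mem_filter.2 ⟨Finset.mem_univ _, he⟩)⟩

lemma eventProb_add_not {l : List (Stage ι)} (hl : ∀ s ∈ l, s.IsIsometric) {ψ : State ι}
    (hψ : normSq ψ = 1) (A : List (Basis ι) → Bool) :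
    eventProb l ψ A + eventProb l ψ (fun vs => !A vs) = 1 := by
  rw [eventProb_eq_weight hl hψ, eventProb_eq_weight hl hψ, ← weight_add, ← hψ, ← weight_one hl]
  congr 1
  funext vs
  unfold indic
  cases h : A vs <;> simp [h]

lemma one_third_le_abs_eventProb_sub {l l' : List (Stage ι)} (hl : ∀ s ∈ l, s.IsIsometric)
    (hl' : ∀ s ∈ l', s.IsIsometric) {ψ ψ' : State ι} (hψ : normSq ψ = 1) (hψ' : normSq ψ' = 1)
    (A : List (Basis ι) → Bool) {b b' : Bool} (hb : b ≠ b')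
    (h : 2 / 3 ≤ eventProb l ψ (fun vs => A vs == b))
    (h' : 2 / 3 ≤ eventProb l' ψ' (fun vs => A vs == b')) :
    1 / 3 ≤ |eventProb l ψ A - eventProb l' ψ' A| := by
  have e1 := eventProb_add_not hl hψ A
  have e2 := eventProb_add_not hl' hψ' A
  cases b <;> cases b' <;> simp at hb h h'
  · rw [abs_sub_comm]
    exact le_abs.2 (Or.inl (by linarith))
  · exact le_abs.2 (Or.inl (by linarith))

/-- All runs start in the same state, so the spread comes from the queries alone, at most 4 from
each; `192 = 48 * 4`. -/
theorem Algorithm.lower_bound {N : ℕ} (A : Algorithm N) {f : (Fin N → Bool) → Bool}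
    (hA : A.Computes f) (hne : (sensEdges f).Nonempty) {h : ℝ}
    (hf : ∀ x, sensitivity f x ≠ 0 → h ≤ sensitivity f x) :
    h ≤ 192 * ((A.samples + 1) * A.queries) := by
  set F : Step (QueryReg N ⊕ Fin A.work) → StageFamily (Fin N → Bool) (QueryReg N ⊕ Fin A.work) :=
    fun s => ⟨fun _ ψ => s.U.1.mulVec ψ, s.measured,
      if s.isQuery then some (fun x => phaseOracle x) else none⟩ with hF
  have hon : ∀ x, (A.steps.map fun s => (F s).on x) = A.stages x := by
    intro x
    refine List.map_congr_left fun s _ => ?_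
    simp only [hF, StageFamily.on]
    cases s.isQuery <;> simp
  have hO : ∀ x, IsIsometry (phaseOracle (N := N) (w := A.work) x) := fun x => by
    rw [phaseOracle_eq]; exact isIsometry_keyOracle _ _
  have hsteps : ∀ s ∈ A.steps, (F s).IsIsometric ∧
      (F s).Perturbs (sensEdges f) (sensPoints f) (if s.isQuery then 4 else 0) := by
    intro s _
    refine ⟨fun x => ⟨isIsometry_mulVec _, ?_⟩, ?_⟩
    · cases hs : s.isQuery
      · simp [hF, StageFamily.on, hs]
      · simpa [hF, StageFamily.on, hs] using hO x
    · have h0 := Perturbs.of_isIsometry (E := sensEdges f) (M := sensPoints f)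
        (isIsometry_mulVec s.U)
      cases hs : s.isQuery
      · simpa [StageFamily.Perturbs, hF, hs] using h0
      · simp only [StageFamily.Perturbs, hF, hs, if_true]
        refine ⟨h0, ?_⟩
        simp only [phaseOracle_eq]
        exact perturbs_keyOracle flip_mem_sensEdges fst_mem_sensPoints _
  have hiso : ∀ x, ∀ s ∈ A.stages x, s.IsIsometric := by
    intro x s hs
    rw [← hon] at hs
    obtain ⟨t, ht, rfl⟩ := List.mem_map.1 hs
    exact (hsteps t ht).1 x
  have := adversary_bound (K₀ := 0) (T := 0) (fst_mem_sensPoints (f := f)) hne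
    (card_sensEdges_ge hf) F (fun s => if s.isQuery then 4 else 0)
    (fun s => by split_ifs <;> norm_num) A.steps hsteps (fun _ => zeroState _)
    (fun _ => normSq_zeroState) (by simp [spread]) (fun _ => A.decision) (fun _ _ => ∅)
    (by simp) (by simp) (by
      intro e he
      simp only [sensEdges, Finset.mem_filter, Finset.mem_univ, true_and] at he
      rw [hon, hon]
      exact one_third_le_abs_eventProb_sub (hiso _) (hiso _) normSq_zeroState normSq_zeroState _ he
        (hA _) (hA _))
  have hP : (A.steps.filter fun s => (F s).query.isNone).length = A.samples := by
    rw [Algorithm.samples]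
    congr 2
    funext s
    simp only [hF]
    cases s.isQuery <;> simp
  have hQ : (A.steps.map fun s => if s.isQuery then (4 : ℝ) else 0).sum = 4 * A.queries := by
    rw [Algorithm.queries]
    generalize A.steps = l
    induction l with
    | nil => simp
    | cons s l ih =>
      rw [List.map_cons, List.sum_cons, ih]
      cases hs : s.isQuery <;> simp [hs]
      ring
  rw [hP, hQ] at this
  linarith

/-- The queries to the registers in `s`. -/
def partialOracle {N Q w : ℕ} (s : Finset (Fin Q)) (x : Fin N → Bool)
    (ψ : State (Fin Q × QueryReg N ⊕ Fin w)) : State (Fin Q × QueryReg N ⊕ Fin w) :=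
  fun b => (∏ t ∈ s, phaseSign x (fun j => b (Sum.inl (t, j)))) * ψ b

/-- A parallel query is a product of single-register queries, so the estimate for one query can be
iterated. -/
lemma partialOracle_insert {N Q w : ℕ} {s : Finset (Fin Q)} {t : Fin Q} (ht : t ∉ s)
    (x : Fin N → Bool) (ψ : State (Fin Q × QueryReg N ⊕ Fin w)) :
    partialOracle (insert t s) x ψ =
      keyOracle (fun b => queryKey fun j => b (Sum.inl (t, j))) x (partialOracle s x ψ) := by
  funext b
  simp only [partialOracle, keyOracle, Finset.prod_insert ht, phaseSign, phaseBit_eq]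
  ring

lemma isIsometry_partialOracle {N Q w : ℕ} (s : Finset (Fin Q)) (x : Fin N → Bool) :
    IsIsometry (partialOracle (w := w) s x) := by
  induction s using Finset.induction_on with
  | empty =>
    have : partialOracle (w := w) (∅ : Finset (Fin Q)) x = fun ψ => ψ := by
      funext ψ b; simp [partialOracle]
    rw [this]
    exact IsIsometry.id
  | insert t s ht ih =>
    have := (isIsometry_keyOracle (fun b => queryKey fun j => b (Sum.inl (t, j))) x).comp ih
    simpa only [← partialOracle_insert ht] using this

lemma perturbs_partialOracle {N Q w : ℕ} (s : Finset (Fin Q))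
    {E : Finset ((Fin N → Bool) × Fin N)} {M : Finset (Fin N → Bool)}
    (hE : ∀ e ∈ E, (flip e.1 e.2, e.2) ∈ E) (hM : ∀ e ∈ E, e.1 ∈ M) :
    Perturbs E M (4 * s.card) (partialOracle (w := w) s) := by
  induction s using Finset.induction_on with
  | empty =>
    have : partialOracle (w := w) (∅ : Finset (Fin Q)) = fun (_ : Fin N → Bool) ψ => ψ := by
      funext x ψ b; simp [partialOracle]
    rw [this]
    simpa using Perturbs.of_isIsometry (IsIsometry.id (ι := Fin Q × QueryReg N ⊕ Fin w))
  | insert t s ht ih =>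
    have := (perturbs_keyOracle hE hM (fun b => queryKey fun j => b (Sum.inl (t, j)))).comp ih
      (fun x => isIsometry_partialOracle s x)
    simp only [← partialOracle_insert ht] at this
    rw [Finset.card_insert_of_notMem ht]
    convert this using 1
    push_cast
    ring

theorem NonadaptiveAlgorithm.lower_bound {N : ℕ} (A : NonadaptiveAlgorithm N)
    {f : (Fin N → Bool) → Bool} (hA : A.Computes f) (hne : (sensEdges f).Nonempty) {h : ℝ}
    (hf : ∀ x, sensitivity f x ≠ 0 → h ≤ sensitivity f x) :
    h ≤ 192 * ((A.samples + 1) * A.queries) := by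
  set F : Matrix.unitaryGroup (Basis (Fin A.queries × QueryReg N ⊕ Fin A.work)) ℂ ×
      Finset (Fin A.queries × QueryReg N ⊕ Fin A.work) →
      StageFamily (Fin N → Bool) (Fin A.queries × QueryReg N ⊕ Fin A.work) :=
    fun s => ⟨fun _ ψ => s.1.1.mulVec ψ, s.2, none⟩ with hF
  have hon : ∀ x, (A.steps.map fun s => (F s).on x) = A.stages := fun x => rfl
  have hsteps : ∀ s ∈ A.steps, (F s).IsIsometric ∧
      (F s).Perturbs (sensEdges f) (sensPoints f) 0 := fun s _ =>
    ⟨fun x => ⟨isIsometry_mulVec _, by simp [hF, StageFamily.on]⟩,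
      Perturbs.of_isIsometry (isIsometry_mulVec s.1)⟩
  have hiso : ∀ s ∈ A.stages, s.IsIsometric := by
    intro s hs
    rw [← hon fun _ => false] at hs
    obtain ⟨t, ht, rfl⟩ := List.mem_map.1 hs
    exact (hsteps t ht).1 _
  set φ := A.U₀.1.mulVec (zeroState _) with hφ
  have hφ1 : normSq φ = 1 := ((isIsometry_mulVec A.U₀).normSq_map _).trans normSq_zeroState
  have hψ1 : ∀ x : Fin N → Bool, normSq (parallelOracle x φ) = 1 := fun x =>
    ((isIsometry_partialOracle Finset.univ x).normSq_map _).trans hφ1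
  have hspread : spread (sensEdges f) (fun x => parallelOracle x φ) ≤
      4 * A.queries * (sensPoints f).card := by
    have := perturbs_partialOracle (w := A.work) (Finset.univ : Finset (Fin A.queries))
      (flip_mem_sensEdges (f := f)) fst_mem_sensPoints (fun _ => φ)
    simp only [hφ1, Finset.card_univ, Fintype.card_fin, Finset.sum_const, nsmul_eq_mul,
      mul_one] at this
    refine this.trans ?_
    simp [spread]
  -- Here the queries precede the run: they enter through the initial spread `K₀ = 4 * Q`, and all
  -- later steps cost 0.
  have := adversary_bound (T := 0) (fst_mem_sensPoints (f := f)) hne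
    (card_sensEdges_ge hf) F (fun _ => 0) (fun s => le_rfl) A.steps hsteps
    (fun x => parallelOracle x φ) hψ1 hspread (fun _ => A.decision) (fun _ _ => ∅)
    (by simp) (by simp) (by
      intro e he
      simp only [sensEdges, Finset.mem_filter, Finset.mem_univ, true_and] at he
      rw [hon, hon]
      exact one_third_le_abs_eventProb_sub hiso hiso (hψ1 _) (hψ1 _) _ he (hA _) (hA _))
  have hP : (A.steps.filter fun s => (F s).query.isNone).length = A.samples := by
    simp [hF, NonadaptiveAlgorithm.samples]
  rw [hP] at this
  simp only [List.map_const', List.sum_replicate, smul_zero, add_zero, mul_zero] at this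
  linarith

/-! ### Sensitivity of majority and parity -/

lemma hammingWeight_flip {N : ℕ} (x : Fin N → Bool) (i : Fin N) :
    hammingWeight (flip x i) + (if x i then 1 else 0) =
      hammingWeight x + (if x i then 0 else 1) := by
  have h : ∀ z : Fin N → Bool, hammingWeight z =
      (∑ j ∈ Finset.univ.erase i, if z j then 1 else 0) + if z i then 1 else 0 := by
    intro z
    rw [hammingWeight, Finset.card_filter, Finset.sum_erase_add _ _ (Finset.mem_univ i)]
  have e : (∑ j ∈ Finset.univ.erase i, if flip x i j then 1 else 0) =
      ∑ j ∈ Finset.univ.erase i, if x j then 1 else 0 :=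
    Finset.sum_congr rfl fun j hj => by rw [flip_of_ne x (Finset.ne_of_mem_erase hj)]
  rw [h x, h (flip x i), e, flip_self]
  cases x i <;> simp

lemma parity_flip {N : ℕ} (x : Fin N → Bool) (i : Fin N) :
    parity N x ≠ parity N (flip x i) := by
  have := hammingWeight_flip x i
  simp only [parity, ne_eq, decide_eq_decide, Nat.odd_iff]
  cases hx : x i <;> simp [hx] at this <;> omega

lemma sensitivity_parity {N : ℕ} (x : Fin N → Bool) : sensitivity (parity N) x = N := by
  rw [sensitivity, Finset.filter_true_of_mem fun i _ => parity_flip x i]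
  simp

lemma card_filter_false {N : ℕ} (x : Fin N → Bool) :
    (Finset.univ.filter fun i => x i = false).card = N - hammingWeight x := by
  have := Finset.card_filter_add_card_filter_not (s := (Finset.univ : Finset (Fin N)))
    (fun i => x i = true)
  simp only [Bool.not_eq_true, Finset.card_univ, Fintype.card_fin] at this
  rw [hammingWeight]
  omega

lemma hammingWeight_le {N : ℕ} (x : Fin N → Bool) : hammingWeight x ≤ N := by
  simpa [hammingWeight] using Finset.card_filter_le (Finset.univ : Finset (Fin N)) _

/-- A sensitive point has weight just below or just at the threshold. Just below it all zeros are
sensitive, just at it all ones; either way these are at least half of the bits. -/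
lemma le_sensitivity_majority {N : ℕ} (x : Fin N → Bool)
    (hx : sensitivity (majority N) x ≠ 0) : N ≤ 2 * sensitivity (majority N) x := by
  obtain ⟨i, hi⟩ := Finset.card_ne_zero.1 hx
  simp only [Finset.mem_filter, Finset.mem_univ, true_and, majority, ne_eq,
    decide_eq_decide] at hi
  have h1 := hammingWeight_flip x i
  have hle := hammingWeight_le x
  cases hxi : x i
  · simp only [hxi, Bool.false_eq_true, if_false] at h1
    have hsub : (Finset.univ.filter fun j => x j = false) ⊆
        Finset.univ.filter fun j => majority N x ≠ majority N (flip x j) := by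
      intro j hj
      simp only [Finset.mem_filter, Finset.mem_univ, true_and] at hj
      simp only [Finset.mem_filter, Finset.mem_univ, true_and, majority, ne_eq, decide_eq_decide]
      have h2 := hammingWeight_flip x j
      simp only [hj, Bool.false_eq_true, if_false] at h2
      omega
    have := Finset.card_le_card hsub
    rw [card_filter_false] at this
    rw [sensitivity]
    omega
  · simp only [hxi, if_true] at h1
    have hsub : (Finset.univ.filter fun j => x j = true) ⊆
        Finset.univ.filter fun j => majority N x ≠ majority N (flip x j) := by
      intro j hj
      simp only [Finset.mem_filter, Finset.mem_univ, true_and] at hj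
      simp only [Finset.mem_filter, Finset.mem_univ, true_and, majority, ne_eq, decide_eq_decide]
      have h2 := hammingWeight_flip x j
      simp only [hj, if_true] at h2
      omega
    have := Finset.card_le_card hsub
    rw [sensitivity]
    change hammingWeight x ≤ _ at this
    omega

lemma sensEdges_parity_nonempty {N : ℕ} (hN : 2 ≤ N) : (sensEdges (parity N)).Nonempty :=
  ⟨(fun _ => false, ⟨0, by omega⟩), by simpa [sensEdges] using parity_flip _ _⟩

lemma exists_hammingWeight_eq {N k : ℕ} (hk : k ≤ N) : ∃ x : Fin N → Bool, hammingWeight x = k := by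
  obtain ⟨s, -, hs⟩ := Finset.exists_subset_card_eq
    (s := (Finset.univ : Finset (Fin N))) (n := k) (by simpa using hk)
  exact ⟨fun i => decide (i ∈ s), by simpa [hammingWeight] using hs⟩

lemma sensEdges_majority_nonempty {N : ℕ} (hN : 2 ≤ N) : (sensEdges (majority N)).Nonempty := by
  obtain ⟨x, hx⟩ := exists_hammingWeight_eq (N := N) (k := (N + 1) / 2) (by omega)
  have : 0 < hammingWeight x := by omega
  obtain ⟨i, hi⟩ := Finset.card_pos.1 this
  simp only [Finset.mem_filter, Finset.mem_univ, true_and] at hi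
  refine ⟨(x, i), ?_⟩
  have h := hammingWeight_flip x i
  simp only [hi, if_true] at h
  simp only [sensEdges, Finset.mem_filter, Finset.mem_univ, true_and, majority, ne_eq,
    decide_eq_decide]
  omega

/-- Since `Q ≥ 1`, both `P + 1` and `Q` are at most `Q + P`, so `N ≤ 384 * (Q + P)²`, and `384 ≤
20²`. -/
lemma sqrt_le_of_le_mul {N P Q : ℕ} (h : (N : ℝ) / 2 ≤ 192 * ((P + 1) * Q)) (hN : 2 ≤ N) :
    1 / 20 * √N ≤ ((Q + P : ℕ) : ℝ) := by
  have hQ : 1 ≤ Q := by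
    by_contra hQ
    have : Q = 0 := by omega
    subst this
    have : (2 : ℝ) ≤ N := by exact_mod_cast hN
    norm_num at h
    linarith
  have hQ' : (1 : ℝ) ≤ Q := by exact_mod_cast hQ
  have hP : (0 : ℝ) ≤ P := Nat.cast_nonneg P
  have h1 : √(N : ℝ) ≤ 20 * ((Q + P : ℕ) : ℝ) := by
    refine Real.sqrt_le_iff.2 ⟨by positivity, ?_⟩
    push_cast
    nlinarith
  linarith

end

/-! ### State preparation, phase decoding and repeated sampling -/

section

variable {ι : Type} [Fintype ι] [DecidableEq ι]

/-! ### Unitaries with prescribed columns -/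

/-- The family is orthonormal. -/
def IsOrthonormal {κ : Type*} [DecidableEq κ] (u : κ → State ι) : Prop :=
  ∀ k l, star (u k) ⬝ᵥ u l = if k = l then 1 else 0

/-- Extend the prescribed columns to an orthonormal basis. The algorithms only need their unitaries
on the span of a few basis states, so the extension is irrelevant. -/
lemma exists_unitary_mulVec_single {κ : Type*} [DecidableEq κ] {γ : κ → Basis ι}
    (hγ : Function.Injective γ) {u : κ → State ι} (hu : IsOrthonormal u) :
    ∃ U : Matrix.unitaryGroup (Basis ι) ℂ, ∀ k, U.1.mulVec (Pi.single (γ k) 1) = u k := by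
  classical
  set w : Basis ι → EuclideanSpace ℂ (Basis ι) :=
    fun b => if h : ∃ k, γ k = b then WithLp.toLp 2 (u h.choose) else 0 with hw
  have hwγ : ∀ k, w (γ k) = WithLp.toLp 2 (u k) := by
    intro k
    have h : ∃ l, γ l = γ k := ⟨k, rfl⟩
    rw [hw]
    simp only [h, dif_pos]
    rw [hγ h.choose_spec]
  have hon : Orthonormal ℂ ((Set.range γ).domRestrict w) := by
    rw [orthonormal_iff_ite]
    rintro ⟨b, hb⟩ ⟨c, hc⟩
    obtain ⟨k, rfl⟩ := Set.mem_range.1 hb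
    obtain ⟨l, rfl⟩ := Set.mem_range.1 hc
    simp only [Set.domRestrict_apply, hwγ, EuclideanSpace.inner_toLp_toLp, Subtype.mk.injEq,
      hγ.eq_iff]
    rw [dotProduct_comm]
    exact hu k l
  obtain ⟨b, hb⟩ := hon.exists_orthonormalBasis_extension_of_card_eq (by simp)
  refine ⟨⟨(EuclideanSpace.basisFun (Basis ι) ℂ).toBasis.toMatrix b,
    OrthonormalBasis.toMatrix_orthonormalBasis_mem_unitary _ _⟩, fun k => ?_⟩
  funext c
  rw [Matrix.mulVec_single_one]
  simp [Module.Basis.toMatrix_apply, hb (γ k) ⟨k, rfl⟩, hwγ]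

lemma isOrthonormal_single {κ : Type*} [DecidableEq κ] {γ : κ → Basis ι}
    (hγ : Function.Injective γ) : IsOrthonormal fun k => (Pi.single (γ k) 1 : State ι) := by
  intro k l
  rw [dotProduct_single_one]
  by_cases h : k = l
  · simp [h]
  · have : γ l ≠ γ k := fun e => h (hγ e).symm
    simp [h, this]

lemma exists_unitary_mulVec_zeroState {ψ : State ι} (hψ : normSq ψ = 1) :
    ∃ U : Matrix.unitaryGroup (Basis ι) ℂ, U.1.mulVec (zeroState ι) = ψ := by
  obtain ⟨U, hU⟩ := exists_unitary_mulVec_single (κ := Unit) (γ := fun _ _ => false)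
    (fun _ _ _ => rfl) (u := fun _ => ψ) (fun _ _ => by rw [← ofReal_normSq, hψ]; simp)
  exact ⟨U, hU ()⟩

/-! ### Superpositions of a family of basis states -/

/-- The vector with the amplitudes `a` on the basis states `γ k`. -/
def frameState {κ : Type*} [Fintype κ] (γ : κ → Basis ι) (a : κ → ℂ) : State ι :=
  ∑ k, a k • Pi.single (γ k) 1

section Frame

variable {κ : Type*} [Fintype κ] [DecidableEq κ] {γ : κ → Basis ι}

lemma frameState_apply (hγ : Function.Injective γ) (a : κ → ℂ) (k : κ) :
    frameState γ a (γ k) = a k := by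
  rw [frameState, Finset.sum_apply, Finset.sum_eq_single k]
  · simp
  · intro l _ hl
    simp [hγ.ne hl.symm]
  · simp

lemma frameState_apply_of_notMem (a : κ → ℂ) {b : Basis ι} (hb : ∀ k, γ k ≠ b) :
    frameState γ a b = 0 := by
  rw [frameState, Finset.sum_apply]
  exact Finset.sum_eq_zero fun k _ => by simp [(hb k).symm]

lemma star_frameState_dotProduct (hγ : Function.Injective γ) (a a' : κ → ℂ) :
    star (frameState γ a) ⬝ᵥ frameState γ a' = ∑ k, star (a k) * a' k := by
  conv_lhs => rw [frameState.eq_def γ a', dotProduct_sum]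
  refine Finset.sum_congr rfl fun k _ => ?_
  rw [dotProduct_smul, dotProduct_single_one, Pi.star_apply, frameState_apply hγ, smul_eq_mul,
    mul_comm]

lemma normSq_frameState (hγ : Function.Injective γ) (a : κ → ℂ) :
    normSq (frameState γ a) = ∑ k, ‖a k‖ ^ 2 := by
  have : ((normSq (frameState γ a) : ℝ) : ℂ) = ((∑ k, ‖a k‖ ^ 2 : ℝ) : ℂ) := by
    rw [ofReal_normSq, star_frameState_dotProduct hγ]
    push_cast
    refine Finset.sum_congr rfl fun k _ => ?_
    rw [← Complex.ofReal_pow, Complex.sq_norm, Complex.normSq_eq_conj_mul_self]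
    rfl
  exact_mod_cast this

lemma mulVec_frameState {U : Matrix (Basis ι) (Basis ι) ℂ} {u : κ → State ι}
    (hU : ∀ k, U.mulVec (Pi.single (γ k) 1) = u k) (a : κ → ℂ) :
    U.mulVec (frameState γ a) = ∑ k, a k • u k := by
  rw [frameState, Matrix.mulVec_sum]
  exact Finset.sum_congr rfl fun k _ => by rw [Matrix.mulVec_smul, hU]

lemma diagonal_frameState (d : Basis ι → ℂ) (a : κ → ℂ) :
    (fun b => d b * frameState γ a b) = frameState γ (fun k => d (γ k) * a k) := by
  funext b
  simp only [frameState, Finset.sum_apply, Finset.mul_sum]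
  refine Finset.sum_congr rfl fun k _ => ?_
  by_cases h : b = γ k
  · simp [h]
  · simp [h]

end Frame

/-! ### Decoding phases -/

/-- The sign `(-1)^(a · b)`. -/
def chi (a b : Bool) : ℂ := if a && b then -1 else 1

/-- The superposition of the blocks `j` and of control strings `c`, with the phase `y j · c`. -/
def blockAmp {B Q : ℕ} (y : Fin B → Fin Q → Bool) (k : Fin B × (Fin Q → Bool)) : ℂ :=
  ((√(B * 2 ^ Q))⁻¹ : ℝ) * ∏ t, chi (y k.1 t) (k.2 t)

lemma norm_chi (a b : Bool) : ‖chi a b‖ = 1 := by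
  unfold chi; split_ifs <;> simp

lemma sum_norm_blockAmp {B Q : ℕ} (hB : 0 < B) (y : Fin B → Fin Q → Bool) :
    ∑ k, ‖blockAmp y k‖ ^ 2 = 1 := by
  have h : ∀ k, ‖blockAmp y k‖ ^ 2 = ((B : ℝ) * 2 ^ Q)⁻¹ := by
    intro k
    rw [blockAmp, norm_mul, norm_prod, Complex.norm_real]
    simp only [norm_chi, Finset.prod_const_one, mul_one, Real.norm_eq_abs, sq_abs, inv_pow]
    rw [Real.sq_sqrt (by positivity)]
  simp only [h, Finset.sum_const, nsmul_eq_mul]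
  have hB' : (B : ℝ) ≠ 0 := by positivity
  simp [Finset.card_univ, Fintype.card_prod]
  field_simp

/-- Orthogonality of characters: the sum over control strings factors over positions, and a position
where `y` and `z` differ gives the factor 0. -/
lemma sum_chi_mul_chi {Q : ℕ} (y z : Fin Q → Bool) :
    ∑ c : Fin Q → Bool, (∏ t, chi (y t) (c t)) * ∏ t, chi (z t) (c t) =
      if y = z then 2 ^ Q else 0 := by
  have h := Finset.prod_univ_sum (fun _ : Fin Q => (Finset.univ : Finset Bool))
    (fun t b => chi (y t) b * chi (z t) b)
  rw [Fintype.piFinset_univ] at h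
  simp only [← Finset.prod_mul_distrib]
  rw [← h]
  split_ifs with hyz
  · subst hyz
    have : ∀ t, ∑ b, chi (y t) b * chi (y t) b = 2 := by
      intro t
      cases y t
      · simp [chi]
      · simp [chi]; norm_num
    simp only [this, Finset.prod_const, Finset.card_univ, Fintype.card_fin]
  · obtain ⟨t, ht⟩ := Function.ne_iff.1 hyz
    refine Finset.prod_eq_zero (Finset.mem_univ t) ?_
    revert ht
    cases y t <;> cases z t <;> simp [chi]

/-- There is a unitary that turns the phases `y j` into basis states. -/
lemma exists_unitary_decode {B Q : ℕ} (hB : 0 < B) {γ : Fin B × (Fin Q → Bool) → Basis ι}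
    (hγ : Function.Injective γ) :
    ∃ W : Matrix.unitaryGroup (Basis ι) ℂ, ∀ y : Fin B → Fin Q → Bool,
      W.1.mulVec (frameState γ (blockAmp y)) =
        frameState (fun j => γ (j, y j)) (fun _ => (((√B)⁻¹ : ℝ) : ℂ)) := by
  -- `u (j, y)` is the Hadamard transform of `|j, y⟩` on the control string. The phase state is the
  -- uniform superposition of the `u (j, y j)`, so the inverse transform decodes it for all `y`
  -- simultaneously.
  set u : Fin B × (Fin Q → Bool) → State ι := fun k => frameState γ fun l =>
    if l.1 = k.1 then ((√(2 ^ Q))⁻¹ : ℝ) * ∏ t, chi (k.2 t) (l.2 t) else 0 with hu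
  have hstar : ∀ a b, star (chi a b) = chi a b := by
    intro a b; unfold chi; split_ifs <;> simp
  have huo : IsOrthonormal u := by
    rintro ⟨j, y⟩ ⟨j', y'⟩
    simp only [hu]
    rw [star_frameState_dotProduct hγ, Fintype.sum_prod_type, Finset.sum_eq_single j]
    · by_cases hj : j = j'
      · subst hj
        simp only [if_true, Prod.mk.injEq, true_and]
        have h2 : (((√(2 ^ Q))⁻¹ : ℝ) : ℂ) * (((√(2 ^ Q))⁻¹ : ℝ) : ℂ) = (2 ^ Q : ℂ)⁻¹ := by
          rw [← Complex.ofReal_mul, ← mul_inv, Real.mul_self_sqrt (by positivity)]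
          push_cast
          rfl
        calc _ = ∑ c : Fin Q → Bool, (2 ^ Q : ℂ)⁻¹ *
              ((∏ t, chi (y t) (c t)) * ∏ t, chi (y' t) (c t)) := by
              refine Finset.sum_congr rfl fun c _ => ?_
              rw [star_mul', star_prod]
              simp only [hstar]
              rw [← h2, Complex.star_def, Complex.conj_ofReal]
              ring
          _ = _ := by
              rw [← Finset.mul_sum, sum_chi_mul_chi]
              split_ifs <;> simp
      · simp [hj]
    · intro i _ hi
      simp [hi]
    · simp
  obtain ⟨U, hU⟩ := exists_unitary_mulVec_single hγ huo
  refine ⟨U⁻¹, fun y => ?_⟩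
  have hinv : ∀ k, (U⁻¹).1.mulVec (u k) = Pi.single (γ k) 1 := by
    intro k
    rw [← hU k, Matrix.mulVec_mulVec, ← Matrix.UnitaryGroup.mul_val, inv_mul_cancel,
      Matrix.UnitaryGroup.one_val, Matrix.one_mulVec]
  have hsum : frameState γ (blockAmp y) = ∑ j, (((√B)⁻¹ : ℝ) : ℂ) • u (j, y j) := by
    simp only [hu, frameState, Finset.smul_sum]
    rw [Finset.sum_comm]
    refine Finset.sum_congr rfl fun k _ => ?_
    rw [Finset.sum_eq_single k.1]
    · rw [smul_smul]
      congr 1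
      simp only [if_true, blockAmp]
      rw [Real.sqrt_mul (by positivity), mul_inv]
      push_cast
      ring
    · intro j _ hj
      simp [hj.symm]
    · simp
  rw [hsum, Matrix.mulVec_sum, frameState]
  exact Finset.sum_congr rfl fun j _ => by rw [Matrix.mulVec_smul, hinv]

/-! ### Independent samples of one state -/

/-- The stage that does nothing but take a sample. -/
def sampleStage : Stage ι := ⟨fun ψ => ψ, ∅, none⟩

lemma sampleStage_isIsometric : ∀ s ∈ List.replicate n (sampleStage : Stage ι), s.IsIsometric := by
  intro s hs
  rw [List.eq_of_mem_replicate hs]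
  exact ⟨IsIsometry.id, by simp [sampleStage]⟩

lemma project_empty (m : (∅ : Finset ι) → Bool) (ψ : State ι) : project ∅ m ψ = ψ := by
  funext b
  simp [project]

lemma sum_empty_outcomes (c : ℝ) : ∑ _m : ((∅ : Finset ι) → Bool), c = c := by
  rw [Finset.sum_const, Finset.card_univ, Fintype.card_fun]
  simp

lemma weight_sampleStage_cons {ξ : State ι} (hξ : normSq ξ = 1) (l : List (Stage ι))
    (f : List (Basis ι) → ℝ) :
    weight (sampleStage :: l) ξ f = ∑ v, ‖ξ v‖ ^ 2 * weight l ξ (fun vs => f (v :: vs)) := by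
  rw [weight]
  simp only [sampleStage, project_empty, normalize_of_normSq_eq_one hξ]
  exact sum_empty_outcomes _

/-- Strings outside the support of the state are never sampled. -/
lemma weight_sample_mono {ξ : State ι} (hξ : normSq ξ = 1) (n : ℕ)
    {f g : List (Basis ι) → ℝ} (h : ∀ vs, (∀ v ∈ vs, ξ v ≠ 0) → f vs ≤ g vs) :
    weight (List.replicate n sampleStage) ξ f ≤ weight (List.replicate n sampleStage) ξ g := by
  induction n generalizing f g with
  | zero => simpa [weight, hξ] using h [] (by simp)
  | succ n ih =>
    rw [List.replicate_succ, weight_sampleStage_cons hξ, weight_sampleStage_cons hξ]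
    refine Finset.sum_le_sum fun v _ => ?_
    by_cases hv : ξ v = 0
    · simp [hv]
    · refine mul_le_mul_of_nonneg_left (ih fun vs hvs => h _ ?_) (by positivity)
      simpa [hv] using hvs

lemma weight_sample_notMem {ξ : State ι} (hξ : normSq ξ = 1) (n : ℕ) (w : Basis ι) :
    weight (List.replicate n sampleStage) ξ (fun vs => if w ∈ vs then 0 else 1) =
      (1 - ‖ξ w‖ ^ 2) ^ n := by
  induction n with
  | zero => simp [weight, hξ]
  | succ n ih =>
    rw [List.replicate_succ, weight_sampleStage_cons hξ]
    have h0 : weight (List.replicate n sampleStage) ξ (fun _ => 0) = 0 := by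
      simpa using weight_const_mul (List.replicate n sampleStage) ξ 0 (fun _ => 0)
    have h : ∀ v, ‖ξ v‖ ^ 2 * weight (List.replicate n sampleStage) ξ
        (fun vs => if w ∈ v :: vs then 0 else 1) =
        ‖ξ v‖ ^ 2 * (1 - ‖ξ w‖ ^ 2) ^ n -
          if v = w then ‖ξ w‖ ^ 2 * (1 - ‖ξ w‖ ^ 2) ^ n else 0 := by
      intro v
      by_cases hv : v = w
      · subst hv
        simp [h0]
      · simp [Ne.symm hv, hv, ih]
    simp only [h, Finset.sum_sub_distrib, ← Finset.sum_mul]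
    have h1 : ∑ v, ‖ξ v‖ ^ 2 = 1 := hξ
    rw [h1]
    simp only [Finset.sum_ite_eq', Finset.mem_univ, if_true]
    ring

/-- With high probability the samples contain all the `B` equally likely basis states. -/
lemma le_eventProb_sample {B n : ℕ} (hB : 0 < B) {δ : Fin B → Basis ι}
    (hδ : Function.Injective δ) (A : List (Basis ι) → Bool)
    (hA : ∀ vs, (∀ v ∈ vs, ∃ j, δ j = v) → (∀ j, δ j ∈ vs) → A vs = true) :
    1 - B * (1 - (B : ℝ)⁻¹) ^ n ≤ eventProb (List.replicate n sampleStage)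
      (frameState δ fun _ => (((√B)⁻¹ : ℝ) : ℂ)) A := by
  set ξ := frameState δ fun _ => (((√B)⁻¹ : ℝ) : ℂ) with hξdef
  have hnorm : ‖(((√B)⁻¹ : ℝ) : ℂ)‖ ^ 2 = (B : ℝ)⁻¹ := by
    rw [Complex.norm_real, Real.norm_eq_abs, sq_abs, inv_pow, Real.sq_sqrt (Nat.cast_nonneg B)]
  have hB' : (B : ℝ) ≠ 0 := by positivity
  have hξ : normSq ξ = 1 := by
    rw [hξdef, normSq_frameState hδ]
    simp only [hnorm]
    simp [hB']
  rw [eventProb_eq_weight sampleStage_isIsometric hξ]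
  -- Union bound: either `A` holds or one of the `B` basis states is missing from all `n` samples.
  have h1 : weight (List.replicate n sampleStage) ξ (fun _ => 1) ≤
      weight (List.replicate n sampleStage) ξ
        (fun vs => indic A vs + ∑ j, if δ j ∈ vs then 0 else 1) := by
    refine weight_sample_mono hξ n fun vs hvs => ?_
    have hs : ∀ v ∈ vs, ∃ j, δ j = v := by
      intro v hv
      by_contra hc
      push Not at hc
      exact hvs v hv (frameState_apply_of_notMem _ hc)
    have h0 : ∀ j ∈ Finset.univ, (0 : ℝ) ≤ if δ j ∈ vs then 0 else 1 := fun j _ => by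
      split_ifs <;> norm_num
    by_cases hall : ∀ j, δ j ∈ vs
    · rw [indic, if_pos (hA vs hs hall)]
      linarith [Finset.sum_nonneg h0]
    · push Not at hall
      obtain ⟨j, hj⟩ := hall
      have := Finset.single_le_sum h0 (Finset.mem_univ j)
      rw [if_neg hj] at this
      have hi : 0 ≤ indic A vs := by unfold indic; split_ifs <;> norm_num
      linarith
  rw [weight_one sampleStage_isIsometric, hξ, weight_add, weight_sum] at h1
  simp only [weight_sample_notMem hξ] at h1
  have h2 : ∀ j, ‖ξ (δ j)‖ ^ 2 = (B : ℝ)⁻¹ := fun j => by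
    rw [hξdef, frameState_apply hδ, hnorm]
  simp only [h2, Finset.sum_const, Finset.card_univ, Fintype.card_fin, nsmul_eq_mul] at h1
  linarith

end

/-! ### Reading the input with about `√N` queries and samples -/

section

variable {ι : Type} [Fintype ι] [DecidableEq ι]

/-! ### Reading the whole input by blocks -/

/-- The basis state `|i, b⟩` of a query register. -/
def regState {N : ℕ} (i : Fin N) (b : Bool) : Basis (QueryReg N) :=
  Sum.elim (fun j => Nat.testBit i j) (fun _ => b)

lemma phaseSign_regState {N : ℕ} (x : Fin N → Bool) (i : Fin N) (b : Bool) :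
    phaseSign x (regState i b) = chi (x i) b := by
  have h : Nat.ofBits (fun j : Fin (Nat.clog 2 N) => regState i b (Sum.inl j)) = i := by
    simp only [regState, Sum.elim_inl, Nat.ofBits_testBit]
    exact Nat.mod_eq_of_lt (i.2.trans_le (Nat.le_pow_clog (by norm_num) N))
  simp only [phaseSign, phaseBit, h, i.2, dif_pos, Fin.eta, chi]
  rfl

lemma phaseSign_false {N : ℕ} (x : Fin N → Bool) : phaseSign x (fun _ => false) = 1 := by
  simp [phaseSign, phaseBit]

open Classical in
/-- The input that the samples show. -/
def decode {N B Q : ℕ} (idx : Fin B → Fin Q → Fin N) (γ : Fin B × (Fin Q → Bool) → Basis ι)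
    (vs : List (Basis ι)) (i : Fin N) : Bool :=
  decide (∃ k t, γ k ∈ vs ∧ idx k.1 t = i ∧ k.2 t = true)

/-- A bit is declared 0 when no sample shows a 1. So the ones need every block to appear, and the
zeros need every sample to be correct. -/
lemma decode_eq {N B Q : ℕ} {idx : Fin B → Fin Q → Fin N} (hidx : ∀ i, ∃ j t, idx j t = i)
    {γ : Fin B × (Fin Q → Bool) → Basis ι} (hγ : Function.Injective γ) (x : Fin N → Bool)
    {vs : List (Basis ι)} (h1 : ∀ v ∈ vs, ∃ j, γ (j, fun t => x (idx j t)) = v)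
    (h2 : ∀ j, γ (j, fun t => x (idx j t)) ∈ vs) : decode idx γ vs = x := by
  funext i
  rw [Bool.eq_iff_iff]
  simp only [decode, decide_eq_true_eq]
  constructor
  · rintro ⟨k, t, hk, rfl, hkt⟩
    obtain ⟨j, hj⟩ := h1 _ hk
    have := hγ hj
    subst this
    exact hkt
  · intro hx
    obtain ⟨j, t, rfl⟩ := hidx i
    exact ⟨_, t, h2 j, rfl, hx⟩

lemma two_thirds_le_eventProb_decode {N B Q n : ℕ} (hB : 0 < B)
    (hn : (B : ℝ) * (1 - (B : ℝ)⁻¹) ^ n ≤ 1 / 3)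
    {idx : Fin B → Fin Q → Fin N} (hidx : ∀ i, ∃ j t, idx j t = i)
    {γ : Fin B × (Fin Q → Bool) → Basis ι} (hγ : Function.Injective γ)
    (f : (Fin N → Bool) → Bool) (x : Fin N → Bool) :
    2 / 3 ≤ eventProb (List.replicate n sampleStage)
      (frameState (fun j => γ (j, fun t => x (idx j t))) fun _ => (((√B)⁻¹ : ℝ) : ℂ))
      (fun vs => f (decode idx γ vs) == f x) := by
  refine le_trans (by linarith) (le_eventProb_sample (n := n) hB
    (δ := fun j => γ (j, fun t => x (idx j t))) (fun j j' h => congrArg Prod.fst (hγ h)) _ ?_)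
  intro vs h1 h2
  rw [decode_eq hidx hγ x h1 h2]
  simp

/-- Moves the decoding unitary into the initial state, so that what remains is pure repeated
sampling. -/
lemma eventProb_evolve_cons (ev : State ι → State ι) (l : List (Stage ι)) (ψ : State ι)
    (A : List (Basis ι) → Bool) :
    eventProb (⟨ev, ∅, none⟩ :: l) ψ A = eventProb (sampleStage :: l) (ev ψ) A := by
  rw [eventProb, eventProb]
  rfl

lemma eventProb_query_cons {ev O : State ι → State ι} {ψ : State ι} (h : normSq (ev ψ) = 1)
    (l : List (Stage ι)) (A : List (Basis ι) → Bool) :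
    eventProb (⟨ev, ∅, some O⟩ :: l) ψ A = eventProb l (O (ev ψ)) A := by
  rw [eventProb]
  simp only [project_empty, normalize_of_normSq_eq_one h, h, one_mul]
  exact sum_empty_outcomes _

lemma mulVec_one_eq : (fun ψ : State ι => (1 : Matrix.unitaryGroup (Basis ι) ℂ).1.mulVec ψ) =
    fun ψ => ψ := by
  funext ψ
  rw [Matrix.UnitaryGroup.one_val, Matrix.one_mulVec]

lemma chi_false (b : Bool) : chi false b = 1 := by simp [chi]

section Nonadaptive

variable {N B Q : ℕ} (idx : Fin B → Fin Q → Fin N)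

/-- Block `j` with the control string `c` in parallel query registers. -/
def parallelFrame (k : Fin B × (Fin Q → Bool)) : Basis (Fin Q × QueryReg N ⊕ Fin B) :=
  Sum.elim (fun p => regState (idx k.1 p.1) (k.2 p.1) p.2) (fun j => decide (j = k.1))

lemma parallelFrame_injective : Function.Injective (parallelFrame idx) := by
  rintro ⟨j, c⟩ ⟨j', c'⟩ h
  have h1 : j = j' := by simpa [parallelFrame] using congrFun h (Sum.inr j)
  have h2 : c = c' := by
    funext t
    simpa [parallelFrame, regState] using congrFun h (Sum.inl (t, Sum.inr ()))
  rw [h1, h2]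

lemma parallelOracle_frameState (x : Fin N → Bool) :
    parallelOracle x (frameState (parallelFrame idx) (blockAmp fun _ _ => false)) =
      frameState (parallelFrame idx) (blockAmp fun j t => x (idx j t)) := by
  refine (diagonal_frameState (fun b => ∏ t : Fin Q, phaseSign x fun q => b (Sum.inl (t, q)))
    _).trans ?_
  refine congrArg _ (funext fun k => ?_)
  have : ∀ t, phaseSign x (fun q => parallelFrame idx k (Sum.inl (t, q))) =
      chi (x (idx k.1 t)) (k.2 t) := by
    intro t
    have h : (fun q => parallelFrame idx k (Sum.inl (t, q))) = regState (idx k.1 t) (k.2 t) := by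
      funext q
      rw [parallelFrame, Sum.elim_inl]
    rw [h, phaseSign_regState]
  simp only [this, blockAmp, chi_false, Finset.prod_const_one]
  ring

theorem exists_nonadaptiveAlgorithm (hB : 0 < B) {n : ℕ}
    (hn : (B : ℝ) * (1 - (B : ℝ)⁻¹) ^ (n + 1) ≤ 1 / 3) (hidx : ∀ i, ∃ j t, idx j t = i)
    (f : (Fin N → Bool) → Bool) :
    ∃ A : NonadaptiveAlgorithm N, A.Computes f ∧ A.queries + A.samples = Q + (n + 1) := by
  have hγ := parallelFrame_injective idx
  obtain ⟨U₀, hU₀⟩ := exists_unitary_mulVec_zeroState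
    (ψ := frameState (parallelFrame idx) (blockAmp fun _ _ => false))
    ((normSq_frameState hγ _).trans (sum_norm_blockAmp hB _))
  obtain ⟨W, hW⟩ := exists_unitary_decode hB hγ
  -- The first sample is taken after decoding; the other `n` repeat it with identity steps.
  refine ⟨⟨Q, B, U₀, (W, ∅) :: List.replicate n (1, ∅),
    fun vs => f (decode idx (parallelFrame idx) vs)⟩, fun x => ?_, ?_⟩
  · simp only [NonadaptiveAlgorithm.stages, List.map_cons, List.map_replicate, mulVec_one_eq]
    rw [hU₀, parallelOracle_frameState, eventProb_evolve_cons, hW]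
    exact two_thirds_le_eventProb_decode hB hn hidx hγ f x
  · simp [NonadaptiveAlgorithm.samples]

end Nonadaptive

section Adaptive

variable {N B Q : ℕ} (idx : Fin B → Fin Q → Fin N)

/-- Block `j` with the control string `c` in the work register; the query register asks for
the bit `t - 1` of the block if `0 < t`. -/
def serialFrame (t : ℕ) (k : Fin B × (Fin Q → Bool)) : Basis (QueryReg N ⊕ Fin (B + Q)) :=
  Sum.elim (if h : 0 < t ∧ t - 1 < Q then
      regState (idx k.1 ⟨t - 1, h.2⟩) (k.2 ⟨t - 1, h.2⟩) else fun _ => false)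
    (fun q => Sum.elim (fun j => decide (j = k.1)) k.2 (finSumFinEquiv.symm q))

lemma serialFrame_injective (t : ℕ) : Function.Injective (serialFrame idx t) := by
  rintro ⟨j, c⟩ ⟨j', c'⟩ h
  have h1 : j = j' := by
    simpa [serialFrame] using congrFun h (Sum.inr (finSumFinEquiv (Sum.inl j)))
  have h2 : c = c' := by
    funext s
    simpa [serialFrame] using congrFun h (Sum.inr (finSumFinEquiv (Sum.inr s)))
  rw [h1, h2]

/-- The amplitudes after the first `t` bits of every block have been asked for. -/
def partialAmp (x : Fin N → Bool) (t : ℕ) : Fin B × (Fin Q → Bool) → ℂ :=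
  blockAmp fun j s => if s.val < t then x (idx j s) else false

lemma phaseOracle_serialFrame_zero (x : Fin N → Bool) (a : Fin B × (Fin Q → Bool) → ℂ) :
    phaseOracle x (frameState (serialFrame idx 0) a) = frameState (serialFrame idx 0) a := by
  refine (diagonal_frameState _ _).trans ?_
  congr 1
  funext k
  have : phaseSign x (fun j => serialFrame idx 0 k (Sum.inl j)) = 1 := by
    simp only [serialFrame, Sum.elim_inl]
    exact phaseSign_false x
  rw [this, one_mul]

lemma phaseOracle_serialFrame_succ (x : Fin N → Bool) {t : ℕ} (ht : t < Q) :
    phaseOracle x (frameState (serialFrame idx (t + 1)) (partialAmp idx x t)) =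
      frameState (serialFrame idx (t + 1)) (partialAmp idx x (t + 1)) := by
  refine (diagonal_frameState _ _).trans ?_
  congr 1
  funext k
  have h1 : phaseSign x (fun j => serialFrame idx (t + 1) k (Sum.inl j)) =
      chi (x (idx k.1 ⟨t, ht⟩)) (k.2 ⟨t, ht⟩) := by
    simp only [serialFrame, Sum.elim_inl, Nat.succ_pos, Nat.add_sub_cancel, ht, and_self, dif_pos]
    exact phaseSign_regState x _ _
  have h2 : ∏ s, chi (if s.val < t + 1 then x (idx k.1 s) else false) (k.2 s) =
      chi (x (idx k.1 ⟨t, ht⟩)) (k.2 ⟨t, ht⟩) *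
        ∏ s, chi (if s.val < t then x (idx k.1 s) else false) (k.2 s) := by
    have h3 : ∏ s, (if s = ⟨t, ht⟩ then chi (x (idx k.1 s)) (k.2 s) else 1) =
        chi (x (idx k.1 ⟨t, ht⟩)) (k.2 ⟨t, ht⟩) := by simp
    rw [← h3, ← Finset.prod_mul_distrib]
    refine Finset.prod_congr rfl fun s _ => ?_
    by_cases hs : s = ⟨t, ht⟩
    · subst hs
      simp [chi_false]
    · have hs' : s.val ≠ t := fun h => hs (Fin.ext h)
      have : s.val < t + 1 ↔ s.val < t := by omega
      simp only [hs, if_false, one_mul, this]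
  simp only [h1, partialAmp, blockAmp, h2]
  ring

lemma eventProb_queries {w : ℕ} (x : Fin N → Bool)
    (Us : List (Matrix.unitaryGroup (Basis (QueryReg N ⊕ Fin w)) ℂ))
    (l : List (Stage (QueryReg N ⊕ Fin w))) {ψ : State (QueryReg N ⊕ Fin w)} (hψ : normSq ψ = 1)
    (A : List (Basis (QueryReg N ⊕ Fin w)) → Bool) :
    eventProb ((Us.map fun U => ⟨fun φ => U.1.mulVec φ, ∅, some (phaseOracle x)⟩) ++ l) ψ A =
      eventProb l (Us.foldl (fun φ U => phaseOracle x (U.1.mulVec φ)) ψ) A := by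
  induction Us generalizing ψ with
  | nil => rfl
  | cons U Us ih =>
    have h1 : normSq (U.1.mulVec ψ) = 1 := ((isIsometry_mulVec U).normSq_map ψ).trans hψ
    have h2 : normSq (phaseOracle x (U.1.mulVec ψ)) = 1 := by
      rw [phaseOracle_eq, (isIsometry_keyOracle _ _).normSq_map, h1]
    rw [List.map_cons, List.cons_append, eventProb_query_cons h1, ih h2, List.foldl_cons]

theorem exists_algorithm (hB : 0 < B) {n : ℕ}
    (hn : (B : ℝ) * (1 - (B : ℝ)⁻¹) ^ (n + 1) ≤ 1 / 3) (hidx : ∀ i, ∃ j t, idx j t = i)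
    (f : (Fin N → Bool) → Bool) :
    ∃ A : Algorithm N, A.Computes f ∧ A.queries + A.samples = Q + 1 + (n + 1) := by
  have hγ := serialFrame_injective idx
  obtain ⟨U₀, hU₀⟩ := exists_unitary_mulVec_zeroState
    (ψ := frameState (serialFrame idx 0) (blockAmp fun _ _ => false))
    ((normSq_frameState (hγ 0) _).trans (sum_norm_blockAmp hB _))
  choose T hT using fun t => exists_unitary_mulVec_single (hγ t) (isOrthonormal_single (hγ (t + 1)))
  obtain ⟨W, hW⟩ := exists_unitary_decode hB (hγ Q)
  -- The step of `U₀` must end with a query too. In frame 0 the query register is idle, so that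
  -- query has no effect; this explains the total of `Q + 1` queries. Then `T t` readdresses the
  -- register from frame `t` to frame `t + 1`.
  set Us := U₀ :: (List.range Q).map T with hUs
  have hfold : ∀ x : Fin N → Bool, ∀ t ≤ Q,
      ((List.range t).map T).foldl (fun φ U => phaseOracle x (U.1.mulVec φ))
        (frameState (serialFrame idx 0) (blockAmp fun _ _ => false)) =
      frameState (serialFrame idx t) (partialAmp idx x t) := by
    intro x t ht
    induction t with
    | zero => simp [partialAmp]
    | succ t ih =>
      rw [List.range_succ, List.map_append, List.foldl_append, ih (by omega)]
      simp only [List.map_cons, List.map_nil, List.foldl_cons, List.foldl_nil]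
      rw [mulVec_frameState (hT t)]
      exact phaseOracle_serialFrame_succ idx x (by omega)
  refine ⟨⟨B + Q, (Us.map fun U => ⟨U, ∅, true⟩) ++ ⟨W, ∅, false⟩ ::
    List.replicate n ⟨1, ∅, false⟩, fun vs => f (decode idx (serialFrame idx Q) vs)⟩,
    fun x => ?_, ?_⟩
  · simp only [Algorithm.stages, List.map_append, List.map_map, Function.comp_def, if_true,
      List.map_cons, List.map_replicate, mulVec_one_eq, Bool.false_eq_true, if_false]
    rw [eventProb_queries x Us _ normSq_zeroState, hUs, List.foldl_cons, hU₀,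
      phaseOracle_serialFrame_zero, hfold x Q le_rfl, eventProb_evolve_cons]
    have : partialAmp idx x Q = blockAmp fun j t => x (idx j t) := by simp [partialAmp]
    rw [this, hW]
    exact two_thirds_le_eventProb_decode hB hn hidx (hγ Q) f x
  · simp [Algorithm.queries, Algorithm.samples, hUs, List.filter_map, Function.comp_def]

end Adaptive

/-! ### The query complexities -/

lemma exists_index (N : ℕ) (hN : 2 ≤ N) : ∃ idx : Fin (Nat.sqrt N + 1) → Fin (Nat.sqrt N + 1) → Fin N,
    ∀ i, ∃ j t, idx j t = i := by
  set B := Nat.sqrt N + 1 with hB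
  have hNB : N < B * B := by simpa [hB] using Nat.lt_succ_sqrt N
  refine ⟨fun j t => if h : j.val * B + t.val < N then ⟨_, h⟩ else ⟨0, by omega⟩, fun i => ?_⟩
  refine ⟨⟨i / B, Nat.div_lt_of_lt_mul (i.2.trans hNB)⟩, ⟨i % B, Nat.mod_lt _ (by omega)⟩, ?_⟩
  have h : i.val / B * B + i.val % B = i := Nat.div_add_mod' _ _
  simp [h]

lemma exists_sample_number {N : ℕ} (hN : 2 ≤ N) : ∃ n : ℕ,
    ((Nat.sqrt N + 1 : ℕ) : ℝ) * (1 - ((Nat.sqrt N + 1 : ℕ) : ℝ)⁻¹) ^ (n + 1) ≤ 1 / 3 ∧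
    ((Nat.sqrt N + 1 + 1 + (n + 1) : ℕ) : ℝ) ≤ 20 * √N * Real.log N ^ 1 := by
  set B : ℕ := Nat.sqrt N + 1 with hB
  have hN' : (2 : ℝ) ≤ N := by exact_mod_cast hN
  have hs1 : 1 ≤ √(N : ℝ) := Real.one_le_sqrt.2 (by linarith)
  have hsq : √(N : ℝ) ^ 2 = N := Real.sq_sqrt (by positivity)
  have hBs : (B : ℝ) ≤ √N + 1 := by
    rw [hB]
    push_cast
    linarith [Real.nat_sqrt_le_real_sqrt (a := N)]
  have hB1 : (1 : ℝ) ≤ B := by exact_mod_cast (by omega : 1 ≤ B)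
  have hlog2 : 1 / 2 ≤ Real.log N :=
    le_trans (by linarith [Real.log_two_gt_d9]) (Real.log_le_log (by norm_num) hN')
  -- `3 * B ≤ 3 * √N + 3 ≤ 8 * N ≤ N^4` for `N ≥ 2`.
  have hlogB : Real.log (3 * B) ≤ 4 * Real.log N := by
    have h4 : Real.log ((N : ℝ) ^ 4) = 4 * Real.log N := by rw [Real.log_pow]; norm_num
    rw [← h4]
    refine Real.log_le_log (by positivity) ?_
    have h5 : √(N : ℝ) ≤ N := by nlinarith
    have h6 : (4 : ℝ) ≤ (N : ℝ) ^ 2 := by nlinarith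
    have h7 : (8 : ℝ) * N ≤ (N : ℝ) ^ 4 := by nlinarith [mul_le_mul_of_nonneg_left h6 (by positivity : (0:ℝ) ≤ N ^ 2)]
    nlinarith
  have hlog0 : 0 ≤ Real.log (3 * B) := Real.log_nonneg (by linarith)
  -- With this `n`, `(1 - 1/B)^n ≤ exp (-n/B) ≤ 1/(3 * B)`, and the union bound over `B` blocks
  -- leaves error `1/3`.
  refine ⟨⌈(B : ℝ) * Real.log (3 * B)⌉₊, ?_, ?_⟩
  · set n := ⌈(B : ℝ) * Real.log (3 * B)⌉₊
    have hn : (B : ℝ) * Real.log (3 * B) ≤ n := Nat.le_ceil _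
    have hinv : (B : ℝ)⁻¹ ≤ 1 := inv_le_one_of_one_le₀ hB1
    have h1 : (1 - (B : ℝ)⁻¹) ^ (n + 1) ≤ Real.exp (-(Real.log (3 * B))) := by
      calc (1 - (B : ℝ)⁻¹) ^ (n + 1) ≤ Real.exp (-(B : ℝ)⁻¹) ^ (n + 1) := by
            refine pow_le_pow_left₀ (by linarith) ?_ _
            linarith [Real.add_one_le_exp (-(B : ℝ)⁻¹)]
        _ = Real.exp (-((n + 1 : ℕ) * (B : ℝ)⁻¹)) := by
            rw [← Real.exp_nat_mul]
            congr 1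
            ring
        _ ≤ _ := by
            refine Real.exp_le_exp.2 (neg_le_neg ?_)
            rw [← div_eq_mul_inv, le_div_iff₀ (by linarith)]
            push_cast
            linarith
    rw [Real.exp_neg, Real.exp_log (by linarith)] at h1
    calc (B : ℝ) * (1 - (B : ℝ)⁻¹) ^ (n + 1) ≤ B * (3 * (B : ℝ))⁻¹ :=
          mul_le_mul_of_nonneg_left h1 (by linarith)
      _ = 1 / 3 := by field_simp
  · have hc := (Nat.ceil_lt_add_one (mul_nonneg (by linarith) hlog0 : 0 ≤ (B : ℝ) * Real.log (3 * B))).le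
    push_cast
    have h1 : (B : ℝ) * Real.log (3 * B) ≤ (√N + 1) * (4 * Real.log N) :=
      mul_le_mul hBs hlogB hlog0 (by linarith)
    rw [pow_one]
    nlinarith [mul_le_mul_of_nonneg_left hlog2 (by linarith : 0 ≤ √(N : ℝ) - 1)]

lemma exists_iInf_eq {α : Type*} (p : α → Prop) (n : α → ℕ) (h : ∃ a, p a) :
    ∃ a, p a ∧ (⨅ (a) (_ : p a), (n a : ℕ∞)) = n a := by
  classical
  have hex : ∃ m, ∃ a, p a ∧ n a = m := ⟨_, h.choose, h.choose_spec, rfl⟩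
  obtain ⟨a, ha, hm⟩ := Nat.find_spec hex
  refine ⟨a, ha, le_antisymm (iInf₂_le a ha) (le_iInf₂ fun b hb => ?_)⟩
  rw [hm]
  exact_mod_cast Nat.find_min' hex ⟨b, hb, rfl⟩

lemma isThetaTildeSqrt_of_algorithms {α : ℕ → Type*} (p : ∀ N, α N → Prop) (cost : ∀ N, α N → ℕ)
    (hlow : ∀ N, 2 ≤ N → ∀ a, p N a → 1 / 20 * √(N : ℝ) ≤ cost N a)
    (hup : ∀ N, 2 ≤ N → ∃ a, p N a ∧ (cost N a : ℝ) ≤ 20 * √(N : ℝ) * Real.log N ^ 1) :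
    IsThetaTildeSqrt fun N => ⨅ (a : α N) (_ : p N a), (cost N a : ℕ∞) := by
  refine ⟨1 / 20, 20, by norm_num, by norm_num, 1, fun N hN => ?_⟩
  obtain ⟨b, hb, hb'⟩ := hup N hN
  obtain ⟨a, ha, hq⟩ := exists_iInf_eq (p N) (cost N) ⟨b, hb⟩
  refine ⟨cost N a, hq, hlow N hN a ha, le_trans ?_ hb'⟩
  have : (cost N a : ℕ∞) ≤ cost N b := hq ▸ iInf₂_le b hb
  exact_mod_cast this

theorem isThetaTildeSqrt_complexity (f : ∀ N, (Fin N → Bool) → Bool)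
    (hne : ∀ N, 2 ≤ N → (sensEdges (f N)).Nonempty)
    (hf : ∀ N x, sensitivity (f N) x ≠ 0 → (N : ℝ) / 2 ≤ sensitivity (f N) x) :
    IsThetaTildeSqrt fun N => complexity (f N) := by
  refine isThetaTildeSqrt_of_algorithms (fun N (A : Algorithm N) => A.Computes (f N))
    (fun N A => A.queries + A.samples) ?_ ?_
  · intro N hN A hA
    exact sqrt_le_of_le_mul (A.lower_bound hA (hne N hN) (hf N)) hN
  · intro N hN
    obtain ⟨idx, hidx⟩ := exists_index N hN
    obtain ⟨n, hn, hn'⟩ := exists_sample_number hN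
    obtain ⟨A, hA, hAc⟩ := exists_algorithm idx (Nat.succ_pos _) hn hidx (f N)
    exact ⟨A, hA, by rw [hAc]; exact hn'⟩

theorem isThetaTildeSqrt_nonadaptiveComplexity (f : ∀ N, (Fin N → Bool) → Bool)
    (hne : ∀ N, 2 ≤ N → (sensEdges (f N)).Nonempty)
    (hf : ∀ N x, sensitivity (f N) x ≠ 0 → (N : ℝ) / 2 ≤ sensitivity (f N) x) :
    IsThetaTildeSqrt fun N => nonadaptiveComplexity (f N) := by
  refine isThetaTildeSqrt_of_algorithms (fun N (A : NonadaptiveAlgorithm N) => A.Computes (f N))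
    (fun N A => A.queries + A.samples) ?_ ?_
  · intro N hN A hA
    exact sqrt_le_of_le_mul (A.lower_bound hA (hne N hN) (hf N)) hN
  · intro N hN
    obtain ⟨idx, hidx⟩ := exists_index N hN
    obtain ⟨n, hn, hn'⟩ := exists_sample_number hN
    obtain ⟨A, hA, hAc⟩ := exists_nonadaptiveAlgorithm idx (Nat.succ_pos _) hn hidx (f N)
    refine ⟨A, hA, le_trans ?_ hn'⟩
    rw [hAc]
    exact_mod_cast (by omega)

lemma half_le_sensitivity_majority (N : ℕ) (x : Fin N → Bool)
    (hx : sensitivity (majority N) x ≠ 0) : (N : ℝ) / 2 ≤ sensitivity (majority N) x := by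
  have : (N : ℝ) ≤ 2 * sensitivity (majority N) x := by
    exact_mod_cast le_sensitivity_majority x hx
  linarith

lemma half_le_sensitivity_parity (N : ℕ) (x : Fin N → Bool)
    (_ : sensitivity (parity N) x ≠ 0) : (N : ℝ) / 2 ≤ sensitivity (parity N) x := by
  rw [sensitivity_parity]
  linarith [(Nat.cast_nonneg N : (0 : ℝ) ≤ N)]

end

/-! ### Finite dependence on the oracle, and codes of circuits -/

section

/-! ### Locality of oracle machines -/

/-- The words that stand on the query tape during the first `T` steps. -/
def Machine.asked (M : Machine) (O : List Bool → Bool) (x y : List Bool) (T : ℕ) :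
    Finset (List Bool) :=
  (Finset.range T).image fun t => (((M.next O)^[t] (M.start x y)).tapes 2).word

lemma Machine.card_asked_le (M : Machine) (O : List Bool → Bool) (x y : List Bool) (T : ℕ) :
    (M.asked O x y T).card ≤ T :=
  Finset.card_image_le.trans (by simp)

/-- `asked` contains the word on the query tape at every time before `T`, whether or not it is
submitted, so agreement on `asked` keeps the configurations equal step by step. -/
lemma Machine.iterate_congr {M : Machine} {O O' : List Bool → Bool} {x y : List Bool} {T : ℕ}
    (h : ∀ w ∈ M.asked O x y T, O w = O' w) {t : ℕ} (ht : t ≤ T) :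
    (M.next O')^[t] (M.start x y) = (M.next O)^[t] (M.start x y) := by
  induction t with
  | zero => rfl
  | succ t ih =>
    rw [Function.iterate_succ_apply', Function.iterate_succ_apply', ih (by omega)]
    have := h _ (Finset.mem_image.2 ⟨t, Finset.mem_range.2 (by omega), rfl⟩)
    simp only [Machine.next, this]

lemma Machine.outputs_congr {M : Machine} {O O' : List Bool → Bool} {x y : List Bool} {T : ℕ}
    (h : ∀ w ∈ M.asked O x y T, O w = O' w) (z : List Bool) :
    M.Outputs O x y T z ↔ M.Outputs O' x y T z := by
  rw [Machine.Outputs, Machine.Outputs, Machine.iterate_congr h le_rfl]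

lemma Machine.Outputs.unique {M : Machine} {O : List Bool → Bool} {x y : List Bool} {T : ℕ}
    {z z' : List Bool} (h : M.Outputs O x y T z) (h' : M.Outputs O x y T z') : z = z' :=
  h.2.symm.trans h'.2

lemma Tape.length_word_le (t : Tape) : t.word.length ≤ t.right.length :=
  (List.reduceOption_length_le _).trans (List.takeWhile_sublist _).length_le

lemma Machine.length_right_le (M : Machine) (O : List Bool → Bool) (x y : List Bool) (t : ℕ)
    (i : Fin (M.work + 4)) (hi : 2 ≤ i.val) :
    (((M.next O)^[t] (M.start x y)).tapes i).right.length ≤ 2 * t := by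
  induction t with
  | zero =>
    have h0 : i.val ≠ 0 := by omega
    have h1 : i.val ≠ 1 := by omega
    simp only [Function.iterate_zero, id_eq, Machine.start, h0, h1, if_false, Tape.ofWord]
    simp
  | succ t ih =>
    rw [Function.iterate_succ_apply']
    set c := (M.next O)^[t] (M.start x y)
    rw [Machine.next]
    cases M.current c with
    | halt => exact ih.trans (by omega)
    | ask yes no => exact ih.trans (by omega)
    | act q w m =>
      simp only
      generalize m i = d
      -- One step can lengthen an empty list by 2: writing creates a cell and a left move uncovers
      -- another. Hence the bound `2 * t`.
      cases d <;> simp only [Tape.move, Tape.write, List.length_cons, List.length_tail,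
        List.tail_cons] <;> omega

lemma val_two (k : ℕ) : ((2 : Fin (k + 4)) : ℕ) = 2 :=
  Nat.mod_eq_of_lt (show 2 < k + 4 by omega)

lemma val_three (k : ℕ) : ((3 : Fin (k + 4)) : ℕ) = 3 :=
  Nat.mod_eq_of_lt (show 3 < k + 4 by omega)

lemma Machine.length_le_of_mem_asked {M : Machine} {O : List Bool → Bool} {x y : List Bool} {T : ℕ}
    {w : List Bool} (hw : w ∈ M.asked O x y T) : w.length ≤ 2 * T := by
  obtain ⟨t, ht, rfl⟩ := Finset.mem_image.1 hw
  have := M.length_right_le O x y t 2 (val_two _).ge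
  exact (Tape.length_word_le _).trans (this.trans (by have := Finset.mem_range.1 ht; omega))

lemma Machine.Outputs.length_le {M : Machine} {O : List Bool → Bool} {x y : List Bool} {T : ℕ}
    {z : List Bool} (h : M.Outputs O x y T z) : z.length ≤ 2 * T := by
  rw [← h.2]
  exact (Tape.length_word_le _).trans (M.length_right_le O x y T 3 (by rw [val_three]; omega))

/-! ### Codes of circuits -/

/-- No code word is a prefix of another one. -/
def PrefixFree {α : Type} (e : α → List Bool) : Prop :=
  ∀ a b u v, e a ++ u = e b ++ v → a = b ∧ u = v

lemma prefixFree_encodeNat : PrefixFree encodeNat := by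
  intro a
  induction a with
  | zero =>
    intro b u v h
    cases b with
    | zero => simpa [encodeNat] using h
    | succ b => simp [encodeNat, List.replicate_succ] at h
  | succ a ih =>
    intro b u v h
    cases b with
    | zero => simp [encodeNat, List.replicate_succ] at h
    | succ b =>
      have h' : encodeNat a ++ u = encodeNat b ++ v := by
        simpa [encodeNat, List.replicate_succ] using h
      obtain ⟨rfl, rfl⟩ := ih b u v h'
      exact ⟨rfl, rfl⟩

lemma prefixFree_encodeQubit {l : ℕ} : PrefixFree (encodeQubit (l := l)) := by
  intro a b u v h
  obtain ⟨h1, h2⟩ := prefixFree_encodeNat _ _ _ _ h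
  exact ⟨Fin.ext h1, h2⟩

lemma flatMap_append_inj {α : Type} {e : α → List Bool} (he : PrefixFree e) :
    ∀ (as bs : List α), as.length = bs.length → ∀ u v,
      as.flatMap e ++ u = bs.flatMap e ++ v → as = bs ∧ u = v
  | [], [], _, u, v, h => ⟨rfl, by simpa using h⟩
  | a :: as, b :: bs, hl, u, v, h => by
    simp only [List.flatMap_cons, List.append_assoc] at h
    obtain ⟨rfl, h'⟩ := he _ _ _ _ h
    obtain ⟨rfl, rfl⟩ := flatMap_append_inj he as bs (by simpa using hl) u v h'
    exact ⟨rfl, rfl⟩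

lemma prefixFree_encodeList {α : Type} {e : α → List Bool} (he : PrefixFree e) :
    PrefixFree (encodeList e) := by
  intro as bs u v h
  simp only [encodeList, List.append_assoc] at h
  obtain ⟨hl, h'⟩ := prefixFree_encodeNat _ _ _ _ h
  exact flatMap_append_inj he as bs hl u v h'

lemma PrefixFree.prod {α β : Type} {e : α → List Bool} {e' : β → List Bool} (he : PrefixFree e)
    (he' : PrefixFree e') : PrefixFree fun s : α × β => e s.1 ++ e' s.2 := by
  rintro ⟨a, b⟩ ⟨a', b'⟩ u v h
  simp only [List.append_assoc] at h
  obtain ⟨rfl, h'⟩ := he _ _ _ _ h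
  obtain ⟨rfl, rfl⟩ := he' _ _ _ _ h'
  exact ⟨rfl, rfl⟩

lemma prefixFree_gateEncode {l : ℕ} : PrefixFree (Gate.encode (l := l)) := by
  intro g g' u v h
  have hq := prefixFree_encodeQubit (l := l)
  have hn := prefixFree_encodeNat
  cases g <;> cases g' <;> simp only [Gate.encode, List.append_assoc] at h <;>
    obtain ⟨h0, h⟩ := hn _ _ _ _ h <;> first | omega | skip
  · obtain ⟨rfl, rfl⟩ := hq _ _ _ _ h
    exact ⟨rfl, rfl⟩
  · obtain ⟨rfl, rfl⟩ := hq _ _ _ _ h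
    exact ⟨rfl, rfl⟩
  · obtain ⟨rfl, h'⟩ := hq _ _ _ _ h
    obtain ⟨rfl, rfl⟩ := hq _ _ _ _ h'
    exact ⟨rfl, rfl⟩
  · obtain ⟨rfl, h'⟩ := prefixFree_encodeList hq _ _ _ _ h
    obtain ⟨rfl, rfl⟩ := hq _ _ _ _ h'
    exact ⟨rfl, rfl⟩

/-- Needed because membership in PDQP provides a circuit separately for each oracle; equal outputs
of the generating machine must mean equal circuits. -/
lemma Circuit.encode_injective : Function.Injective Circuit.encode := by
  rintro ⟨w, s⟩ ⟨w', s'⟩ h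
  simp only [Circuit.encode] at h
  obtain ⟨rfl, h'⟩ := prefixFree_encodeNat _ _ _ _ h
  have := prefixFree_encodeList ((prefixFree_encodeList prefixFree_gateEncode).prod
    (prefixFree_encodeList (prefixFree_encodeQubit (l := w)))) s s' [] []
    (by simpa using h')
  rw [this.1]

lemma length_encodeNat (n : ℕ) : (encodeNat n).length = n + 1 := by simp [encodeNat]

lemma length_le_length_encodeList {α : Type} (e : α → List Bool) (as : List α) :
    as.length ≤ (encodeList e as).length := by
  rw [encodeList, List.length_append, length_encodeNat]
  omega

lemma sum_length_le_length_encodeList {α : Type} (e : α → List Bool) (as : List α) :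
    (as.map fun a => (e a).length).sum ≤ (encodeList e as).length := by
  rw [encodeList, List.length_append, List.length_flatMap]
  omega

lemma Circuit.length_steps_le (C : Circuit) : C.steps.length ≤ C.encode.length := by
  rw [Circuit.encode, List.length_append]
  exact (length_le_length_encodeList _ _).trans (Nat.le_add_left _ _)

/-- List lengths are coded in unary, so the code length bounds the number of gates, of samples and
of qubits in an oracle query. -/
lemma Circuit.sum_length_gates_le (C : Circuit) :
    (C.steps.map fun s => s.1.length).sum ≤ C.encode.length := by
  rw [Circuit.encode, List.length_append]
  refine le_trans (le_trans (List.sum_le_sum fun s _ => ?_) (sum_length_le_length_encodeList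
    (fun s : List (Gate C.width) × List (Fin C.width) =>
      encodeList Gate.encode s.1 ++ encodeList encodeQubit s.2) C.steps)) (Nat.le_add_left _ _)
  rw [List.length_append]
  exact (length_le_length_encodeList _ _).trans (Nat.le_add_right _ _)

lemma length_le_of_mem_encodeList {α : Type} (e : α → List Bool) {as : List α} {a : α}
    (ha : a ∈ as) : (e a).length ≤ (encodeList e as).length :=
  le_trans (List.single_le_sum (by simp) _ (List.mem_map.2 ⟨a, ha, rfl⟩))
    (sum_length_le_length_encodeList e as)

lemma Circuit.length_query_le (C : Circuit) {s : List (Gate C.width) × List (Fin C.width)}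
    (hs : s ∈ C.steps) {qs : List (Fin C.width)} {b : Fin C.width}
    (hg : Gate.oracle qs b ∈ s.1) : qs.length ≤ C.encode.length := by
  have h1 := length_le_length_encodeList (encodeQubit (l := C.width)) qs
  have h2 := length_le_of_mem_encodeList Gate.encode hg
  have h3 := length_le_of_mem_encodeList (fun s : List (Gate C.width) × List (Fin C.width) =>
      encodeList Gate.encode s.1 ++ encodeList encodeQubit s.2) hs
  rw [Circuit.encode, List.length_append]
  simp only [Gate.encode, List.length_append] at h2 h3
  omega

end

/-! ### The adversary bound for circuits with oracle gates -/

section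

/-! ### Circuits with oracle gates -/

section Gates

variable {l : ℕ}

lemma sum_comp_of_involutive {α β : Type*} [Fintype α] [AddCommMonoid β] {σ : α → α}
    (hσ : Function.Involutive σ) (f : α → β) : ∑ a, f (σ a) = ∑ a, f a :=
  Equiv.sum_comp (hσ.toPerm σ) f

/-- The parallelogram law on each pair of basis states that differ in `q`; summing over all basis
states counts every pair twice on both sides. -/
lemma isIsometry_hadamard (O : List Bool → Bool) (q : Fin l) :
    IsIsometry ((Gate.hadamard q).apply O) where
  map_sub ψ φ := by
    funext b
    simp only [Gate.apply, Pi.sub_apply]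
    ring
  map_smul c ψ := by
    funext b
    simp only [Gate.apply, Pi.smul_apply, smul_eq_mul]
    ring
  normSq_map ψ := by
    have hσ : Function.Involutive fun b : Basis (Fin l) => flip b q := fun b => flip_flip b q
    have hpair : ∀ b : Basis (Fin l),
        ‖(Gate.hadamard q).apply O ψ b‖ ^ 2 + ‖(Gate.hadamard q).apply O ψ (flip b q)‖ ^ 2 =
          ‖ψ b‖ ^ 2 + ‖ψ (flip b q)‖ ^ 2 := by
      intro b
      have h2 : ‖((√2 : ℝ) : ℂ)‖ ^ 2 = 2 := by
        rw [Complex.norm_real, Real.norm_eq_abs, sq_abs, Real.sq_sqrt (by norm_num)]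
      have hu : ∀ a, Function.update (flip b q) q a = Function.update b q a := by
        intro a; simp [flip]
      have hpar := parallelogram_law_with_norm ℝ (ψ (Function.update b q false))
        (ψ (Function.update b q true))
      simp only [Gate.apply, hu, flip_self, norm_div, div_pow, h2]
      have hb : Function.update b q (b q) = b := Function.update_eq_self q b
      have hf : Function.update b q (!b q) = flip b q := rfl
      cases hq : b q
      · rw [hq] at hb hf
        rw [hb, show Function.update b q true = flip b q from hf] at hpar ⊢
        simp only [Bool.false_eq_true, if_false, Bool.not_false, if_true, one_mul, neg_mul,
          ← sub_eq_add_neg]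
        linarith
      · rw [hq] at hb hf
        rw [hb, show Function.update b q false = flip b q from hf] at hpar ⊢
        simp only [Bool.false_eq_true, if_false, Bool.not_true, if_true, one_mul, neg_mul,
          ← sub_eq_add_neg]
        linarith
    have h1 := sum_comp_of_involutive hσ fun b => ‖(Gate.hadamard q).apply O ψ b‖ ^ 2
    have h2 := sum_comp_of_involutive hσ fun b => ‖ψ b‖ ^ 2
    have h3 := Finset.sum_congr rfl fun (b : Basis (Fin l)) (_ : b ∈ Finset.univ) => hpair b
    rw [Finset.sum_add_distrib, Finset.sum_add_distrib] at h3
    simp only [normSq]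
    linarith

lemma isIsometry_phase (O : List Bool → Bool) (q : Fin l) :
    IsIsometry ((Gate.phase q).apply O) where
  map_sub ψ φ := by
    funext b
    simp only [Gate.apply, Pi.sub_apply]
    ring
  map_smul c ψ := by
    funext b
    simp only [Gate.apply, Pi.smul_apply, smul_eq_mul]
    ring
  normSq_map ψ := by
    refine Finset.sum_congr rfl fun b _ => ?_
    have h : ‖Complex.exp (Complex.I * Real.pi / 4)‖ = 1 := by
      have : Complex.I * Real.pi / 4 = ((Real.pi / 4 : ℝ) : ℂ) * Complex.I := by
        push_cast
        ring
      rw [this, Complex.norm_exp_ofReal_mul_I]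
    simp only [Gate.apply, norm_mul]
    split_ifs <;> simp [h]

lemma isIsometry_cnot (O : List Bool → Bool) (c t : Fin l) :
    IsIsometry ((Gate.cnot c t).apply O) where
  map_sub ψ φ := by
    funext b
    simp only [Gate.apply, Pi.sub_apply]
    split_ifs <;> rfl
  map_smul a ψ := by
    funext b
    simp only [Gate.apply, Pi.smul_apply]
    split_ifs <;> rfl
  normSq_map ψ := by
    by_cases h : c = t
    · simp [normSq, Gate.apply, h]
    · have hσ : Function.Involutive fun b : Basis (Fin l) =>
          Function.update b t (xor (b t) (b c)) := by
        intro b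
        simp [Function.update_of_ne h]
      have := sum_comp_of_involutive hσ fun b => ‖ψ b‖ ^ 2
      simpa only [normSq, Gate.apply, h, if_false] using this

lemma oracle_apply_eq (O : List Bool → Bool) (qs : List (Fin l)) (a : Fin l) :
    (Gate.oracle qs a).apply O = keyOracle (fun b => if b a then some (qs.map b) else none) O := by
  funext ψ b
  simp only [Gate.apply, keyOracle]
  by_cases h : b a <;> simp [h]

lemma Gate.isIsometry (g : Gate l) (O : List Bool → Bool) : IsIsometry (g.apply O) := by
  cases g with
  | hadamard q => exact isIsometry_hadamard O q
  | phase q => exact isIsometry_phase O q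
  | cnot c t => exact isIsometry_cnot O c t
  | oracle qs a => rw [oracle_apply_eq]; exact isIsometry_keyOracle _ _

variable {E : Finset ((List Bool → Bool) × List Bool)} {M : Finset (List Bool → Bool)}

lemma Perturbs.mono {ι I : Type} [Fintype ι] [DecidableEq ι] [DecidableEq I]
    {E : Finset ((I → Bool) × I)} {M : Finset (I → Bool)} {κ κ' : ℝ}
    {f : (I → Bool) → State ι → State ι} (hf : Perturbs E M κ f) (h : κ ≤ κ') :
    Perturbs E M κ' f := fun ψ =>
  (hf ψ).trans (add_le_add le_rfl
    (mul_le_mul_of_nonneg_right h (Finset.sum_nonneg fun _ _ => normSq_nonneg _)))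

lemma Gate.perturbs (hE : ∀ e ∈ E, (flip e.1 e.2, e.2) ∈ E) (hM : ∀ e ∈ E, e.1 ∈ M)
    (g : Gate l) : Perturbs E M 4 (fun O => g.apply O) := by
  have h0 : ∀ g : Gate l, (∀ O O', g.apply O = g.apply O') →
      Perturbs E M 4 (fun O => g.apply O) := by
    intro g hg
    have : (fun O => g.apply O) = fun _ : List Bool → Bool => g.apply fun _ => false :=
      funext fun O => hg O _
    rw [this]
    exact (Perturbs.of_isIsometry (g.isIsometry _)).mono (by norm_num)
  cases g with
  | hadamard q => exact h0 _ fun _ _ => rfl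
  | phase q => exact h0 _ fun _ _ => rfl
  | cnot c t => exact h0 _ fun _ _ => rfl
  | oracle qs a =>
    simp only [oracle_apply_eq]
    exact perturbs_keyOracle hE hM _

lemma isIsometry_foldl (O : List Bool → Bool) (gs : List (Gate l)) :
    IsIsometry fun ψ => gs.foldl (fun φ g => g.apply O φ) ψ := by
  induction gs with
  | nil => exact IsIsometry.id
  | cons g gs ih => exact ih.comp (g.isIsometry O)

lemma perturbs_foldl (hE : ∀ e ∈ E, (flip e.1 e.2, e.2) ∈ E) (hM : ∀ e ∈ E, e.1 ∈ M)
    (gs : List (Gate l)) :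
    Perturbs E M (4 * gs.length) fun O ψ => gs.foldl (fun φ g => g.apply O φ) ψ := by
  induction gs with
  | nil => simpa using Perturbs.of_isIsometry (IsIsometry.id (ι := Fin l))
  | cons g gs ih =>
    refine (ih.comp (g.perturbs hE hM) fun O => g.isIsometry O).mono (le_of_eq ?_)
    push_cast [List.length_cons]
    ring

end Gates

/-- The steps of a circuit as functions of the oracle. -/
def circuitFamily {l : ℕ} (s : List (Gate l) × List (Fin l)) :
    StageFamily (List Bool → Bool) (Fin l) :=
  ⟨fun O ψ => s.1.foldl (fun φ g => g.apply O φ) ψ, s.2.toFinset, none⟩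

lemma Circuit.stages_eq (C : Circuit) (O : List Bool → Bool) :
    (C.steps.map fun s => (circuitFamily s).on O) = C.stages O := rfl

lemma circuitFamily_isIsometric {l : ℕ} (s : List (Gate l) × List (Fin l)) :
    (circuitFamily s).IsIsometric := fun O =>
  ⟨isIsometry_foldl O s.1, by simp [circuitFamily, StageFamily.on]⟩

lemma Circuit.stages_congr (C : Circuit) {O O' : List Bool → Bool}
    (h : ∀ w : List Bool, w.length ≤ C.encode.length → O w = O' w) :
    C.stages O = C.stages O' := by
  refine List.map_congr_left fun s hs => ?_
  have : ∀ ψ, s.1.foldl (fun φ g => g.apply O φ) ψ = s.1.foldl (fun φ g => g.apply O' φ) ψ := by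
    intro ψ
    refine List.foldl_ext _ _ _ fun φ g hg => ?_
    cases g with
    | hadamard q => rfl
    | phase q => rfl
    | cnot c t => rfl
    | oracle qs a =>
      funext b
      have := h (qs.map b) (by rw [List.length_map]; exact C.length_query_le hs hg)
      simp only [Gate.apply, this]
  simp only [this]

/-- On the input `x` the machines `G` and `D` decide with bounded error, in time `T`, whether
`b` holds. -/
def DecidesAt (G D : Machine) (T : ℕ) (O : List Bool → Bool) (x : List Bool) (b : Prop) : Prop :=
  open Classical in
  ∃ C : Circuit, G.Outputs O x [] T C.encode ∧
    (∀ vs : List (Basis (Fin C.width)), vs.length = C.steps.length →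
      ∃ z, D.Outputs O x (encodeSamples vs) T z) ∧
    (b → 2 / 3 ≤ eventProb (C.stages O) (zeroState _)
      (fun vs => decide (D.Outputs O x (encodeSamples vs) T [true]))) ∧
    (¬ b → eventProb (C.stages O) (zeroState _)
      (fun vs => decide (D.Outputs O x (encodeSamples vs) T [true])) ≤ 1 / 3)

/-- The machines ask words of length at most `2 * T`, and the circuit's code, hence its oracle
queries, have at most that length as well. This gives openness in the Baire argument. -/
lemma DecidesAt.congr {G D : Machine} {T : ℕ} {O O' : List Bool → Bool} {x : List Bool} {b : Prop}
    (h : ∀ w : List Bool, w.length ≤ 2 * T → O w = O' w) (hO : DecidesAt G D T O x b) :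
    DecidesAt G D T O' x b := by
  obtain ⟨C, hG, hD, h1, h2⟩ := hO
  have hM : ∀ (M : Machine) y z, M.Outputs O x y T z ↔ M.Outputs O' x y T z := fun M y z =>
    Machine.outputs_congr (fun w hw => h w (Machine.length_le_of_mem_asked hw)) z
  have hC : C.stages O = C.stages O' :=
    C.stages_congr fun w hw => h w (hw.trans hG.length_le)
  classical
  have hA : (fun vs : List (Basis (Fin C.width)) =>
      decide (D.Outputs O x (encodeSamples vs) T [true])) =
      fun vs => decide (D.Outputs O' x (encodeSamples vs) T [true]) := by
    funext vs
    rw [decide_eq_decide]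
    exact hM D _ _
  refine ⟨C, (hM G _ _).1 hG, fun vs hvs => ?_, fun hb => ?_, fun hb => ?_⟩
  · obtain ⟨z, hz⟩ := hD vs hvs
    exact ⟨z, (hM D _ _).1 hz⟩
  · rw [← hC, ← hA]
    exact h1 hb
  · rw [← hC, ← hA]
    exact h2 hb

/-- If `G` and `D` decide a property on the ends of all edges in `E` and `G` sees no difference
between the oracles, then the time is large compared to the degrees. -/
lemma le_of_decidesAt {G D : Machine} {T : ℕ} {x : List Bool} (P : (List Bool → Bool) → Prop)
    {E : Finset ((List Bool → Bool) × List Bool)} {M : Finset (List Bool → Bool)}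
    (hE : ∀ e ∈ E, (flip e.1 e.2, e.2) ∈ E) (hM : ∀ e ∈ E, e.1 ∈ M) (hne : E.Nonempty) {h : ℝ}
    (hdeg : M.card * h ≤ E.card) (hP : ∀ e ∈ E, ¬ (P e.1 ↔ P (flip e.1 e.2)))
    {z : List Bool} (hG : ∀ e ∈ E, G.Outputs e.1 x [] T z)
    (hdec : ∀ e ∈ E, DecidesAt G D T e.1 x (P e.1)) :
    h ≤ 48 * ((2 * T + 1) * (8 * T)) + 4 * T := by
  classical
  obtain ⟨e₀, he₀⟩ := hne
  obtain ⟨C, hC, -⟩ := hdec e₀ he₀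
  have hCz : C.encode = z := hC.unique (hG e₀ he₀)
  have hlen : C.encode.length ≤ 2 * T := hC.length_le
  have hprob : ∀ e ∈ E,
      (P e.1 → 2 / 3 ≤ eventProb (C.stages e.1) (zeroState _)
        (fun vs => decide (D.Outputs e.1 x (encodeSamples vs) T [true]))) ∧
      (¬ P e.1 → eventProb (C.stages e.1) (zeroState _)
        (fun vs => decide (D.Outputs e.1 x (encodeSamples vs) T [true])) ≤ 1 / 3) := by
    intro e he
    obtain ⟨C', hC', -, h1, h2⟩ := hdec e he
    -- One circuit serves for all edges, so the adversary bound compares runs of the same algorithm.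
    have : C' = C := Circuit.encode_injective ((hC'.unique (hG e he)).trans hCz.symm)
    subst this
    constructor
    · intro hp; convert h1 hp
    · intro hp; convert h2 hp
  have key := adversary_bound (K₀ := 0) (T := T) hM ⟨e₀, he₀⟩ hdeg circuitFamily
    (fun s => 4 * (s.1.length : ℝ)) (fun s => by positivity) C.steps
    (fun s _ => ⟨circuitFamily_isIsometric s, perturbs_foldl hE hM s.1⟩)
    (fun _ => zeroState _) (fun _ => normSq_zeroState) (by simp [spread])
    (fun O vs => decide (D.Outputs O x (encodeSamples vs) T [true]))
    (fun O vs => D.asked O x (encodeSamples vs) T)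
    (fun O vs => by exact_mod_cast D.card_asked_le O x (encodeSamples vs) T)
    (by
      intro e _ vs hvs
      -- A final computation that never has the flipped word on its query tape gives the same
      -- verdict for both oracles.
      by_contra hmem
      refine hvs ?_
      rw [decide_eq_decide]
      refine Machine.outputs_congr (fun w hw => ?_) _
      rw [flip_of_ne]
      rintro rfl
      exact hmem hw)
    (by
      intro e he
      rw [C.stages_eq, C.stages_eq]
      have h1 := hprob e he
      have h2 := hprob _ (hE e he)
      have h3 := hP e he
      simp only at h2
      by_cases hp : P e.1
      · have hp' : ¬ P (flip e.1 e.2) := fun hq => h3 ⟨fun _ => hq, fun _ => hp⟩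
        exact le_abs.2 (Or.inl (by linarith [h1.1 hp, h2.2 hp']))
      · have hp' : P (flip e.1 e.2) := by
          by_contra hq
          exact h3 ⟨fun h => absurd h hp, fun h => absurd h hq⟩
        exact le_abs.2 (Or.inr (by linarith [h1.2 hp, h2.1 hp'])))
  -- Every gate is charged 4 as if it were an oracle gate, and there are at most `2 * T` gates.
  have hQ : (C.steps.map fun s => 4 * (s.1.length : ℝ)).sum ≤ 8 * T := by
    have h1 : (((C.steps.map fun s => s.1.length).sum : ℕ) : ℝ) ≤ 2 * T := by
      exact_mod_cast C.sum_length_gates_le.trans hlen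
    rw [List.sum_map_mul_left]
    rw [Nat.cast_list_sum, List.map_map] at h1
    simp only [Function.comp_def] at h1
    linarith
  have hPs : ((C.steps.filter fun s => (circuitFamily s).query.isNone).length : ℝ) ≤ 2 * T := by
    exact_mod_cast (List.length_filter_le _ _).trans (C.length_steps_le.trans hlen)
  have hsum0 : 0 ≤ (C.steps.map fun s => 4 * (s.1.length : ℝ)).sum :=
    List.sum_nonneg (by simp only [List.mem_map]; rintro _ ⟨s, _, rfl⟩; positivity)
  rw [zero_add] at key
  refine key.trans ?_
  gcongr

end

/-! ### Diagonalization against PDQP -/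

section

/-! ### Counting on one level of the oracle -/

/-- The strings of length `n`. -/
def level (n : ℕ) : Finset (List Bool) :=
  Finset.univ.image fun y : Fin n → Bool => (List.ofFn y).reverse

lemma reverse_ofFn_injective (n : ℕ) :
    Function.Injective fun y : Fin n → Bool => (List.ofFn y).reverse :=
  List.reverse_injective.comp List.ofFn_injective

lemma card_level (n : ℕ) : (level n).card = 2 ^ n := by
  rw [level, Finset.card_image_of_injective _ (reverse_ofFn_injective n)]
  simp

lemma length_of_mem_level {n : ℕ} {w : List Bool} (hw : w ∈ level n) : w.length = n := by
  obtain ⟨y, -, rfl⟩ := Finset.mem_image.1 hw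
  simp

/-- The number of strings of length `n` in the oracle. -/
def levelCount (O : List Bool → Bool) (n : ℕ) : ℕ := ((level n).filter fun w => O w = true).card

lemma levelCount_congr {O O' : List Bool → Bool} {n : ℕ}
    (h : ∀ w : List Bool, w.length = n → O w = O' w) : levelCount O n = levelCount O' n := by
  unfold levelCount
  congr 1
  exact Finset.filter_congr fun w hw => by rw [h w (length_of_mem_level hw)]

/-- The oracle `O₀` with its level `n` replaced by the set `s`. -/
def setLevel (O₀ : List Bool → Bool) (n : ℕ) (s : Finset (List Bool)) (w : List Bool) : Bool :=
  if w ∈ level n then decide (w ∈ s) else O₀ w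

lemma levelCount_setLevel (O₀ : List Bool → Bool) {n : ℕ} {s : Finset (List Bool)}
    (hs : s ⊆ level n) : levelCount (setLevel O₀ n s) n = s.card := by
  unfold levelCount
  congr 1
  ext w
  rw [Finset.mem_filter, setLevel]
  constructor
  · rintro ⟨hw, h⟩
    simpa [hw] using h
  · intro h
    simp [hs h, h]

/-- Add or remove an element. -/
def toggle (s : Finset (List Bool)) (w : List Bool) : Finset (List Bool) :=
  if w ∈ s then s.erase w else insert w s

lemma toggle_toggle (s : Finset (List Bool)) (w : List Bool) : toggle (toggle s w) w = s := by
  by_cases h : w ∈ s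
  · simp [toggle, h]
  · simp [toggle, h]

lemma toggle_subset {s A : Finset (List Bool)} {w : List Bool} (hs : s ⊆ A) (hw : w ∈ A) :
    toggle s w ⊆ A := by
  unfold toggle
  split_ifs
  · exact (Finset.erase_subset _ _).trans hs
  · exact Finset.insert_subset hw hs

lemma card_toggle (s : Finset (List Bool)) (w : List Bool) :
    (toggle s w).card + (if w ∈ s then 1 else 0) = s.card + if w ∈ s then 0 else 1 := by
  unfold toggle
  split_ifs with h
  · exact Finset.card_erase_add_one h
  · exact Finset.card_insert_of_notMem h

lemma flip_setLevel (O₀ : List Bool → Bool) {n : ℕ} (s : Finset (List Bool)) {w : List Bool}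
    (hw : w ∈ level n) : flip (setLevel O₀ n s) w = setLevel O₀ n (toggle s w) := by
  funext v
  by_cases hv : v = w
  · subst hv
    rw [flip_self]
    by_cases h : v ∈ s <;> simp [setLevel, hw, toggle, h]
  · rw [flip_of_ne _ hv]
    by_cases h : w ∈ s <;> simp [setLevel, toggle, h, hv]

/-- A property of the number of strings on level `n` such that many bits are sensitive wherever
there is a sensitive bit is not decided for all oracles. -/
lemma exists_not_decidesAt (G D : Machine) (T : ℕ) (x : List Bool) (O₀ : List Bool → Bool) (n : ℕ)
    (Q : ℕ → Prop) {h : ℝ}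
    (hex : ∀ A ⊆ level n, 2 ^ n ≤ A.card + T →
      ∃ s ⊆ A, ∃ w ∈ A, ¬ (Q s.card ↔ Q (toggle s w).card))
    (hQ : ∀ A ⊆ level n, 2 ^ n ≤ A.card + T → ∀ s ⊆ A, ∀ w ∈ A, ¬ (Q s.card ↔ Q (toggle s w).card) →
      ∃ B ⊆ A, h ≤ B.card ∧ ∀ v ∈ B, ¬ (Q s.card ↔ Q (toggle s v).card))
    (hbig : 48 * ((2 * (T : ℝ) + 1) * (8 * T)) + 4 * T < h) :
    ∃ O : List Bool → Bool, (∀ w, w.length ≠ n → O w = O₀ w) ∧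
      ¬ DecidesAt G D T O x (Q (levelCount O n)) := by
  classical
  by_contra hcon
  push Not at hcon
  have hdec : ∀ s, DecidesAt G D T (setLevel O₀ n s) x (Q (levelCount (setLevel O₀ n s) n)) :=
    fun s => hcon _ fun w hw => by
      rw [setLevel, if_neg fun h => hw (length_of_mem_level h)]
  -- Words asked during circuit generation are kept out of the oracle. Varying only the words of `A`
  -- leaves the run of `G`, and thus the circuit, unchanged.
  set K := G.asked (setLevel O₀ n ∅) x [] T
  set A := level n \ K with hA
  have hAl : A ⊆ level n := Finset.sdiff_subset
  have hAcard : 2 ^ n ≤ A.card + T := by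
    have h1 := Finset.le_card_sdiff K (level n)
    have h2 : K.card ≤ T := G.card_asked_le (setLevel O₀ n ∅) x [] T
    rw [card_level, ← hA] at h1
    omega
  obtain ⟨C, hC, -⟩ := hdec ∅
  have hG : ∀ s ⊆ A, G.Outputs (setLevel O₀ n s) x [] T C.encode := by
    intro s hs
    refine (Machine.outputs_congr (fun w hw => ?_) _).1 hC
    unfold setLevel
    split_ifs with hl
    · have : w ∉ s := fun hws => (Finset.mem_sdiff.1 (hs hws)).2 hw
      simp [this]
    · rfl
  set S := (A.powerset ×ˢ A).filter fun q => ¬ (Q q.1.card ↔ Q (toggle q.1 q.2).card) with hS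
  set E := S.image fun q => (setLevel O₀ n q.1, q.2) with hE
  have hmemE : ∀ e ∈ E, ∃ s ⊆ A, ∃ w ∈ A, ¬ (Q s.card ↔ Q (toggle s w).card) ∧
      e = (setLevel O₀ n s, w) := by
    intro e he
    obtain ⟨⟨s, w⟩, hq, rfl⟩ := Finset.mem_image.1 he
    simp only [hS, Finset.mem_filter, Finset.mem_product, Finset.mem_powerset] at hq
    exact ⟨s, hq.1.1, w, hq.1.2, hq.2, rfl⟩
  have hEmem : ∀ s ⊆ A, ∀ w ∈ A, ¬ (Q s.card ↔ Q (toggle s w).card) →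
      (setLevel O₀ n s, w) ∈ E := by
    intro s hs w hw hsw
    refine Finset.mem_image.2 ⟨(s, w), ?_, rfl⟩
    simp only [hS, Finset.mem_filter, Finset.mem_product, Finset.mem_powerset]
    exact ⟨⟨hs, hw⟩, hsw⟩
  set M := E.image Prod.fst
  have hM : ∀ e ∈ E, e.1 ∈ M := fun e he => Finset.mem_image_of_mem _ he
  have hdeg : M.card * h ≤ E.card := by
    rw [Finset.card_eq_sum_card_fiberwise hM, ← nsmul_eq_mul]
    push_cast
    refine Finset.card_nsmul_le_sum _ _ _ fun O hO => ?_
    obtain ⟨e, he, rfl⟩ := Finset.mem_image.1 hO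
    obtain ⟨s, hs, w, hw, hsw, rfl⟩ := hmemE e he
    -- Every point of `M` is an end of an edge, so `hQ` gives it at least `h` edges.
    obtain ⟨B, hBA, hB, hBs⟩ := hQ A hAl hAcard s hs w hw hsw
    refine hB.trans ?_
    norm_cast
    refine Finset.card_le_card_of_injOn (fun v => (setLevel O₀ n s, v)) (fun v hv => ?_)
      fun v _ v' _ hvv => congrArg Prod.snd hvv
    exact Finset.mem_coe.2 (Finset.mem_filter.2 ⟨hEmem s hs v (hBA hv) (hBs v hv), rfl⟩)
  have hle := le_of_decidesAt (fun O => Q (levelCount O n)) (E := E) (M := M) (h := h) ?_ hM ?_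
    hdeg ?_ (z := C.encode) ?_ ?_ (G := G) (D := D) (x := x) (T := T)
  · linarith
  · intro e he
    obtain ⟨s, hs, w, hw, hsw, rfl⟩ := hmemE e he
    simp only
    rw [flip_setLevel _ _ (hAl hw)]
    refine hEmem _ (toggle_subset hs hw) w hw ?_
    rw [toggle_toggle]
    exact fun h => hsw h.symm
  · obtain ⟨s, hs, w, hw, hsw⟩ := hex A hAl hAcard
    exact ⟨_, hEmem s hs w hw hsw⟩
  · intro e he
    obtain ⟨s, hs, w, hw, hsw, rfl⟩ := hmemE e he
    simp only
    rw [flip_setLevel _ _ (hAl hw), levelCount_setLevel _ (hs.trans hAl),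
      levelCount_setLevel _ ((toggle_subset hs hw).trans hAl)]
    exact hsw
  · intro e he
    obtain ⟨s, hs, w, hw, hsw, rfl⟩ := hmemE e he
    exact hG s hs
  · intro e he
    obtain ⟨s, hs, w, hw, hsw, rfl⟩ := hmemE e he
    exact hdec s

/-- Every alteration of an oracle on a high enough level can spoil a decision procedure for the
property `Q n` of the number of strings on level `n`. -/
def IsHardCount (Q : ℕ → ℕ → Prop) : Prop :=
  ∀ (G D : Machine) (p : Polynomial ℕ) (O₀ : List Bool → Bool) (m : ℕ), ∃ n ≥ m,
    ∃ O : List Bool → Bool, (∀ w, w.length ≠ n → O w = O₀ w) ∧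
      ¬ DecidesAt G D (p.eval n) O (List.replicate n true) (Q n (levelCount O n))

lemma tendsto_polynomial_div_two_pow (q : Polynomial ℕ) :
    Filter.Tendsto (fun n : ℕ => ((q.eval n : ℕ) : ℝ) / 2 ^ n) Filter.atTop (nhds 0) := by
  induction q using Polynomial.induction_on' with
  | add p q hp hq =>
    simpa [add_div] using hp.add hq
  | monomial k a =>
    have := (tendsto_pow_const_div_const_pow_of_one_lt k (by norm_num : (1 : ℝ) < 2)).const_mul
      (a : ℝ)
    simpa [Polynomial.eval_monomial, mul_div_assoc] using this

lemma exists_polynomial_lt_two_pow (q : Polynomial ℕ) (m : ℕ) :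
    ∃ n ≥ m, 1 ≤ n ∧ q.eval n < 2 ^ (n - 1) := by
  have h := (tendsto_polynomial_div_two_pow q).eventually
    (gt_mem_nhds (by norm_num : (0 : ℝ) < 1 / 2))
  obtain ⟨n, hn, hnm⟩ := (h.and (Filter.eventually_ge_atTop (m + 1))).exists
  refine ⟨n, by omega, by omega, ?_⟩
  rw [div_lt_iff₀ (by positivity)] at hn
  have h2 : (2 : ℝ) ^ n = 2 * 2 ^ (n - 1) := by
    rw [← pow_succ']
    congr 1
    omega
  rw [h2] at hn
  have : ((q.eval n : ℕ) : ℝ) < 2 ^ (n - 1) := by linarith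
  exact_mod_cast this

lemma isHardCount_of_sensitive (Q : ℕ → ℕ → Prop)
    (hex : ∀ n T, 1 ≤ n → T < 2 ^ (n - 1) → ∀ A ⊆ level n, 2 ^ n ≤ A.card + T →
      ∃ s ⊆ A, ∃ w ∈ A, ¬ (Q n s.card ↔ Q n (toggle s w).card))
    (hQ : ∀ n T, 1 ≤ n → ∀ A ⊆ level n, 2 ^ n ≤ A.card + T → ∀ s ⊆ A, ∀ w ∈ A,
      ¬ (Q n s.card ↔ Q n (toggle s w).card) →
      ∃ B ⊆ A, 2 ^ (n - 1) ≤ B.card + T ∧ ∀ v ∈ B, ¬ (Q n s.card ↔ Q n (toggle s v).card)) :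
    IsHardCount Q := by
  intro G D p O₀ m
  -- The adversary bound contributes `4 * T`; one more `T` accounts for the discarded words in `h =
  -- 2^(n-1) - T`.
  obtain ⟨n, hnm, hn1, hn⟩ := exists_polynomial_lt_two_pow
    (48 * ((2 * p + 1) * (8 * p)) + 5 * p) m
  simp only [Polynomial.eval_add, Polynomial.eval_mul, Polynomial.eval_ofNat,
    Polynomial.eval_one] at hn
  set T := p.eval n
  have hT : T < 2 ^ (n - 1) := lt_of_le_of_lt (by omega) hn
  refine ⟨n, hnm, exists_not_decidesAt G D T _ O₀ n (Q n) (h := (2 : ℝ) ^ (n - 1) - T)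
    (hex n T hn1 hT) ?_ ?_⟩
  · intro A hA hAc s hs w hw hsw
    obtain ⟨B, hB, hBc, hBs⟩ := hQ n T hn1 A hA hAc s hs w hw hsw
    refine ⟨B, hB, ?_, hBs⟩
    have : (2 : ℝ) ^ (n - 1) ≤ B.card + T := by exact_mod_cast hBc
    linarith
  · have : (48 * ((2 * (T : ℝ) + 1) * (8 * T)) + 5 * T) < 2 ^ (n - 1) := by exact_mod_cast hn
    linarith

lemma isHardCount_odd : IsHardCount fun _ c => Odd c := by
  have hs : ∀ (s : Finset (List Bool)) w, ¬ (Odd s.card ↔ Odd (toggle s w).card) := by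
    intro s w
    have := card_toggle s w
    simp only [Nat.odd_iff]
    split_ifs at this <;> omega
  refine isHardCount_of_sensitive _ ?_ ?_
  · intro n T hn hT A _ hAc
    have h2 : 2 ^ n = 2 * 2 ^ (n - 1) := by rw [← pow_succ']; congr 1; omega
    obtain ⟨w, hw⟩ := Finset.card_pos.1 (by omega : 0 < A.card)
    exact ⟨∅, by simp, w, hw, hs _ _⟩
  · intro n T hn A _ hAc s _ w _ _
    have h2 : 2 ^ n = 2 * 2 ^ (n - 1) := by rw [← pow_succ']; congr 1; omega
    exact ⟨A, subset_rfl, by omega, fun v _ => hs s v⟩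

lemma isHardCount_majority : IsHardCount fun n c => 2 ^ n < 2 * c := by
  refine isHardCount_of_sensitive _ ?_ ?_
  · intro n T hn hT A _ hAc
    have h2 : 2 ^ n = 2 * 2 ^ (n - 1) := by rw [← pow_succ']; congr 1; omega
    -- At exactly half of the level the strict inequality fails, and one more word makes it true.
    obtain ⟨s, hs, hsc⟩ := Finset.exists_subset_card_eq (s := A) (n := 2 ^ (n - 1)) (by omega)
    have hlt : s.card < A.card := by omega
    obtain ⟨w, hw, hws⟩ := Finset.exists_mem_notMem_of_card_lt_card hlt
    refine ⟨s, hs, w, hw, ?_⟩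
    have := card_toggle s w
    simp only [hws, if_false] at this
    omega
  · intro n T hn A _ hAc s hs w hw hsw
    have h2 : 2 ^ n = 2 * 2 ^ (n - 1) := by rw [← pow_succ']; congr 1; omega
    have hc := card_toggle s w
    -- If removing `w` matters, `s` has `2^(n-1) + 1` elements and removing any of them matters. If
    -- adding `w` matters, `s` has `2^(n-1)` elements and adding any word of `A \ s` matters.
    by_cases hws : w ∈ s
    · simp only [hws, if_true] at hc
      refine ⟨s, hs, by omega, fun v hv => ?_⟩
      have hv' := card_toggle s v
      simp only [hv, if_true] at hv'
      omega
    · simp only [hws, if_false] at hc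
      refine ⟨A \ s, Finset.sdiff_subset, ?_, fun v hv => ?_⟩
      · rw [Finset.card_sdiff_of_subset hs]
        have := Finset.card_le_card hs
        omega
      · have hv' := card_toggle s v
        simp only [(Finset.mem_sdiff.1 hv).2, if_false] at hv'
        omega

/-! ### Generic oracles -/

instance : Countable Move :=
  Function.Injective.countable (f := fun m : Move => match m with
    | Move.left => (0 : ℕ) | Move.stay => 1 | Move.right => 2)
    (by intro a b; cases a <;> cases b <;> simp)

instance (σ κ : Type) [Countable σ] [Finite κ] : Countable (Command σ κ) :=
  Function.Injective.countable (f := fun c : Command σ κ => match c with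
    | Command.halt => (none : Option ((σ × (κ → Option Bool) × (κ → Move)) ⊕ (σ × σ)))
    | Command.act q w m => some (Sum.inl (q, w, m))
    | Command.ask y n => some (Sum.inr (y, n)))
    (by intro a b; cases a <;> cases b <;> simp)

instance : Countable Machine :=
  Function.Injective.countable (β := Σ n : ℕ × ℕ, Fin (n.1 + 1) → (Fin (n.2 + 4) → Option Bool) →
      Command (Fin (n.1 + 1)) (Fin (n.2 + 4))) (f := fun M => ⟨(M.states, M.work), M.command⟩)
    (by
      rintro ⟨s, w, c⟩ ⟨s', w', c'⟩ h
      simp only [Sigma.mk.injEq, Prod.mk.injEq] at h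
      obtain ⟨⟨rfl, rfl⟩, h⟩ := h
      rw [eq_of_heq h])

lemma countable_polynomial_nat : Countable (Polynomial ℕ) :=
  Function.Injective.countable (f := fun p : Polynomial ℕ =>
    (List.range (p.natDegree + 1)).map p.coeff) (by
      intro p q h
      have hl : p.natDegree = q.natDegree := by
        simpa using congrArg List.length h
      ext k
      by_cases hk : k ≤ p.natDegree
      · have := congrArg (fun l => l[k]?) h
        simpa [hk, hl ▸ hk, Nat.lt_succ_iff] using this
      · rw [Polynomial.coeff_eq_zero_of_natDegree_lt (by omega),
          Polynomial.coeff_eq_zero_of_natDegree_lt (by omega)])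

lemma isOpen_agree (O : List Bool → Bool) (R : ℕ) :
    IsOpen {O' : List Bool → Bool | ∀ w : List Bool, w.length ≤ R → O' w = O w} := by
  have := isOpen_set_pi (List.finite_length_le Bool R) (s := fun w => ({O w} : Set Bool))
    fun _ _ => isOpen_discrete _
  convert this using 1
  ext O'
  simp [Set.mem_pi]

/-- For a generic oracle the language given by a hard counting property is not in `PDQP`. -/
theorem exists_oracle_notMem_PDQP {Q : ℕ → ℕ → Prop} (hQ : IsHardCount Q) :
    ∃ O : List Bool → Bool, {x : List Bool | Q x.length (levelCount O x.length)} ∉ PDQP O := by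
  have := countable_polynomial_nat
  set V : Machine × Machine × Polynomial ℕ → Set (List Bool → Bool) := fun t =>
    {O | ∃ n, ¬ DecidesAt t.1 t.2.1 (t.2.2.eval n) O (List.replicate n true)
      (Q n (levelCount O n))}
  have hopen : ∀ t, IsOpen (V t) := by
    intro t
    rw [isOpen_iff_mem_nhds]
    rintro O ⟨n, hn⟩
    refine Filter.mem_of_superset ((isOpen_agree O (max n (2 * t.2.2.eval n))).mem_nhds
      fun w _ => rfl) ?_
    intro O' hO'
    refine ⟨n, fun hdec => hn ?_⟩
    rw [← levelCount_congr (O := O') (O' := O) fun w hw => hO' w (by omega)]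
    exact hdec.congr fun w hw => hO' w (hw.trans (le_max_right _ _))
  have hdense : ∀ t, Dense (V t) := by
    intro t
    rw [dense_iff_inter_open]
    rintro U hU ⟨O₀, hO₀⟩
    -- A basic open set constrains finitely many words only; altering a level beyond their lengths
    -- stays inside it.
    obtain ⟨I, u, hu, hsub⟩ := isOpen_pi_iff.1 hU O₀ hO₀
    obtain ⟨n, hn, O, hO, hdec⟩ := hQ t.1 t.2.1 t.2.2 O₀ (I.sup List.length + 1)
    refine ⟨O, hsub fun w hw => ?_, n, hdec⟩
    have : w.length ≤ I.sup List.length := Finset.le_sup (f := List.length) hw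
    rw [hO w (by omega)]
    exact (hu w hw).2
  -- Baire category in the Cantor space of oracles, over the countably many triples of two machines
  -- and a polynomial time bound.
  obtain ⟨O, hO⟩ := (dense_iInter_of_isOpen hopen hdense).nonempty
  refine ⟨O, ?_⟩
  rintro ⟨G, D, p, h⟩
  obtain ⟨n, hn⟩ := Set.mem_iInter.1 hO (G, D, p)
  refine hn ?_
  have key : DecidesAt G D (p.eval (List.replicate n true).length) O (List.replicate n true)
      (Q (List.replicate n true).length (levelCount O (List.replicate n true).length)) := h _
  rw [List.length_replicate] at key
  exact key

end

/-! ### The counting languages lie in PP and ⊕P -/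

section

/-! ### A machine that asks for its second input -/

/-- The machine that copies its second input in reverse order on the query tape, asks the oracle,
and writes `1` on the output tape if the answer is yes. -/
def askMachine : Machine where
  states := 3
  work := 0
  command := fun q r =>
    if q = 0 then
      match r 1 with
      | some b => Command.act 0 (fun i => if i = 2 then some b else r i)
          (fun i => if i = 1 then Move.right else if i = 2 then Move.left else Move.stay)
      | none => Command.act 1 r (fun i => if i = 2 then Move.right else Move.stay)
    else if q = 1 then Command.ask 2 3
    else if q = 2 then
      Command.act 3 (fun i => if i = 3 then some true else r i) (fun _ => Move.stay)
    else Command.halt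

lemma Machine.next_of_act {M : Machine} {c : M.Config} {q : Fin (M.states + 1)}
    {w : Fin (M.work + 4) → Option Bool} {m : Fin (M.work + 4) → Move}
    (h : M.current c = Command.act q w m) (O : List Bool → Bool) :
    M.next O c = ⟨q, fun i => ((c.tapes i).write (w i)).move (m i)⟩ := by
  rw [Machine.next, h]

/-- The state of the tapes while the input is copied: `v` is left and `u` has been copied. -/
structure Copying (c : askMachine.Config) (v u : List Bool) : Prop where
  state : c.state = (0 : Fin 4)
  input : (c.tapes (1 : Fin 4)).right = v.map some
  copy : (c.tapes (2 : Fin 4)).right.tail = u.map some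
  left : (c.tapes (2 : Fin 4)).left = []
  read_output : (c.tapes (3 : Fin 4)).read = none
  output : (c.tapes (3 : Fin 4)).right.tail = []

/-- The state of the tapes when the query `u` is ready. -/
structure Asking (c : askMachine.Config) (u : List Bool) : Prop where
  state : c.state = (1 : Fin 4)
  query : (c.tapes (2 : Fin 4)).right = u.map some
  read_output : (c.tapes (3 : Fin 4)).read = none
  output : (c.tapes (3 : Fin 4)).right.tail = []

/-- The query head stays on the blank to the left of the copy and writes leftwards, so the copy is
reversed. On the output tape, rewriting a blank creates an explicit blank cell; hence the invariant
fixes its head symbol and tail, not the list itself. -/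
lemma Copying.next_cons {c : askMachine.Config} {b : Bool} {v u : List Bool}
    (h : Copying c (b :: v) u) (O : List Bool → Bool) :
    Copying (askMachine.next O c) v (b :: u) := by
  have hr : (c.tapes (1 : Fin 4)).read = some b := by simp [Tape.read, h.input]
  have hcur : askMachine.current c = Command.act (0 : Fin 4)
      (fun i : Fin 4 => if i = 2 then some b else (c.tapes i).read)
      (fun i : Fin 4 => if i = 1 then Move.right else if i = 2 then Move.left else Move.stay) := by
    simp only [Machine.current, askMachine, h.state, if_true]
    rw [hr]
  rw [Machine.next_of_act hcur]
  refine ⟨rfl, ?_, ?_, ?_, ?_, ?_⟩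
  · simp [Tape.write, Tape.move, h.input]
  · simp [Tape.write, Tape.move, h.copy]
  · simp [Tape.write, Tape.move, h.left]
  · simpa [Tape.write, Tape.move, Tape.read] using h.read_output
  · simpa [Tape.write, Tape.move] using h.output

lemma Copying.next_nil {c : askMachine.Config} {u : List Bool} (h : Copying c [] u)
    (O : List Bool → Bool) : Asking (askMachine.next O c) u := by
  have hr : (c.tapes (1 : Fin 4)).read = none := by simp [Tape.read, h.input]
  have hcur : askMachine.current c = Command.act (1 : Fin 4)
      (fun i : Fin 4 => (c.tapes i).read)
      (fun i : Fin 4 => if i = 2 then Move.right else Move.stay) := by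
    simp only [Machine.current, askMachine, h.state, if_true]
    rw [hr]
  rw [Machine.next_of_act hcur]
  refine ⟨rfl, ?_, ?_, ?_⟩
  · simp [Tape.write, Tape.move, h.copy]
  · simpa [Tape.write, Tape.move, Tape.read] using h.read_output
  · simpa [Tape.write, Tape.move] using h.output

lemma Copying.iterate {c : askMachine.Config} {v u : List Bool} (h : Copying c v u)
    (O : List Bool → Bool) :
    Asking ((askMachine.next O)^[v.length + 1] c) (v.reverse ++ u) := by
  induction v generalizing c u with
  | nil => simpa using h.next_nil O
  | cons b v ih =>
    have := ih (h.next_cons O)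
    rw [List.length_cons, Function.iterate_succ_apply]
    simpa using this

lemma Tape.word_eq {t : Tape} {u : List Bool} (h : t.right = u.map some) : t.word = u := by
  rw [Tape.word, h]
  clear h
  induction u with
  | nil => rfl
  | cons b u ih => simp [List.reduceOption_cons_of_some, ih]

lemma Tape.word_eq_nil {t : Tape} (h : t.read = none) : t.word = [] := by
  obtain ⟨l, r⟩ := t
  cases r with
  | nil => rfl
  | cons a r =>
    simp only [Tape.read, List.headD_cons] at h
    subst h
    rfl

lemma Asking.outputs {c : askMachine.Config} {u : List Bool} (h : Asking c u)
    (O : List Bool → Bool) :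
    askMachine.current ((askMachine.next O)^[2] c) = Command.halt ∧
      (((askMachine.next O)^[2] c).tapes (3 : Fin 4)).word = if O u then [true] else [] := by
  have hcur : askMachine.current c = Command.ask (2 : Fin 4) (3 : Fin 4) := by
    simp [Machine.current, askMachine, h.state]
  have hw : (c.tapes (2 : Fin 4)).word = u := Tape.word_eq h.query
  have hn : askMachine.next O c = ⟨if O u then (2 : Fin 4) else (3 : Fin 4), c.tapes⟩ := by
    rw [Machine.next, hcur]
    simp only
    rw [← hw]
    rfl
  have hhalt : ∀ d : askMachine.Config, d.state = (3 : Fin 4) →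
      askMachine.current d = Command.halt := by
    intro d hd
    simp [Machine.current, askMachine, hd]
  rw [Function.iterate_succ_apply, Function.iterate_one, hn]
  cases O u
  · set d : askMachine.Config := ⟨if false = true then (2 : Fin 4) else (3 : Fin 4), c.tapes⟩
    have hd := hhalt d rfl
    have hnd : askMachine.next O d = d := by rw [Machine.next, hd]
    rw [hnd]
    exact ⟨hd, Tape.word_eq_nil h.read_output⟩
  · set d : askMachine.Config := ⟨if true = true then (2 : Fin 4) else (3 : Fin 4), c.tapes⟩
    have hd : askMachine.current d = Command.act (3 : Fin 4)
        (fun i : Fin 4 => if i = 3 then some true else (c.tapes i).read) (fun _ => Move.stay) := by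
      simp [Machine.current, askMachine, d]
    rw [Machine.next_of_act hd]
    refine ⟨hhalt _ rfl, Tape.word_eq ?_⟩
    simp [Tape.write, Tape.move, h.output, d]

/-- The copying takes `y.length + 1` steps, the last of which moves the query head onto the first
letter; then come the question and the writing of the answer. After the answer no, the machine is
already halted during the last step. -/
lemma askMachine_outputs (O : List Bool → Bool) (x y z : List Bool) :
    askMachine.Outputs O x y (y.length + 3) z ↔ (if O y.reverse then [true] else []) = z := by
  have h0 : Copying (askMachine.start x y) y [] :=
    ⟨rfl, rfl, rfl, rfl, rfl, rfl⟩
  have h1 := h0.iterate O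
  rw [List.append_nil] at h1
  have h2 := h1.outputs O
  rw [← Function.iterate_add_apply, show 2 + (y.length + 1) = y.length + 3 by ring] at h2
  rw [← h2.2]
  exact ⟨fun h => h.2, fun h => ⟨h2.1, h⟩⟩

/-- Reversal is a bijection of the words of length `n`; `level` is defined with it so that witnesses
match queries directly. -/
lemma acceptCount_askMachine (O : List Bool → Bool) (x : List Bool) (n : ℕ) :
    acceptCount askMachine O x n (n + 3) = levelCount O n := by
  have h : ∀ y : Fin n → Bool, askMachine.Outputs O x (List.ofFn y) (n + 3) [true] ↔
      O (List.ofFn y).reverse = true := by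
    intro y
    have := askMachine_outputs O x (List.ofFn y) [true]
    rw [List.length_ofFn] at this
    rw [this]
    split_ifs with hO <;> simp [hO]
  rw [acceptCount, levelCount, level, Finset.filter_image,
    Finset.card_image_of_injective _ (reverse_ofFn_injective n), Nat.card_congr
      (Equiv.subtypeEquivRight h), Nat.card_eq_fintype_card, Fintype.card_subtype]

lemma askMachine_haltsOnAll (O : List Bool → Bool) (x : List Bool) (n : ℕ) :
    HaltsOnAll askMachine O x n (n + 3) := fun y =>
  ⟨_, by simpa using (askMachine_outputs O x (List.ofFn y) _).2 rfl⟩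

lemma levelCount_mem_PP (O : List Bool → Bool) :
    {x : List Bool | 2 ^ x.length < 2 * levelCount O x.length} ∈ PP O := by
  refine ⟨askMachine, Polynomial.X + 3, Polynomial.X, fun x => ?_⟩
  simp only [Polynomial.eval_add, Polynomial.eval_X, Polynomial.eval_ofNat]
  rw [acceptCount_askMachine]
  exact ⟨askMachine_haltsOnAll O x _, Iff.rfl⟩

lemma levelCount_mem_ParityP (O : List Bool → Bool) :
    {x : List Bool | Odd (levelCount O x.length)} ∈ ParityP O := by
  refine ⟨askMachine, Polynomial.X + 3, Polynomial.X, fun x => ?_⟩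
  simp only [Polynomial.eval_add, Polynomial.eval_X, Polynomial.eval_ofNat]
  rw [acceptCount_askMachine]
  exact ⟨askMachine_haltsOnAll O x _, Iff.rfl⟩

end

end

end Noncollapsing

theorem mainTheorem8 :
    Noncollapsing.IsThetaTildeSqrt (fun N => Noncollapsing.complexity (Noncollapsing.majority N)) ∧
    Noncollapsing.IsThetaTildeSqrt (fun N => Noncollapsing.nonadaptiveComplexity (Noncollapsing.majority N)) ∧
    Noncollapsing.IsThetaTildeSqrt (fun N => Noncollapsing.complexity (Noncollapsing.parity N)) ∧
    Noncollapsing.IsThetaTildeSqrt (fun N => Noncollapsing.nonadaptiveComplexity (Noncollapsing.parity N)) ∧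
    (∃ O : List Bool → Bool, ¬ Noncollapsing.PP O ⊆ Noncollapsing.PDQP O) ∧
    (∃ O : List Bool → Bool, ¬ Noncollapsing.ParityP O ⊆ Noncollapsing.PDQP O) := by
  open Noncollapsing in
  refine ⟨
    isThetaTildeSqrt_complexity majority (fun _ => sensEdges_majority_nonempty)
      half_le_sensitivity_majority,
    isThetaTildeSqrt_nonadaptiveComplexity majority (fun _ => sensEdges_majority_nonempty)
      half_le_sensitivity_majority,
    isThetaTildeSqrt_complexity parity (fun _ => sensEdges_parity_nonempty)
      half_le_sensitivity_parity,
    isThetaTildeSqrt_nonadaptiveComplexity parity (fun _ => sensEdges_parity_nonempty)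
      half_le_sensitivity_parity, ?_, ?_⟩
  · obtain ⟨O, hO⟩ := exists_oracle_notMem_PDQP isHardCount_majority
    exact ⟨O, fun h => hO (h (levelCount_mem_PP O))⟩
  · obtain ⟨O, hO⟩ := exists_oracle_notMem_PDQP isHardCount_odd
    exact ⟨O, fun h => hO (h (levelCount_mem_ParityP O))⟩
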